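/- Work over $\mathbb{C}$ and let $d\ge 2$. A *quasi-Veronese curve* in $\mathbb{P}^d$ is a complete, connected, reduced curve of degree $d$ in $\mathbb{P}^d$ that is not contained in a hyperplane. A *rational normal curve* in $\mathbb{P}^d$ is the image of $[s:t]\mapsto[s^d:s^{d-1}t:\cdots:t^d]$ up to a projective automorphism of $\mathbb{P}^d$. Points of $\mathbb{P}^d$ are in *general linear position* if no $d+1$ of them lie on a hyperplane. Let $P_1,\dots,P_{d+4}$ be (not necessarily distinct) points in $\mathbb{P}^d$. For $I=\{i_1<\cdots<i_6\}\subseteq\{1,\dots,d+4\}$ with complement $I^c=\{j_1<\cdots<j_{d-2}\}$, consider the following $d+1$ points: - the intersection of the line $P_{i_1}P_{i_2}$ with the hyperplane $P_{i_4}P_{i_5}P_{j_1}\cdots P_{j_{d-2}}$; - the intersection of the line $P_{i_2}P_{i_3}$ with the hyperplane $P_{i_5}P_{i_6}P_{j_1}\cdots P_{j_{d-2}}$; - the intersection of the line $P_{i_3}P_{i_4}$ with the hyperplane $P_{i_6}P_{i_1}P_{j_1}\cdots P_{j_{d-2}}$; - the points $P_{j_1},\dots,P_{j_{d-2}}$.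 Let $(\ast)$ be the condition that for every such $I$ these $d+1$ points lie on a hyperplane, where no condition is imposed by those $I$ for which one of the three intersections is degenerate (that is, the two points do not span a line, or the $d$ points do not span a hyperplane, or the line is contained in the hyperplane). 1. If $P_1,\dots,P_{d+4}$ do not lie on a hyperplane, then they lie on a quasi-Veronese curve if and only if $(\ast)$ holds. 2. If $P_1,\dots,P_{d+4}$ are in general linear position, then for every $I$ each of the three intersections is a single point, and $P_1,\dots,P_{d+4}$ lie on a rational normal curve if and only if $(\ast)$ holds. -/

import Mathlib

/-- Complex projective space `ℙ^d`: the lines through the origin of `ℂ^(d+1)`. -/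
abbrev ProjSpace (d : ℕ) : Type := Projectivization ℂ (Fin (d + 1) → ℂ)

/-- The points of `S` lie on a common hyperplane of `ℙ^d`. -/
def OnHyperplane {d : ℕ} (S : Set (ProjSpace d)) : Prop :=
  ∃ φ : Module.Dual ℂ (Fin (d + 1) → ℂ), φ ≠ 0 ∧ ∀ p ∈ S, p.submodule ≤ LinearMap.ker φ

/-- The linear subspace of `ℂ^(d+1)` underlying the projective span of `S`. -/
noncomputable def linSpan {d : ℕ} (S : Set (ProjSpace d)) : Submodule ℂ (Fin (d + 1) → ℂ) :=
  ⨆ p ∈ S, p.submodule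

/-- General linear position: no `d + 1` of the points lie on a hyperplane. -/
def GeneralLinearPosition {d n : ℕ} (P : Fin n → ProjSpace d) : Prop :=
  ∀ S : Finset (Fin n), S.card = d + 1 → ¬ OnHyperplane (P '' (S : Set (Fin n)))

/-! ### Curves in projective space -/

/-- The Zariski topology on `ℙ^d`: its open sets are the unions of sets `{f ≠ 0}`, `f` a form.
(For a form `f`, whether `f` vanishes at `p` does not depend on the representative of `p`, and
the sets `{f ≠ 0}` are stable under finite intersections.) -/
@[reducible] def zariskiTopology (d : ℕ) : TopologicalSpace (ProjSpace d) :=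
  TopologicalSpace.generateFrom
    {U | ∃ (m : ℕ) (f : MvPolynomial (Fin (d + 1)) ℂ), f.IsHomogeneous m ∧
      U = {p | MvPolynomial.eval p.rep f ≠ 0}}

/-- The degree `m` part of the homogeneous ideal of `C`: the forms of degree `m` vanishing
on `C`. -/
def vanishingForms {d : ℕ} (C : Set (ProjSpace d)) (m : ℕ) :
    Submodule ℂ (MvPolynomial.homogeneousSubmodule (Fin (d + 1)) ℂ m) where
  carrier := {f | ∀ p ∈ C, MvPolynomial.eval p.rep (f : MvPolynomial (Fin (d + 1)) ℂ) = 0}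
  zero_mem' := by intro p _; simp
  add_mem' := by
    intro f g hf hg p hp
    simp [hf p hp, hg p hp]
  smul_mem' := by
    intro c f hf p hp
    simp [MvPolynomial.smul_eval, hf p hp]

/-- The Hilbert function of `C`: the dimension of the degree `m` part of the homogeneous
coordinate ring of `C`. -/
noncomputable def hilbertFunction {d : ℕ} (C : Set (ProjSpace d)) (m : ℕ) : ℕ :=
  Module.finrank ℂ
    (MvPolynomial.homogeneousSubmodule (Fin (d + 1)) ℂ m ⧸ vanishingForms C m)

/-- A quasi-Veronese curve in `ℙ^d` (`1 ≤ d`): a complete (that is, Zariski closed in `ℙ^d`),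
connected (reduced) curve of degree `d` not contained in a hyperplane. Being one-dimensional of
degree `d` means that the Hilbert polynomial is `d * m + c`; since `C` is connected, it then has
no zero-dimensional component. -/
structure IsQuasiVeronese {d : ℕ} (C : Set (ProjSpace d)) : Prop where
  isClosed : @IsClosed (ProjSpace d) (zariskiTopology d) C
  isConnected : @IsConnected (ProjSpace d) (zariskiTopology d) C
  degree : ∃ c : ℤ, ∀ᶠ m : ℕ in Filter.atTop, (hilbertFunction C m : ℤ) = d * m + c
  nondegenerate : ¬ OnHyperplane C

/-- The vector of all monomials of degree `d` in `s`, `t`. -/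
def veroneseVector (d : ℕ) (s t : ℂ) : Fin (d + 1) → ℂ :=
  fun k => s ^ (d - (k : ℕ)) * t ^ (k : ℕ)

/-- A rational normal curve in `ℙ^d`: the image of the Veronese embedding
`[s : t] ↦ [s^d : s^(d-1) t : ⋯ : t^d]` of `ℙ^1`, up to a projective automorphism `g`. -/
def IsRationalNormalCurve {d : ℕ} (C : Set (ProjSpace d)) : Prop :=
  ∃ g : (Fin (d + 1) → ℂ) ≃ₗ[ℂ] (Fin (d + 1) → ℂ),
    C = {p | ∃ s t : ℂ, (s, t) ≠ (0, 0) ∧ p.submodule = ℂ ∙ g (veroneseVector d s t)}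

/-! ### The incidence condition -/

/-- `a`, `b` span a line, the points of `S` span a hyperplane, and `x` is the unique point of
intersection of this line with this hyperplane. -/
def MeetsAt {d : ℕ} (a b : ProjSpace d) (S : Set (ProjSpace d)) (x : ProjSpace d) : Prop :=
  Module.finrank ℂ (linSpan {a, b}) = 2 ∧ Module.finrank ℂ (linSpan S) = d ∧
    linSpan {a, b} ⊓ linSpan S = x.submodule

/-- The points `P_j`, for `j` outside of `I = {i 0 < ⋯ < i 5}`. -/
def complementPoints {d : ℕ} (P : Fin (d + 4) → ProjSpace d) (i : Fin 6 ↪o Fin (d + 4)) :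
    Set (ProjSpace d) :=
  P '' (Set.range i)ᶜ

/-- For `I = {i 0 < ⋯ < i 5}`: the points `x`, `y`, `z` are the intersections of the lines
`P_{i 0} P_{i 1}`, `P_{i 1} P_{i 2}`, `P_{i 2} P_{i 3}` with the hyperplanes
`P_{i 3} P_{i 4} P_J`, `P_{i 4} P_{i 5} P_J`, `P_{i 5} P_{i 0} P_J`, where `J` is the complement
of `I`. -/
def IsPascalTriple {d : ℕ} (P : Fin (d + 4) → ProjSpace d) (i : Fin 6 ↪o Fin (d + 4))
    (x y z : ProjSpace d) : Prop :=
  MeetsAt (P (i 0)) (P (i 1)) ({P (i 3), P (i 4)} ∪ complementPoints P i) x ∧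
  MeetsAt (P (i 1)) (P (i 2)) ({P (i 4), P (i 5)} ∪ complementPoints P i) y ∧
  MeetsAt (P (i 2)) (P (i 3)) ({P (i 5), P (i 0)} ∪ complementPoints P i) z

/-- The condition of the higher-dimensional Pascal theorem: for every six-element set `I` of
indices, the three intersection points and the points `P_J` lie on a hyperplane. If for some `I`
one of the three intersections is not a single point of an honest line and an honest hyperplane,
then the corresponding meet in the Grassmann-Cayley algebra is zero, and `I` imposes no
condition. -/
def PascalCondition {d : ℕ} (P : Fin (d + 4) → ProjSpace d) : Prop :=
  ∀ (i : Fin 6 ↪o Fin (d + 4)) (x y z : ProjSpace d), IsPascalTriple P i x y z →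
    OnHyperplane ({x, y, z} ∪ complementPoints P i)

open MvPolynomial

/-! ### Forms, cones and homogeneous ideals -/

/-! Both directions pass through plane conics. A quasi-Veronese curve has the smallest degree that a
connected nondegenerate curve can have, and this forces its projection from d - 2 independent points
of it to lie on a conic. For an irreducible set whose span has vector dimension n + 1, restricting a
space of linear forms to those vanishing at one more point lowers the dimension of its m-th power by
at least m (`finrank_pow_add_le`, a Nakayama argument). Hence the Hilbert function is at least nm +
1. If it is at most nm + c, the three-dimensional space of forms vanishing at n - 2 points has m-th
powers of dimension at most 2m + c, and `exists_quadric_mem` yields a quadratic relation. A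
connected set is built up from irreducible pieces: the slopes of Hilbert functions at least add,
minimality passes to the pieces (`MinimalGrowth.union`), and the conics glue
(`ProjectsToConics.union`). Projecting from P_J then reduces the incidence condition to Pascal's
theorem for a plane hexagon, degenerate ones included (`hexagonBracket_eq_zero_of_conic`).

Conversely, d + 4 vectors spanning dimension d + 1 have a three-dimensional space of relations,
hence a Gale dual of vectors q_k in ℂ³. Projecting from P_J corresponds to restricting q to I
(`IsGaleDual.projection`), and if the determinant of the projected hexagon vanishes, its Gale dual
lies on a conic (`exists_conic_of_hexagon`). For a degenerate I the six q_k lie on a conic anyway.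
Conics have six coefficients, so all q_k lie on a single conic (`exists_conic_of_six`).

The curve is built from this conic (`onMinimalCurve_of_isGaleDual`). On a smooth conic the q_k are
Veronese vectors of parameters [s_k : t_k], and the Gale dual of such vectors has the same
parameters on a rational normal curve (`IsGaleDual.exists_normalCurve`). Otherwise one argues by
induction on the number of vectors: two proportional q_k split off a line or indicate a repeated
point, and two planes split the configuration into two parts sharing a new point. Curves glued at a
point in which their spans meet keep the minimal Hilbert function (`IsMinimalCurve.union`). In
general linear position any three q_k are independent, which leaves only the smooth conic. -/

theorem eval_smul_of_isHomogeneous {σ : Type*} {f : MvPolynomial σ ℂ} {m : ℕ}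
    (hf : f.IsHomogeneous m) (a : ℂ) (v : σ → ℂ) :
    eval (a • v) f = a ^ m * eval v f := by
  classical
  rw [eval_eq, eval_eq, Finset.mul_sum]
  refine Finset.sum_congr rfl fun s hs => ?_
  have hdeg : s.degree = m := (hf.degree_eq_sum_deg_support hs).symm
  have : ∏ i ∈ s.support, (a • v) i ^ s i = a ^ m * ∏ i ∈ s.support, v i ^ s i := by
    simp only [Pi.smul_apply, smul_eq_mul, mul_pow, Finset.prod_mul_distrib]
    rw [Finset.prod_pow_eq_pow_sum, ← hdeg, Finsupp.degree_apply]
  rw [this]; ring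

/-- The affine cone over a set of points of `ℙ^d`. -/
def cone {d : ℕ} (X : Set (ProjSpace d)) : Set (Fin (d + 1) → ℂ) :=
  {v | ∃ p ∈ X, v ∈ p.submodule}

theorem mem_submodule_iff {d : ℕ} (p : ProjSpace d) (v : Fin (d + 1) → ℂ) :
    v ∈ p.submodule ↔ ∃ a : ℂ, a • p.rep = v := by
  rw [Projectivization.submodule_eq, Submodule.mem_span_singleton]

theorem rep_mem_submodule {d : ℕ} (p : ProjSpace d) : p.rep ∈ p.submodule := by
  rw [Projectivization.submodule_eq]; exact Submodule.mem_span_singleton_self _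

theorem rep_mem_cone {d : ℕ} {X : Set (ProjSpace d)} {p : ProjSpace d} (hp : p ∈ X) :
    p.rep ∈ cone X := ⟨p, hp, rep_mem_submodule p⟩

theorem cone_union {d : ℕ} (X Y : Set (ProjSpace d)) : cone (X ∪ Y) = cone X ∪ cone Y := by
  ext v; simp only [cone, Set.mem_union, Set.mem_ofPred_eq]
  constructor
  · rintro ⟨p, hp | hp, h⟩
    · exact Or.inl ⟨p, hp, h⟩
    · exact Or.inr ⟨p, hp, h⟩
  · rintro (⟨p, hp, h⟩ | ⟨p, hp, h⟩)
    · exact ⟨p, Or.inl hp, h⟩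
    · exact ⟨p, Or.inr hp, h⟩

theorem cone_smul_mem {d : ℕ} {X : Set (ProjSpace d)} {v : Fin (d + 1) → ℂ} (hv : v ∈ cone X)
    (a : ℂ) : a • v ∈ cone X := by
  obtain ⟨p, hp, h⟩ := hv
  exact ⟨p, hp, p.submodule.smul_mem a h⟩

theorem span_cone {d : ℕ} (X : Set (ProjSpace d)) : Submodule.span ℂ (cone X) = linSpan X := by
  apply le_antisymm
  · rw [Submodule.span_le]
    rintro v ⟨p, hp, hv⟩
    exact (le_iSup₂_of_le (f := fun (p : ProjSpace d) (_ : p ∈ X) => p.submodule) p hp le_rfl) hv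
  · refine iSup₂_le fun p hp v hv => Submodule.subset_span ⟨p, hp, hv⟩

/-- The ideal of all polynomials vanishing on the affine cone over `X`. -/
noncomputable def coneIdeal {d : ℕ} (X : Set (ProjSpace d)) :
    Ideal (MvPolynomial (Fin (d + 1)) ℂ) where
  carrier := {f | ∀ v ∈ cone X, eval v f = 0}
  zero_mem' := by intro v _; simp
  add_mem' := by
    intro f g hf hg v hv
    simp [hf v hv, hg v hv]
  smul_mem' := by
    intro c f hf v hv
    simp [hf v hv]

theorem mem_coneIdeal {d : ℕ} {X : Set (ProjSpace d)} {f : MvPolynomial (Fin (d + 1)) ℂ} :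
    f ∈ coneIdeal X ↔ ∀ v ∈ cone X, eval v f = 0 := Iff.rfl

theorem mem_coneIdeal_iff_rep {d : ℕ} {X : Set (ProjSpace d)}
    {f : MvPolynomial (Fin (d + 1)) ℂ} {m : ℕ} (hf : f.IsHomogeneous m) :
    f ∈ coneIdeal X ↔ ∀ p ∈ X, eval p.rep f = 0 := by
  constructor
  · intro h p hp
    exact h _ (rep_mem_cone hp)
  · rintro h v ⟨p, hp, hv⟩
    obtain ⟨a, rfl⟩ := (mem_submodule_iff p v).1 hv
    rw [eval_smul_of_isHomogeneous hf, h p hp, mul_zero]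

theorem coneIdeal_anti {d : ℕ} {X Y : Set (ProjSpace d)} (h : X ⊆ Y) :
    coneIdeal Y ≤ coneIdeal X := by
  rintro f hf v ⟨p, hp, hv⟩
  exact hf v ⟨p, h hp, hv⟩

/-- Along the line through v, f is a polynomial in the scalar a that vanishes identically; its
coefficients are the values at v of the homogeneous components. -/
theorem homogeneousComponent_vanishes {σ : Type*} {X : Set (σ → ℂ)}
    (hX : ∀ v ∈ X, ∀ a : ℂ, a • v ∈ X) {f : MvPolynomial σ ℂ}
    (hf : ∀ v ∈ X, eval v f = 0) (n : ℕ) :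
    ∀ v ∈ X, eval v (homogeneousComponent n f) = 0 := by
  intro v hv
  have key : ∀ a : ℂ, ∑ i ∈ Finset.range (f.totalDegree + 1),
      a ^ i * eval v (homogeneousComponent i f) = 0 := by
    intro a
    have h := hf _ (hX v hv a)
    rw [← sum_homogeneousComponent f, map_sum] at h
    rw [← h]
    refine Finset.sum_congr rfl fun i _ => ?_
    rw [eval_smul_of_isHomogeneous (homogeneousComponent_isHomogeneous i f)]
  set P : Polynomial ℂ := ∑ i ∈ Finset.range (f.totalDegree + 1),
    Polynomial.monomial i (eval v (homogeneousComponent i f)) with hP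
  have hP0 : P = 0 := by
    apply Polynomial.funext
    intro a
    rw [hP, Polynomial.eval_finsetSum, Polynomial.eval_zero, ← key a]
    refine Finset.sum_congr rfl fun i _ => ?_
    rw [Polynomial.eval_monomial, mul_comm]
  by_cases hn : n ∈ Finset.range (f.totalDegree + 1)
  · have h2 : P.coeff n = 0 := by rw [hP0, Polynomial.coeff_zero]
    rw [hP, Polynomial.finsetSum_coeff] at h2
    simp only [Polynomial.coeff_monomial] at h2
    rw [Finset.sum_ite_eq' ] at h2
    simpa [hn] using h2
  · rw [homogeneousComponent_eq_zero]
    · simp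
    · simp at hn; omega

theorem homogeneousComponent_mem_coneIdeal {d : ℕ} {X : Set (ProjSpace d)}
    {f : MvPolynomial (Fin (d + 1)) ℂ} (hf : f ∈ coneIdeal X) (n : ℕ) :
    homogeneousComponent n f ∈ coneIdeal X :=
  homogeneousComponent_vanishes (fun _ hv a => cone_smul_mem hv a) hf n

theorem isPrime_of_homogeneous {σ : Type*} {I : Ideal (MvPolynomial σ ℂ)}
    (hI : ∀ f ∈ I, ∀ n, homogeneousComponent n f ∈ I) (hne : I ≠ ⊤)
    (h : ∀ (m n : ℕ) (f g : MvPolynomial σ ℂ), f.IsHomogeneous m → g.IsHomogeneous n →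
      f * g ∈ I → f ∈ I ∨ g ∈ I) : I.IsPrime := by
  let := MvPolynomial.gradedAlgebra (σ := σ) (R := ℂ)
  have hI' : I.IsHomogeneous (homogeneousSubmodule σ ℂ) := by
    intro i f hf
    have := hI f hf i
    rwa [← MvPolynomial.decomposition.decompose'_apply] at this
  refine hI'.isPrime_of_homogeneous_mem_or_mem hne ?_
  rintro f g ⟨m, hm⟩ ⟨n, hn⟩ hfg
  exact h m n f g hm hn hfg

/-- The degree `m` part of the homogeneous coordinate ring. -/
noncomputable abbrev coordForms {d : ℕ} (X : Set (ProjSpace d)) (m : ℕ) :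
    Submodule ℂ (MvPolynomial (Fin (d + 1)) ℂ ⧸ coneIdeal X) :=
  (homogeneousSubmodule (Fin (d + 1)) ℂ m).map (Ideal.Quotient.mkₐ ℂ (coneIdeal X)).toLinearMap

instance finiteDimensional_homogeneousSubmodule {σ : Type*} [Finite σ] (m : ℕ) :
    FiniteDimensional ℂ (homogeneousSubmodule σ ℂ m) :=
  Module.Finite.iff_fg.2 (homogeneousSubmodule_fg σ ℂ m)

theorem finrank_coordForms {d : ℕ} (X : Set (ProjSpace d)) (m : ℕ) :
    Module.finrank ℂ (coordForms X m) = hilbertFunction X m := by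
  set φ : homogeneousSubmodule (Fin (d + 1)) ℂ m →ₗ[ℂ]
    (MvPolynomial (Fin (d + 1)) ℂ ⧸ coneIdeal X) :=
    (Ideal.Quotient.mkₐ ℂ (coneIdeal X)).toLinearMap ∘ₗ (Submodule.subtype _) with hφ
  have hker : LinearMap.ker φ = vanishingForms X m := by
    ext f
    rw [LinearMap.mem_ker]
    change Ideal.Quotient.mk _ (f : MvPolynomial (Fin (d + 1)) ℂ) = 0 ↔ _
    rw [Ideal.Quotient.eq_zero_iff_mem, mem_coneIdeal_iff_rep f.2]
    rfl
  have hrange : LinearMap.range φ = coordForms X m := by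
    rw [hφ, LinearMap.range_comp, Submodule.range_subtype]
  rw [hilbertFunction, ← hrange, ← hker]
  exact (LinearEquiv.finrank_eq φ.quotKerEquivRange).symm

/-- Turns the growth of the Hilbert function into the growth of the powers of one subspace of the
coordinate ring. -/
theorem coordForms_eq_pow {d : ℕ} (X : Set (ProjSpace d)) (m : ℕ) :
    coordForms X m = coordForms X 1 ^ m := by
  rw [coordForms, ← homogeneousSubmodule_one_pow, Submodule.map_pow]

/-- Substitution of a linear map into a form. -/
theorem exists_form_comp {σ τ : Type*} [Fintype σ] [DecidableEq σ]
    (g : (σ → ℂ) →ₗ[ℂ] (τ → ℂ)) {f : MvPolynomial τ ℂ} {m : ℕ} (hf : f.IsHomogeneous m) :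
    ∃ f' : MvPolynomial σ ℂ, f'.IsHomogeneous m ∧ ∀ v, eval v f' = eval (g v) f := by
  refine ⟨aeval (fun j => ∑ i, C (g (Pi.single i 1) j) * X i) f, ?_, fun v => ?_⟩
  · have := hf.aeval (n := 1) (fun j => ∑ i, C (g (Pi.single i 1) j) * X i)
      (fun j => IsHomogeneous.sum _ _ _ fun i _ => isHomogeneous_C_mul_X _ _)
    simpa using this
  · rw [aeval_def, eval_eval₂, eval, eval₂Hom]
    simp only [RingHom.coe_mk, MonoidHom.coe_mk, OneHom.coe_mk]
    congr 1
    · ext; simp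
    · ext j
      simp only [← coe_eval₂Hom]
      rw [map_sum]
      simp only [map_mul, eval₂Hom_C, eval₂Hom_X', RingHom.id_apply]
      conv_rhs => rw [← LinearMap.sum_single_apply (fun _ : σ => ℂ) v, map_sum, Finset.sum_apply]
      refine Finset.sum_congr rfl fun i _ => ?_
      have : (Pi.single i (v i) : σ → ℂ) = v i • Pi.single i 1 := by
        rw [← Pi.single_smul, smul_eq_mul, mul_one]
      rw [this, map_smul, Pi.smul_apply, smul_eq_mul, mul_comm]

/-- The linear form with coefficient vector given by a dual vector. -/
theorem exists_linear_form {σ : Type*} [Fintype σ] [DecidableEq σ] (φ : Module.Dual ℂ (σ → ℂ)) :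
    ∃ f : MvPolynomial σ ℂ, f.IsHomogeneous 1 ∧ ∀ v, eval v f = φ v := by
  refine ⟨∑ i, C (φ (Pi.single i 1)) * X i,
    IsHomogeneous.sum _ _ _ fun i _ => isHomogeneous_C_mul_X _ _, fun v => ?_⟩
  rw [map_sum]
  conv_rhs => rw [← LinearMap.sum_single_apply (fun _ : σ => ℂ) v, map_sum]
  refine Finset.sum_congr rfl fun i _ => ?_
  have : (Pi.single i (v i) : σ → ℂ) = v i • Pi.single i 1 := by
    rw [← Pi.single_smul, smul_eq_mul, mul_one]
  rw [this, map_smul]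
  simp [mul_comm]

/-! ### The Zariski topology -/

attribute [local instance] zariskiTopology

theorem zariski_isTopologicalBasis (d : ℕ) :
    TopologicalSpace.IsTopologicalBasis
      {U : Set (ProjSpace d) | ∃ (m : ℕ) (f : MvPolynomial (Fin (d + 1)) ℂ), f.IsHomogeneous m ∧
        U = {p | MvPolynomial.eval p.rep f ≠ 0}} where
  exists_subset_inter := by
    rintro _ ⟨m, f, hf, rfl⟩ _ ⟨n, g, hg, rfl⟩ p hp
    refine ⟨_, ⟨m + n, f * g, hf.mul hg, rfl⟩, ?_, ?_⟩
    · simpa using hp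
    · intro x hx
      simpa using hx
  sUnion_eq := by
    rw [Set.sUnion_eq_univ_iff]
    intro p
    exact ⟨_, ⟨0, 1, isHomogeneous_one _ _, rfl⟩, by simp⟩
  eq_generateFrom := rfl

theorem zariski_isOpen_form {d m : ℕ} {f : MvPolynomial (Fin (d + 1)) ℂ} (hf : f.IsHomogeneous m) :
    IsOpen {p : ProjSpace d | eval p.rep f ≠ 0} :=
  (zariski_isTopologicalBasis d).isOpen ⟨m, f, hf, rfl⟩

theorem zariski_isClosed_form {d m : ℕ} {f : MvPolynomial (Fin (d + 1)) ℂ}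
    (hf : f.IsHomogeneous m) : IsClosed {p : ProjSpace d | eval p.rep f = 0} := by
  rw [← isOpen_compl_iff]
  exact zariski_isOpen_form hf

theorem exists_form_of_isClosed {d : ℕ} {Z : Set (ProjSpace d)} (hZ : IsClosed Z)
    {p : ProjSpace d} (hp : p ∉ Z) :
    ∃ (m : ℕ) (f : MvPolynomial (Fin (d + 1)) ℂ), f.IsHomogeneous m ∧ f ∈ coneIdeal Z ∧
      eval p.rep f ≠ 0 := by
  obtain ⟨_, ⟨m, f, hf, rfl⟩, hpf, hsub⟩ :=
    (zariski_isTopologicalBasis d).exists_subset_of_mem_open (show p ∈ Zᶜ from hp) hZ.isOpen_compl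
  refine ⟨m, f, hf, (mem_coneIdeal_iff_rep hf).2 fun q hq => ?_, hpf⟩
  by_contra h
  exact hsub h hq

/-- Zero sets of forms are closed. Consequently curves can be replaced by their closures without
changing the Hilbert function. -/
theorem coneIdeal_closure {d : ℕ} (X : Set (ProjSpace d)) :
    coneIdeal (closure X) = coneIdeal X := by
  refine le_antisymm (coneIdeal_anti subset_closure) fun f hf => ?_
  rw [← sum_homogeneousComponent f]
  refine Ideal.sum_mem _ fun i _ => ?_
  rw [mem_coneIdeal_iff_rep (homogeneousComponent_isHomogeneous i f)]
  have h : X ⊆ {p | eval p.rep (homogeneousComponent i f) = 0} :=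
    fun p hp => (mem_coneIdeal_iff_rep (homogeneousComponent_isHomogeneous i f)).1
      (homogeneousComponent_mem_coneIdeal hf i) p hp
  exact fun p hp =>
    closure_minimal h (zariski_isClosed_form (homogeneousComponent_isHomogeneous i f)) hp

theorem hilbertFunction_congr {d : ℕ} {X Y : Set (ProjSpace d)} (h : coneIdeal X = coneIdeal Y)
    (m : ℕ) : hilbertFunction X m = hilbertFunction Y m := by
  have : vanishingForms X m = vanishingForms Y m := by
    ext f
    rw [vanishingForms, vanishingForms]
    change (∀ p ∈ X, _) ↔ (∀ p ∈ Y, _)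
    rw [← mem_coneIdeal_iff_rep f.2, ← mem_coneIdeal_iff_rep f.2, h]
  rw [hilbertFunction, this, hilbertFunction]

/-- A larger open set has a strictly larger ideal of forms vanishing on its complement, so the
ascending chain condition is inherited from the polynomial ring. -/
instance zariski_noetherianSpace (d : ℕ) : TopologicalSpace.NoetherianSpace (ProjSpace d) := by
  let F : TopologicalSpace.Opens (ProjSpace d) → Ideal (MvPolynomial (Fin (d + 1)) ℂ) :=
    fun U => coneIdeal (U : Set (ProjSpace d))ᶜ
  have hF : StrictMono F := by
    intro U U' h
    have hle : (U : Set (ProjSpace d)) ⊆ U' := h.le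
    refine lt_of_le_not_ge (coneIdeal_anti (Set.compl_subset_compl.2 hle)) fun h' => h.not_ge ?_
    intro p hp
    by_contra hpU
    obtain ⟨m, f, hf, hfI, hne⟩ := exists_form_of_isClosed (Z := (U' : Set (ProjSpace d))ᶜ)
      (p := p) U'.isOpen.isClosed_compl (fun h => h hp)
    exact hne (h' hfI _ (rep_mem_cone hpU))
  exact ⟨hF.wellFoundedGT.wf⟩

theorem isPrime_coneIdeal {d : ℕ} {X : Set (ProjSpace d)} (hX : IsIrreducible X) :
    (coneIdeal X).IsPrime := by
  refine isPrime_of_homogeneous (fun f hf n => homogeneousComponent_mem_coneIdeal hf n) ?_ ?_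
  · obtain ⟨p, hp⟩ := hX.1
    intro h
    have : (1 : MvPolynomial (Fin (d + 1)) ℂ) ∈ coneIdeal X := by rw [h]; trivial
    simpa using this _ (rep_mem_cone hp)
  · intro m n f g hf hg hfg
    by_contra! hcon
    obtain ⟨h1, h2⟩ := hcon
    rw [mem_coneIdeal_iff_rep hf] at h1
    rw [mem_coneIdeal_iff_rep hg] at h2
    push Not at h1 h2
    obtain ⟨p, hp, hpf⟩ := h1
    obtain ⟨q, hq, hqg⟩ := h2
    obtain ⟨r, hr, hr1, hr2⟩ := hX.2 _ _ (zariski_isOpen_form hf) (zariski_isOpen_form hg)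
      ⟨p, hp, hpf⟩ ⟨q, hq, hqg⟩
    have := hfg _ (rep_mem_cone hr)
    rw [map_mul, mul_eq_zero] at this
    exact this.elim hr1 hr2

theorem isIrreducible_of_isPrime {d : ℕ} {X : Set (ProjSpace d)} (hX : (coneIdeal X).IsPrime) :
    IsIrreducible X := by
  constructor
  · by_contra h
    rw [Set.not_nonempty_iff_eq_empty] at h
    apply hX.ne_top
    rw [Ideal.eq_top_iff_one]
    rintro v ⟨p, hp, -⟩
    rw [h] at hp
    exact hp.elim
  · rintro U U' hU hU' ⟨p, hpX, hpU⟩ ⟨q, hqX, hqU⟩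
    obtain ⟨_, ⟨m, f, hf, rfl⟩, hpf, hsub⟩ :=
      (zariski_isTopologicalBasis d).exists_subset_of_mem_open hpU hU
    obtain ⟨_, ⟨n, g, hg, rfl⟩, hqg, hsub'⟩ :=
      (zariski_isTopologicalBasis d).exists_subset_of_mem_open hqU hU'
    have hfI : f ∉ coneIdeal X := fun h => hpf (h _ (rep_mem_cone hpX))
    have hgI : g ∉ coneIdeal X := fun h => hqg (h _ (rep_mem_cone hqX))
    have hfg : f * g ∉ coneIdeal X := fun h => (hX.mem_or_mem h).elim hfI hgI
    rw [mem_coneIdeal_iff_rep (hf.mul hg)] at hfg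
    push Not at hfg
    obtain ⟨r, hr, hne⟩ := hfg
    rw [map_mul, mul_ne_zero_iff] at hne
    exact ⟨r, hr, hsub hne.1, hsub' hne.2⟩

theorem not_onHyperplane_iff {d : ℕ} {S : Set (ProjSpace d)} :
    ¬ OnHyperplane S ↔ linSpan S = ⊤ := by
  rw [not_iff_comm]
  constructor
  · intro h
    obtain ⟨φ, hφ, hle⟩ := Submodule.exists_le_ker_of_lt_top _ (lt_top_iff_ne_top.2 h)
    exact ⟨φ, hφ, fun p hp => le_trans
      (le_iSup₂_of_le (f := fun (p : ProjSpace d) (_ : p ∈ S) => p.submodule) p hp le_rfl) hle⟩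
  · rintro ⟨φ, hφ, h⟩ htop
    apply hφ
    have : linSpan S ≤ LinearMap.ker φ := iSup₂_le h
    rw [htop, top_le_iff] at this
    exact LinearMap.ker_eq_top.1 this

open scoped Pointwise

/-! ### Growth of powers of a subspace of a domain -/

theorem finiteDimensional_pow {A : Type*} [CommRing A] [Algebra ℂ A] (L : Submodule ℂ A)
    [FiniteDimensional ℂ L] (m : ℕ) : FiniteDimensional ℂ ↥(L ^ m) :=
  Module.Finite.iff_fg.2 ((Module.Finite.iff_fg.1 ‹_›).pow m)

theorem span_pow_eq_span_coe_pow {A : Type*} [CommRing A] [Algebra ℂ A] (L : Submodule ℂ A)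
    (k : ℕ) : Ideal.span (L : Set A) ^ k = Ideal.span ((L ^ k : Submodule ℂ A) : Set A) := by
  induction k with
  | zero =>
    rw [pow_zero, pow_zero, Ideal.one_eq_top, eq_comm, Ideal.eq_top_iff_one]
    exact Ideal.subset_span (Submodule.one_le.1 le_rfl)
  | succ k ih =>
    rw [pow_succ, ih, Ideal.span_mul_span']
    apply le_antisymm
    · rw [Ideal.span_le]
      rintro _ ⟨a, ha, b, hb, rfl⟩
      refine Ideal.subset_span ?_
      rw [pow_succ]
      exact Submodule.mul_mem_mul ha hb
    · rw [Ideal.span_le]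
      intro y hy
      have : L ^ (k + 1) ≤ (Ideal.span (((L ^ k : Submodule ℂ A) : Set A) *
          (L : Set A))).restrictScalars ℂ := by
        rw [pow_succ, Submodule.mul_le]
        intro a ha b hb
        exact Ideal.subset_span ⟨a, ha, b, hb, rfl⟩
      exact this hy

theorem pow_le_span_pow {A : Type*} [CommRing A] [Algebra ℂ A] (L : Submodule ℂ A)
    (k : ℕ) {y : A} (hy : y ∈ L ^ k) : y ∈ Ideal.span (L : Set A) ^ k := by
  rw [span_pow_eq_span_coe_pow]; exact Ideal.subset_span hy

theorem finrank_inf_ker {S : Type*} [CommRing S] [Algebra ℂ S] (L L' : Submodule ℂ S) [FiniteDimensional ℂ L] (φ : S →ₐ[ℂ] ℂ)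
    (hL' : ∀ y, y ∈ L' ↔ y ∈ L ∧ φ y = 0) (hL : ∃ x ∈ L, φ x ≠ 0) :
    Module.finrank ℂ L' + 1 = Module.finrank ℂ L := by
  set f : L →ₗ[ℂ] ℂ := φ.toLinearMap.domRestrict L with hf
  have h1 := f.finrank_range_add_finrank_ker
  have h2 : LinearMap.range f = ⊤ := by
    obtain ⟨x, hx, hx0⟩ := hL
    apply LinearMap.range_eq_top.2
    apply LinearMap.surjective
    intro h
    apply hx0
    have := LinearMap.congr_fun h ⟨x, hx⟩
    exact this
  have h3 : Module.finrank ℂ (LinearMap.ker f) = Module.finrank ℂ L' := by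
    have h4 : (LinearMap.ker f).map L.subtype = L' := by
      ext y
      rw [hL', Submodule.mem_map]
      constructor
      · rintro ⟨z, hz, rfl⟩
        exact ⟨z.2, hz⟩
      · rintro ⟨hy, hy0⟩
        exact ⟨⟨y, hy⟩, hy0, rfl⟩
    rw [← h4]
    exact (LinearEquiv.finrank_eq (Submodule.equivMapOfInjective _ L.injective_subtype _))
  rw [h2, finrank_top, Module.finrank_self, h3] at h1
  omega

section Growth

variable {S : Type*} [CommRing S] [IsDomain S] [Algebra ℂ S]

/-- Nakayama: a power of the part of `L` vanishing at a point is not swallowed by the next one. -/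
theorem not_pow_mul_pow_le (L' : Submodule ℂ S) [FiniteDimensional ℂ L'] (φ : S →ₐ[ℂ] ℂ)
    (hφ : ∀ y ∈ L', φ y = 0) (hne : L' ≠ ⊥) {x : S} (hx : φ x = 1) (k r : ℕ) :
    ¬ ∀ y ∈ L' ^ k, x ^ r * y ∈ Ideal.span (L' : Set S) ^ (k + 1) := by
  intro h
  set 𝔪 : Ideal S := Ideal.span (L' : Set S) with h𝔪
  set N : Ideal S := 𝔪 ^ k with hN
  have h𝔪fg : 𝔪.FG := by
    obtain ⟨s, hs⟩ := Module.Finite.iff_fg.1 (inferInstance : FiniteDimensional ℂ L')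
    refine ⟨s, ?_⟩
    apply le_antisymm
    · rw [Submodule.span_le]
      intro y hy
      exact Ideal.subset_span (by rw [← hs]; exact Submodule.subset_span hy)
    · rw [h𝔪, Ideal.span_le]
      intro y hy
      rw [← hs] at hy
      exact Submodule.span_le_restrictScalars ℂ S _ hy
  have hfin : Module.Finite S N := Module.Finite.iff_fg.2 (h𝔪fg.pow)
  have hxN : ∀ y ∈ N, x ^ r * y ∈ 𝔪 * N := by
    intro y hy
    rw [hN, h𝔪, span_pow_eq_span_coe_pow] at hy
    induction hy using Submodule.span_induction with
    | mem y hy =>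
      have := h y hy
      rwa [pow_succ'] at this
    | zero => simp
    | add y z _ _ hy hz => rw [mul_add]; exact Ideal.add_mem _ hy hz
    | smul a y _ hy =>
      rw [smul_eq_mul, mul_left_comm]; exact Ideal.mul_mem_left _ _ hy
  -- Cayley–Hamilton: multiplication by x ^ r maps N into 𝔪 N, so it satisfies a monic polynomial
  -- with lower coefficients in 𝔪.
  obtain ⟨p, hp, hdeg, hcoef, hzero⟩ :=
    LinearMap.exists_monic_and_natDegree_eq_and_coeff_mem_pow_and_aeval_eq_zero S
      (LinearMap.lsmul S N (x ^ r)) 𝔪 (by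
        rintro _ ⟨y, rfl⟩
        have h1 : ((𝔪 • ⊤ : Submodule S N).map N.subtype) = 𝔪 * N := by
          rw [Submodule.map_smul'', Submodule.map_top, Submodule.range_subtype, smul_eq_mul]
        have h2 := hxN y y.2
        rw [← h1] at h2
        obtain ⟨z, hz, hzy⟩ := h2
        have : (LinearMap.lsmul S N (x ^ r)) y = z := by
          apply Subtype.ext
          rw [Submodule.subtype_apply] at hzy
          rw [hzy]; rfl
        rw [this]; exact hz)
  have hae : Polynomial.aeval (LinearMap.lsmul S N (x ^ r)) p =
      LinearMap.lsmul S N (p.eval (x ^ r)) := by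
    have := Polynomial.aeval_algHom_apply (Algebra.lsmul S S N) (x ^ r) p
    rw [Polynomial.coe_aeval_eq_eval] at this
    exact this
  obtain ⟨y, hy, hy0⟩ := (Submodule.ne_bot_iff _).1 hne
  have hyN : y ^ k ∈ N := Ideal.pow_mem_pow (Ideal.subset_span hy) k
  have h0 : p.eval (x ^ r) * y ^ k = 0 := by
    have h3 : (LinearMap.lsmul S N (p.eval (x ^ r))) ⟨y ^ k, hyN⟩ = 0 := by
      rw [← hae, hzero]; rfl
    exact congrArg Subtype.val h3
  have h4 : p.eval (x ^ r) = 0 := by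
    rcases mul_eq_zero.1 h0 with h | h
    · exact h
    · exact absurd (pow_eq_zero_iff (n := k) (by rintro rfl; simp at h) |>.1 h) hy0
  have hφ𝔪 : ∀ z ∈ 𝔪, φ z = 0 := by
    intro z hz
    have : 𝔪 ≤ RingHom.ker φ := by
      rw [h𝔪, Ideal.span_le]; exact fun y hy => hφ y hy
    exact this hz
  have h5 : φ (p.eval (x ^ r)) = 1 := by
    rw [Polynomial.eval_eq_sum_range, map_sum, Finset.sum_range_succ, Finset.sum_eq_zero]
    · simp [hp, hx]
    · intro i hi
      have hi' : i < p.natDegree := Finset.mem_range.1 hi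
      have : p.coeff i ∈ 𝔪 := Ideal.pow_le_self (by omega) (hcoef i)
      rw [map_mul, hφ𝔪 _ this, zero_mul]
  rw [h4, map_zero] at h5
  exact zero_ne_one h5

/-- The chain L'^m ⊆ L'^(m-1) L ⊆ ⋯ ⊆ L^m is strict at each of its m steps: an equality would push
x^(r+1) L'^k, where φ x = 1, into the (k+1)-st power of the ideal of L', against
`not_pow_mul_pow_le`. -/
theorem finrank_pow_add_le (L L' : Submodule ℂ S) [FiniteDimensional ℂ L] (φ : S →ₐ[ℂ] ℂ)
    (hL' : ∀ y, y ∈ L' ↔ y ∈ L ∧ φ y = 0) (hne : L' ≠ ⊥) (hL : ∃ x ∈ L, φ x ≠ 0) (m : ℕ) :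
    Module.finrank ℂ ↥(L' ^ m) + m ≤ Module.finrank ℂ ↥(L ^ m) := by
  have hle : L' ≤ L := fun y hy => ((hL' y).1 hy).1
  have : FiniteDimensional ℂ L' := Submodule.finiteDimensional_of_le hle
  obtain ⟨x, hxL, hx1⟩ : ∃ x ∈ L, φ x = 1 := by
    obtain ⟨x, hxL, hx⟩ := hL
    exact ⟨(φ x)⁻¹ • x, L.smul_mem _ hxL, by rw [map_smul, smul_eq_mul, inv_mul_cancel₀ hx]⟩
  have hfd : ∀ a b : ℕ, FiniteDimensional ℂ ↥(L' ^ a * L ^ b) := fun a b =>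
    Module.Finite.iff_fg.2 (((Module.Finite.iff_fg.1 (inferInstance : FiniteDimensional ℂ L')).pow a).mul
      ((Module.Finite.iff_fg.1 (inferInstance : FiniteDimensional ℂ L)).pow b))
  have hstep : ∀ k r : ℕ, Module.finrank ℂ ↥(L' ^ (k + 1) * L ^ r) + 1 ≤
      Module.finrank ℂ ↥(L' ^ k * L ^ (r + 1)) := by
    intro k r
    have := hfd k (r + 1)
    refine Submodule.finrank_lt_finrank_of_lt (lt_of_le_not_ge ?_ ?_)
    · rw [pow_succ, pow_succ', mul_assoc]
      exact mul_le_mul_right (mul_le_mul_left hle _) _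
    · intro hge
      refine not_pow_mul_pow_le L' φ (fun y hy => ((hL' y).1 hy).2) hne hx1 k (r + 1) ?_
      intro y hy
      have h1 : x ^ (r + 1) * y ∈ L' ^ (k + 1) * L ^ r := by
        rw [mul_comm (x ^ (r + 1))]
        exact hge (Submodule.mul_mem_mul hy (Submodule.pow_mem_pow _ hxL _))
      have h2 : L' ^ (k + 1) * L ^ r ≤ (Ideal.span (L' : Set S) ^ (k + 1)).restrictScalars ℂ := by
        rw [Submodule.mul_le]
        intro a ha b _
        exact Ideal.mul_mem_right _ _ (pow_le_span_pow L' _ ha)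
      exact h2 h1
  have hind : ∀ r k : ℕ, Module.finrank ℂ ↥(L' ^ (k + r)) + r ≤
      Module.finrank ℂ ↥(L' ^ k * L ^ r) := by
    intro r
    induction r with
    | zero => intro k; rw [pow_zero, mul_one, add_zero, add_zero]
    | succ r ih =>
      intro k
      have h1 := ih (k + 1)
      have h2 := hstep k r
      rw [show k + (r + 1) = k + 1 + r by ring]
      omega
  have := hind m 0
  rwa [pow_zero, one_mul, zero_add] at this

/-- Induction on n: pass to the elements of L vanishing at a point where some element of L does not
vanish; by `finrank_pow_add_le` this costs at least m. -/
theorem le_finrank_pow (hsep : ∀ s : S, s ≠ 0 → ∃ φ : S →ₐ[ℂ] ℂ, φ s ≠ 0) (n : ℕ) :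
    ∀ (L : Submodule ℂ S) [FiniteDimensional ℂ L], Module.finrank ℂ L = n + 1 →
      ∀ m : ℕ, n * m + 1 ≤ Module.finrank ℂ ↥(L ^ m) := by
  induction n with
  | zero =>
    intro L _ hL m
    have hne : L ≠ ⊥ := by rintro rfl; simp at hL
    obtain ⟨x, hx, hx0⟩ := (Submodule.ne_bot_iff _).1 hne
    have := finiteDimensional_pow L m
    have hne' : L ^ m ≠ ⊥ := (Submodule.ne_bot_iff _).2
      ⟨x ^ m, Submodule.pow_mem_pow _ hx _, pow_ne_zero _ hx0⟩
    have := Submodule.one_le_finrank_iff.2 hne'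
    omega
  | succ n ih =>
    intro L _ hL m
    have hne : L ≠ ⊥ := by rintro rfl; simp at hL
    obtain ⟨x, hx, hx0⟩ := (Submodule.ne_bot_iff _).1 hne
    obtain ⟨φ, hφ⟩ := hsep x hx0
    set L' : Submodule ℂ S := L ⊓ LinearMap.ker φ.toLinearMap with hL'
    have hmem : ∀ y, y ∈ L' ↔ y ∈ L ∧ φ y = 0 := fun y => Iff.rfl
    have hfin := finrank_inf_ker L L' φ hmem ⟨x, hx, hφ⟩
    have hne' : L' ≠ ⊥ := by
      intro h
      rw [h, finrank_bot] at hfin; omega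
    have : FiniteDimensional ℂ L' := Submodule.finiteDimensional_of_le inf_le_left
    have h1 := ih L' (by omega) m
    have h2 := finrank_pow_add_le L L' φ hmem hne' ⟨x, hx, hφ⟩ m
    have : (n + 1) * m = n * m + m := by ring
    omega

end Growth

theorem finrank_homogeneousSubmodule {σ : Type*} [Fintype σ] (m : ℕ) :
    Module.finrank ℂ (homogeneousSubmodule σ ℂ m) = (Fintype.card σ).multichoose m := by
  classical
  rw [homogeneousSubmodule_eq_finsupp_supported]
  have e : {P : σ →₀ ℕ // P.sum (fun _ ↦ id) = m} ≃ ↥{d : σ →₀ ℕ | d.degree = m} :=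
    Equiv.subtypeEquivRight fun P => by
      simp [Finsupp.sum, Finsupp.degree_apply]
  have h := Module.finrank_eq_nat_card_basis
    (basisRestrictSupport ℂ {d : σ →₀ ℕ | d.degree = m})
  refine h.trans ?_
  rw [← Sym.card_sym_eq_multichoose, ← Nat.card_eq_fintype_card]
  exact Nat.card_congr ((Sym.equivNatSum σ m).trans e).symm

/-! ### Plane curves with linear Hilbert function of slope two are conics -/

theorem homogeneousComponent_mul_of_isHomogeneous {σ : Type*} {f : MvPolynomial σ ℂ} {e : ℕ}
    (hf : f.IsHomogeneous e) (h : MvPolynomial σ ℂ) (n : ℕ) :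
    homogeneousComponent (e + n) (f * h) = f * homogeneousComponent n h := by
  conv_lhs => rw [← sum_homogeneousComponent h, Finset.mul_sum, map_sum]
  have h1 : ∀ i, homogeneousComponent (e + n) (f * homogeneousComponent i h) =
      if i = n then f * homogeneousComponent i h else 0 := by
    intro i
    rw [homogeneousComponent_of_mem (hf.mul (homogeneousComponent_isHomogeneous i h))]
    by_cases hi : i = n
    · simp [hi]
    · rw [if_neg (by omega), if_neg hi]
  rw [Finset.sum_congr rfl fun i _ => h1 i, Finset.sum_ite_eq']
  split_ifs with hn
  · rfl
  · rw [homogeneousComponent_eq_zero, mul_zero]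
    simp at hn; omega

theorem two_mul_finrank_plane_forms (m : ℕ) :
    2 * Module.finrank ℂ (homogeneousSubmodule (Fin 3) ℂ m) = (m + 1) * (m + 2) := by
  rw [finrank_homogeneousSubmodule, Fintype.card_fin, Nat.multichoose_eq]
  have : (3 + m - 1).choose m = (m + 2).choose 2 := by
    rw [show 3 + m - 1 = m + 2 by omega]
    exact Nat.choose_symm_add
  rw [this, Nat.choose_two_right, Nat.mul_div_cancel']
  · simp [mul_comm]
  · have := (Nat.even_mul_succ_self (m + 1)).two_dvd
    simpa [mul_comm] using this

/-- The forms of degree `n` multiplied by `f`. -/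
noncomputable def formMultiples {σ : Type*} (f : MvPolynomial σ ℂ) (n : ℕ) :
    Submodule ℂ (MvPolynomial σ ℂ) :=
  (homogeneousSubmodule σ ℂ n).map (LinearMap.mulLeft ℂ f)

theorem finrank_formMultiples {σ : Type*} {f : MvPolynomial σ ℂ} (hf : f ≠ 0) (n : ℕ) :
    Module.finrank ℂ (formMultiples f n) = Module.finrank ℂ (homogeneousSubmodule σ ℂ n) :=
  (LinearEquiv.finrank_eq (Submodule.equivMapOfInjective _
    (fun _ _ h => mul_left_cancel₀ hf h) _)).symm

instance {σ : Type*} [Finite σ] (f : MvPolynomial σ ℂ) (n : ℕ) :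
    FiniteDimensional ℂ (formMultiples f n) := by
  unfold formMultiples; infer_instance

/-- A nonzero form of least degree in 𝔭 is irreducible: one of two factors lies in 𝔭, so it cannot
have smaller degree and the other factor is constant. -/
theorem exists_irreducible_form_mem {σ : Type*} (𝔭 : Ideal (MvPolynomial σ ℂ)) [h𝔭 : 𝔭.IsPrime]
    (hhom : ∀ f ∈ 𝔭, ∀ n, homogeneousComponent n f ∈ 𝔭) (hne : 𝔭 ≠ ⊥) :
    ∃ (e : ℕ) (f : MvPolynomial σ ℂ), f ∈ 𝔭 ∧ f ≠ 0 ∧ f.IsHomogeneous e ∧ Irreducible f := by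
  classical
  have htop : ∀ g ∈ 𝔭, g ≠ 0 → ∃ f ∈ 𝔭, f ≠ 0 ∧ f.IsHomogeneous g.totalDegree := by
    intro g hg hg0
    refine ⟨_, hhom g hg g.totalDegree, ?_, homogeneousComponent_isHomogeneous _ _⟩
    obtain ⟨s, hs, hdeg⟩ := Finset.exists_mem_eq_sup g.support
      (by simpa using hg0) (fun s => s.degree)
    intro h0
    have h1 : coeff s (homogeneousComponent g.totalDegree g) = coeff s g := by
      rw [coeff_homogeneousComponent, if_pos]
      rw [← hdeg, totalDegree]
      rfl
    rw [h0, coeff_zero] at h1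
    exact (mem_support_iff.1 hs) h1.symm
  have hex : ∃ e : ℕ, ∃ f ∈ 𝔭, f ≠ 0 ∧ f.IsHomogeneous e := by
    obtain ⟨g, hg, hg0⟩ := (Submodule.ne_bot_iff _).1 hne
    exact ⟨_, htop g hg hg0⟩
  obtain ⟨f, hf, hf0, hfe⟩ := Nat.find_spec hex
  have hmin : ∀ g ∈ 𝔭, g ≠ 0 → Nat.find hex ≤ g.totalDegree := fun g hg hg0 =>
    Nat.find_min' hex (htop g hg hg0)
  refine ⟨_, f, hf, hf0, hfe, ?_⟩
  have hunit : ∀ b : MvPolynomial σ ℂ, b ≠ 0 → b.totalDegree = 0 → IsUnit b := by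
    intro b hb hb0
    rw [totalDegree_eq_zero_iff_eq_C] at hb0
    rw [hb0]
    refine (IsUnit.mk0 _ fun h => hb ?_).map C
    rw [hb0, h, C_0]
  constructor
  · intro hu
    exact h𝔭.ne_top (Ideal.eq_top_of_isUnit_mem _ hf hu)
  · rintro a b rfl
    have ha : a ≠ 0 := left_ne_zero_of_mul hf0
    have hb : b ≠ 0 := right_ne_zero_of_mul hf0
    have hdeg := hfe.totalDegree hf0
    rw [totalDegree_mul_of_isDomain ha hb] at hdeg
    rcases h𝔭.mem_or_mem hf with h | h
    · right
      have := hmin a h ha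
      exact hunit b hb (by omega)
    · left
      have := hmin b h hb
      exact hunit a ha (by omega)

/-- A plane curve whose Hilbert function has slope two is a conic. An irreducible form f in 𝔭 of
degree e > 2 is impossible: if all forms in 𝔭 are multiples of f, the slope is e, and otherwise
Bézout bounds the Hilbert function. -/
theorem exists_quadric_mem (𝔭 : Ideal (MvPolynomial (Fin 3) ℂ)) [h𝔭 : 𝔭.IsPrime]
    (hhom : ∀ f ∈ 𝔭, ∀ n, homogeneousComponent n f ∈ 𝔭) (c m₀ : ℕ)
    (hup : ∀ m ≥ m₀, Module.finrank ℂ (homogeneousSubmodule (Fin 3) ℂ m) ≤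
      Module.finrank ℂ ↥(𝔭.restrictScalars ℂ ⊓ homogeneousSubmodule (Fin 3) ℂ m) + (2 * m + c))
    (hlow : ∀ m, Module.finrank ℂ ↥(𝔭.restrictScalars ℂ ⊓ homogeneousSubmodule (Fin 3) ℂ m) +
      (2 * m + 1) ≤ Module.finrank ℂ (homogeneousSubmodule (Fin 3) ℂ m)) :
    ∃ f ∈ 𝔭, f ≠ 0 ∧ f.IsHomogeneous 2 := by
  have hD := two_mul_finrank_plane_forms
  set D : ℕ → ℕ := fun m => Module.finrank ℂ (homogeneousSubmodule (Fin 3) ℂ m) with hDdef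
  have hne : 𝔭 ≠ ⊥ := by
    rintro rfl
    have h1 := hup (m₀ + 2 * c + 4) (by omega)
    have h2 : Module.finrank ℂ ↥((⊥ : Ideal (MvPolynomial (Fin 3) ℂ)).restrictScalars ℂ ⊓
        homogeneousSubmodule (Fin 3) ℂ (m₀ + 2 * c + 4)) = 0 := by
      rw [Submodule.restrictScalars_bot, bot_inf_eq, finrank_bot]
    have h3 := hD (m₀ + 2 * c + 4)
    rw [h2] at h1
    nlinarith
  obtain ⟨e, f, hf, hf0, hfe, hirr⟩ := exists_irreducible_form_mem 𝔭 hhom hne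
  rcases Nat.lt_or_ge 2 e with he | he
  swap
  -- A form of degree below two is padded with a power of a variable.
  · refine ⟨f * X 0 ^ (2 - e), 𝔭.mul_mem_right _ hf, mul_ne_zero hf0 (pow_ne_zero _ (X_ne_zero _)), ?_⟩
    have := hfe.mul (isHomogeneous_X_pow (R := ℂ) (0 : Fin 3) (2 - e))
    rwa [show e + (2 - e) = 2 by omega] at this
  exfalso
  by_cases hall : ∀ (r : ℕ) (g : MvPolynomial (Fin 3) ℂ), g ∈ 𝔭 → g.IsHomogeneous r → f ∣ g
  -- The quotient now has dimension at least D (e + n) - D n in degree e + n, which grows like e * n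
  -- with e ≥ 3; this n is large enough to violate `hup`.
  · set n := m₀ + c + e with hn
    have h1 : 𝔭.restrictScalars ℂ ⊓ homogeneousSubmodule (Fin 3) ℂ (e + n) ≤ formMultiples f n := by
      rintro g ⟨hg, hgh⟩
      obtain ⟨h, rfl⟩ := hall _ g hg hgh
      refine ⟨homogeneousComponent n h, homogeneousComponent_isHomogeneous _ _, ?_⟩
      rw [LinearMap.mulLeft_apply, ← homogeneousComponent_mul_of_isHomogeneous hfe,
        homogeneousComponent_eq_self hgh]
    have h2 := Submodule.finrank_mono h1
    rw [finrank_formMultiples hf0] at h2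
    have h3 := hup (e + n) (by omega)
    have h4 := hD (e + n)
    have h5 := hD n
    nlinarith
  · push Not at hall
    obtain ⟨r, g, hg, hgr, hfg⟩ := hall
    have hg0 : g ≠ 0 := by rintro rfl; exact hfg (dvd_zero _)
    -- The multiples of f and g together have codimension at most e * r in degree n + e + r. With n
    -- = e * r this is less than 2 (n + e + r) + 1, contradicting `hlow`.
    set n := e * r with hn
    have h1 : formMultiples f (n + r) ⊔ formMultiples g (n + e) ≤
        𝔭.restrictScalars ℂ ⊓ homogeneousSubmodule (Fin 3) ℂ (n + e + r) := by
      refine sup_le ?_ ?_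
      · rintro _ ⟨h, hh, rfl⟩
        refine ⟨𝔭.mul_mem_right _ hf, ?_⟩
        have := hfe.mul hh
        rwa [show e + (n + r) = n + e + r by ring] at this
      · rintro _ ⟨h, hh, rfl⟩
        refine ⟨𝔭.mul_mem_right _ hg, ?_⟩
        have := hgr.mul hh
        rwa [show r + (n + e) = n + e + r by ring] at this
    have h2 : formMultiples f (n + r) ⊓ formMultiples g (n + e) ≤ formMultiples (f * g) n := by
      rintro _ ⟨⟨a, ha, rfl⟩, ⟨b, hb, hab⟩⟩
      rw [LinearMap.mulLeft_apply, LinearMap.mulLeft_apply] at hab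
      have hdvd : f ∣ b := (hirr.prime.dvd_or_dvd (Dvd.intro a hab.symm)).resolve_left hfg
      obtain ⟨b', rfl⟩ := hdvd
      refine ⟨homogeneousComponent n b', homogeneousComponent_isHomogeneous _ _, ?_⟩
      have h3 : f * homogeneousComponent n b' = f * b' := by
        rw [← homogeneousComponent_mul_of_isHomogeneous hfe, add_comm,
          homogeneousComponent_eq_self hb]
      rw [LinearMap.mulLeft_apply, LinearMap.mulLeft_apply, ← hab, mul_comm f g, mul_assoc, h3]
    have h3 := Submodule.finrank_sup_add_finrank_inf_eq (formMultiples f (n + r))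
      (formMultiples g (n + e))
    have h4 : FiniteDimensional ℂ
      ↥(𝔭.restrictScalars ℂ ⊓ homogeneousSubmodule (Fin 3) ℂ (n + e + r)) :=
      Submodule.finiteDimensional_of_le inf_le_right
    have h5 := Submodule.finrank_mono h1
    have h6 := Submodule.finrank_mono h2
    rw [finrank_formMultiples (mul_ne_zero hf0 hg0)] at h6
    rw [finrank_formMultiples hf0, finrank_formMultiples hg0] at h3
    have h7 := hlow (n + e + r)
    have k1 := hD n
    have k2 := hD (n + r)
    have k3 := hD (n + e)
    have k4 := hD (n + e + r)
    nlinarith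

theorem map_aeval_homogeneousSubmodule {S σ : Type*} [CommRing S] [Algebra ℂ S] (b : σ → S)
    (m : ℕ) : (homogeneousSubmodule σ ℂ m).map (aeval b).toLinearMap =
      Submodule.span ℂ (Set.range b) ^ m := by
  rw [← homogeneousSubmodule_one_pow, Submodule.map_pow, homogeneousSubmodule_one_eq_span_X,
    Submodule.map_span, ← Set.range_comp]
  congr 3
  ext i
  simp

/-- The kernel of ℂ[x, y, z] → S is prime, and in degree m the quotient is the m-th power of the
span of b. `le_finrank_pow` supplies the lower bound and `hup` the upper bound required by
`exists_quadric_mem`. -/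
theorem exists_quadratic_relation {S : Type*} [CommRing S] [IsDomain S] [Algebra ℂ S]
    (hsep : ∀ s : S, s ≠ 0 → ∃ φ : S →ₐ[ℂ] ℂ, φ s ≠ 0) (b : Fin 3 → S) (hb : LinearIndependent ℂ b)
    (hhom : ∀ f : MvPolynomial (Fin 3) ℂ, aeval b f = 0 → ∀ n,
      aeval b (homogeneousComponent n f) = 0) (c m₀ : ℕ)
    (hup : ∀ m ≥ m₀, Module.finrank ℂ ↥(Submodule.span ℂ (Set.range b) ^ m) ≤ 2 * m + c) :
    ∃ f : MvPolynomial (Fin 3) ℂ, aeval b f = 0 ∧ f ≠ 0 ∧ f.IsHomogeneous 2 := by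
  set 𝔭 : Ideal (MvPolynomial (Fin 3) ℂ) := RingHom.ker (aeval (R := ℂ) b) with h𝔭
  have hprime : 𝔭.IsPrime := RingHom.ker_isPrime _
  have hdim : ∀ m, Module.finrank ℂ ↥(𝔭.restrictScalars ℂ ⊓ homogeneousSubmodule (Fin 3) ℂ m) +
      Module.finrank ℂ ↥(Submodule.span ℂ (Set.range b) ^ m) =
      Module.finrank ℂ (homogeneousSubmodule (Fin 3) ℂ m) := by
    intro m
    set ψ := (aeval (R := ℂ) b).toLinearMap.domRestrict (homogeneousSubmodule (Fin 3) ℂ m) with hψ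
    have h1 := ψ.finrank_range_add_finrank_ker
    have h2 : LinearMap.range ψ = Submodule.span ℂ (Set.range b) ^ m := by
      rw [hψ, LinearMap.range_domRestrict, map_aeval_homogeneousSubmodule]
    have h3 : (LinearMap.ker ψ).map (homogeneousSubmodule (Fin 3) ℂ m).subtype =
        𝔭.restrictScalars ℂ ⊓ homogeneousSubmodule (Fin 3) ℂ m := by
      ext y
      rw [Submodule.mem_map]
      constructor
      · rintro ⟨z, hz, rfl⟩
        exact ⟨hz, z.2⟩
      · rintro ⟨hy0, hy⟩
        exact ⟨⟨y, hy⟩, hy0, rfl⟩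
    rw [← h3, LinearEquiv.finrank_eq (Submodule.equivMapOfInjective _
      (Submodule.injective_subtype _) (LinearMap.ker ψ)).symm, ← h2]
    omega
  have hL : Module.finrank ℂ (Submodule.span ℂ (Set.range b)) = 2 + 1 := by
    rw [finrank_span_eq_card hb]; rfl
  have : FiniteDimensional ℂ (Submodule.span ℂ (Set.range b)) :=
    FiniteDimensional.span_of_finite _ (Set.finite_range b)
  obtain ⟨f, hf, hf0, hf2⟩ := exists_quadric_mem 𝔭 hhom c m₀
    (fun m hm => by have := hdim m; have := hup m hm; omega)
    (fun m => by
      have h1 := hdim m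
      have h2 := le_finrank_pow hsep 2 _ hL m
      omega)
  exact ⟨f, hf, hf0, hf2⟩

/-! ### Projections onto the plane -/

/-- A set `X` of vectors projects to conics if its image under each linear projection to a plane,
whose center is spanned by vectors of `X`, lies on a conic. -/
def ProjectsToConics {V : Type*} [AddCommGroup V] [Module ℂ V] (X : Set V) : Prop :=
  ∀ J : Finset V, (J : Set V) ⊆ X → LinearIndepOn ℂ id (J : Set V) →
    J.card + 3 = Module.finrank ℂ (Submodule.span ℂ X) →
    ∀ π : V →ₗ[ℂ] (Fin 3 → ℂ), (Submodule.span ℂ X).map π = ⊤ → (∀ j ∈ J, π j = 0) →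
      ∃ Q : QuadraticForm ℂ (Fin 3 → ℂ), Q ≠ 0 ∧ ∀ v ∈ X, Q (π v) = 0

theorem exists_dual_of_form {σ : Type*} {f : MvPolynomial σ ℂ} (hf : f.IsHomogeneous 1) :
    ∃ ψ : Module.Dual ℂ (σ → ℂ), ∀ v, ψ v = eval v f := by
  rw [← mem_homogeneousSubmodule, homogeneousSubmodule_one_eq_span_X] at hf
  induction hf using Submodule.span_induction with
  | mem f hf =>
    obtain ⟨i, rfl⟩ := hf
    exact ⟨LinearMap.proj i, fun v => by simp⟩
  | zero => exact ⟨0, fun v => by simp⟩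
  | add f g _ _ hf hg =>
    obtain ⟨ψ, hψ⟩ := hf
    obtain ⟨χ, hχ⟩ := hg
    exact ⟨ψ + χ, fun v => by simp [hψ, hχ]⟩
  | smul a f _ hf =>
    obtain ⟨ψ, hψ⟩ := hf
    exact ⟨a • ψ, fun v => by simp [hψ, smul_eval]⟩

theorem exists_quadraticForm_of_form {σ : Type*} {f : MvPolynomial σ ℂ} (hf : f.IsHomogeneous 2) :
    ∃ Q : QuadraticForm ℂ (σ → ℂ), ∀ v, Q v = eval v f := by
  rw [← mem_homogeneousSubmodule, ← homogeneousSubmodule_one_pow, pow_two] at hf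
  induction hf using Submodule.mul_induction_on' with
  | mem_mul_mem a ha b hb =>
    obtain ⟨ψ, hψ⟩ := exists_dual_of_form ha
    obtain ⟨χ, hχ⟩ := exists_dual_of_form hb
    exact ⟨QuadraticMap.linMulLin ψ χ, fun v => by simp [hψ, hχ]⟩
  | add f _ g _ hf hg =>
    obtain ⟨Q, hQ⟩ := hf
    obtain ⟨Q', hQ'⟩ := hg
    exact ⟨Q + Q', fun v => by simp [hQ, hQ']⟩

theorem linMulLin_ne_zero {V : Type*} [AddCommGroup V] [Module ℂ V] {ψ χ : Module.Dual ℂ V}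
    (hψ : ψ ≠ 0) (hχ : χ ≠ 0) : QuadraticMap.linMulLin ψ χ ≠ 0 := by
  intro h
  obtain ⟨v, hv⟩ : ∃ v, ψ v ≠ 0 := by
    by_contra! hcon; exact hψ (LinearMap.ext hcon)
  obtain ⟨w, hw⟩ : ∃ v, χ v ≠ 0 := by
    by_contra! hcon; exact hχ (LinearMap.ext hcon)
  have h0 : ∀ u, ψ u * χ u = 0 := fun u => by
    have := congrArg (fun Q : QuadraticForm ℂ V => Q u) h
    simpa using this
  have hv' : χ v = 0 := (mul_eq_zero.1 (h0 v)).resolve_left hv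
  have hw' : ψ w = 0 := (mul_eq_zero.1 (h0 w)).resolve_right hw
  have := h0 (v + w)
  rw [map_add, map_add, hv', hw', add_zero, zero_add] at this
  exact mul_ne_zero hv hw this

theorem exists_dual_vanishing {V : Type*} [AddCommGroup V] [Module ℂ V] {W : Submodule ℂ V} (hW : W ≠ ⊤) :
    ∃ ψ : Module.Dual ℂ V, ψ ≠ 0 ∧ ∀ v ∈ W, ψ v = 0 := by
  obtain ⟨ψ, h0, hle⟩ := Submodule.exists_le_ker_of_lt_top _ (lt_top_iff_ne_top.2 hW)
  exact ⟨ψ, h0, fun v hv => hle hv⟩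

theorem finrank_map_add_inf_ker {V U : Type*} [AddCommGroup V] [Module ℂ V]
    [AddCommGroup U] [Module ℂ U] (W : Submodule ℂ V) [FiniteDimensional ℂ W]
    (π : V →ₗ[ℂ] U) :
    Module.finrank ℂ (W.map π) + Module.finrank ℂ ↥(W ⊓ LinearMap.ker π) = Module.finrank ℂ W := by
  have h1 := (π.domRestrict W).finrank_range_add_finrank_ker
  rw [LinearMap.range_domRestrict] at h1
  have h3 : (LinearMap.ker (π.domRestrict W)).map W.subtype = W ⊓ LinearMap.ker π := by
    ext y
    rw [Submodule.mem_map]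
    constructor
    · rintro ⟨z, hz, rfl⟩
      exact ⟨z.2, hz⟩
    · rintro ⟨hy, hy0⟩
      exact ⟨⟨y, hy⟩, hy0, rfl⟩
  rw [← h3, LinearEquiv.finrank_eq (Submodule.equivMapOfInjective _
      (Submodule.injective_subtype _) (LinearMap.ker (π.domRestrict W))).symm]
  exact h1

/-! ### Conics for the union of two sets sharing a point. -/

section Gluing

variable {V : Type*} [AddCommGroup V] [Module ℂ V] [FiniteDimensional ℂ V]

/-- As π maps the span W₁ of X₁ onto ℂ³, at most dim W₁ - 3 vectors of J lie in X₁, so at least dim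
W₂ - 1 lie outside X₁. Together with p these span W₂, so π contracts X₂ into the line of π p, and
the conic of X₁ contains it. -/
theorem exists_conic_of_map_eq_top {X₁ X₂ : Set V} {p : V} (hp0 : p ≠ 0) (hp₁ : p ∈ X₁) 
    (hp₂ : p ∈ X₂) (hdim : Module.finrank ℂ ↥(Submodule.span ℂ (X₁ ∪ X₂)) + 1 =
      Module.finrank ℂ (Submodule.span ℂ X₁) + Module.finrank ℂ (Submodule.span ℂ X₂))
    (h₁ : ProjectsToConics X₁) {J : Finset V} (hJ : (J : Set V) ⊆ X₁ ∪ X₂)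
    (hind : LinearIndepOn ℂ id (J : Set V))
    (hcard : J.card + 3 = Module.finrank ℂ (Submodule.span ℂ (X₁ ∪ X₂)))
    {π : V →ₗ[ℂ] (Fin 3 → ℂ)} (hπ : (Submodule.span ℂ X₁).map π = ⊤) (hπJ : ∀ j ∈ J, π j = 0) :
    ∃ Q : QuadraticForm ℂ (Fin 3 → ℂ), Q ≠ 0 ∧ ∀ v ∈ X₁ ∪ X₂, Q (π v) = 0 := by
  classical
  set W₁ := Submodule.span ℂ X₁
  set W₂ := Submodule.span ℂ X₂
  set J₁ : Finset V := J.filter (· ∈ X₁) with hJ₁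
  set J₂ : Finset V := J.filter (· ∉ X₁) with hJ₂
  have hJ₁X : (J₁ : Set V) ⊆ X₁ := fun v hv => (Finset.mem_filter.1 hv).2
  have hJ₂X : (J₂ : Set V) ⊆ X₂ := fun v hv => 
    (hJ (Finset.mem_filter.1 hv).1).resolve_left (Finset.mem_filter.1 hv).2
  have hcard12 : J₁.card + J₂.card = J.card := Finset.card_filter_add_card_filter_not _
  have hi₁ : LinearIndepOn ℂ id (J₁ : Set V) := hind.mono (Finset.coe_subset.2 (Finset.filter_subset _ _))
  have hi₂ : LinearIndepOn ℂ id (J₂ : Set V) := hind.mono (Finset.coe_subset.2 (Finset.filter_subset _ _))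
  have hr₁ : Module.finrank ℂ (Submodule.span ℂ (J₁ : Set V)) = J₁.card := finrank_span_finset_eq_card hi₁
  have hr₂ : Module.finrank ℂ (Submodule.span ℂ (J₂ : Set V)) = J₂.card := finrank_span_finset_eq_card hi₂
  have hdisj : Disjoint (Submodule.span ℂ (J₁ : Set V)) (Submodule.span ℂ (J₂ : Set V)) := by
    have hu : (J₁ : Set V) ∪ J₂ = J := by
      rw [← Finset.coe_union, hJ₁, hJ₂, Finset.filter_union_filter_not_eq]
    have hd : Disjoint (J₁ : Set V) J₂ := by
      rw [Finset.disjoint_coe]; exact Finset.disjoint_filter_filter_not _ _ _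
    rw [← hu] at hind
    exact ((linearIndepOn_id_union_iff hd).1 hind).2.2
  have hker := finrank_map_add_inf_ker W₁ π
  rw [hπ, finrank_top, Module.finrank_fin_fun] at hker
  have hle₁ : Submodule.span ℂ (J₁ : Set V) ≤ W₁ ⊓ LinearMap.ker π := by
    rw [Submodule.span_le]
    exact fun v hv => ⟨Submodule.subset_span (hJ₁X hv), hπJ v (Finset.mem_filter.1 hv).1⟩
  have hle₂ : Submodule.span ℂ (J₂ : Set V) ≤ W₂ := Submodule.span_mono hJ₂X
  have hc₁ := Submodule.finrank_mono hle₁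
  have hc₂ := Submodule.finrank_mono hle₂
  have hpW₂ : p ∈ W₂ := Submodule.subset_span hp₂
  -- it suffices to find the right center and to see that `W₂` collapses to `p`
  have key : ∀ J' : Finset V, (J' : Set V) ⊆ X₁ → LinearIndepOn ℂ id (J' : Set V) →
      J'.card + 3 = Module.finrank ℂ W₁ → (∀ j ∈ J', π j = 0) →
      W₂ ≤ Submodule.span ℂ (J₂ : Set V) ⊔ Submodule.span ℂ {p} →
      ∃ Q : QuadraticForm ℂ (Fin 3 → ℂ), Q ≠ 0 ∧ ∀ v ∈ X₁ ∪ X₂, Q (π v) = 0 := by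
    intro J' h1 h2 h3 h4 h5
    obtain ⟨Q, hQ, hQX⟩ := h₁ J' h1 h2 h3 π hπ h4
    refine ⟨Q, hQ, ?_⟩
    rintro v (hv | hv)
    · exact hQX v hv
    · obtain ⟨y, hy, z, hz, rfl⟩ := Submodule.mem_sup.1 (h5 (Submodule.subset_span hv))
      obtain ⟨a, rfl⟩ := Submodule.mem_span_singleton.1 hz
      have hy0 : π y = 0 := by
        have : Submodule.span ℂ (J₂ : Set V) ≤ LinearMap.ker π := by
          rw [Submodule.span_le]
          exact fun j hj => hπJ j (Finset.mem_filter.1 hj).1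
        exact this hy
      rw [map_add, hy0, zero_add, map_smul, QuadraticMap.map_smul, hQX p hp₁, smul_zero]
  -- If p lies in the span of J₂, then J₁ is one vector short of a center for X₁ and p supplies it.
  -- If not, J₁ is already a center.
  by_cases hpJ₂ : p ∈ Submodule.span ℂ (J₂ : Set V)
  · have hpJ₁ : p ∉ Submodule.span ℂ (J₁ : Set V) := fun h =>
      hp0 (Submodule.disjoint_def.1 hdisj p h hpJ₂)
    have hπp : π p = 0 := by
      have : Submodule.span ℂ (J₂ : Set V) ≤ LinearMap.ker π := by
        rw [Submodule.span_le]
        exact fun j hj => hπJ j (Finset.mem_filter.1 hj).1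
      exact this hpJ₂
    have hins : LinearIndepOn ℂ id ((insert p J₁ : Finset V) : Set V) := by
      rw [Finset.coe_insert]
      exact hi₁.id_insert hpJ₁
    have hpJ₁' : p ∉ J₁ := fun h => hpJ₁ (Submodule.subset_span h)
    have hcins : (insert p J₁).card = J₁.card + 1 := Finset.card_insert_of_notMem hpJ₁'
    have hle₁' : Submodule.span ℂ ((insert p J₁ : Finset V) : Set V) ≤ W₁ ⊓ LinearMap.ker π := by
      rw [Finset.coe_insert, Submodule.span_insert]
      exact sup_le ((Submodule.span_singleton_le_iff_mem _ _).2
        ⟨Submodule.subset_span hp₁, hπp⟩) hle₁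
    have hc₁' := Submodule.finrank_mono hle₁'
    rw [finrank_span_finset_eq_card hins, hcins] at hc₁'
    refine key (insert p J₁) ?_ hins (by omega) ?_ ?_
    · rw [Finset.coe_insert]; exact Set.insert_subset hp₁ hJ₁X
    · intro j hj
      rcases Finset.mem_insert.1 hj with rfl | hj
      · exact hπp
      · exact hπJ j (Finset.mem_filter.1 hj).1
    · have : Submodule.span ℂ (J₂ : Set V) = W₂ := Submodule.eq_of_le_of_finrank_le hle₂ (by omega)
      rw [this]; exact le_sup_left
  · have hins : LinearIndepOn ℂ id ((insert p J₂ : Finset V) : Set V) := by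
      rw [Finset.coe_insert]
      exact hi₂.id_insert hpJ₂
    have hpJ₂' : p ∉ J₂ := fun h => hpJ₂ (Submodule.subset_span h)
    have hcins : (insert p J₂).card = J₂.card + 1 := Finset.card_insert_of_notMem hpJ₂'
    have hle₂' : Submodule.span ℂ ((insert p J₂ : Finset V) : Set V) ≤ W₂ := by
      rw [Finset.coe_insert, Submodule.span_insert]
      exact sup_le ((Submodule.span_singleton_le_iff_mem _ _).2 hpW₂) hle₂
    have hc₂' := Submodule.finrank_mono hle₂'
    rw [finrank_span_finset_eq_card hins, hcins] at hc₂'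
    refine key J₁ hJ₁X hi₁ (by omega) (fun j hj => hπJ j (Finset.mem_filter.1 hj).1) ?_
    have : Submodule.span ℂ ((insert p J₂ : Finset V) : Set V) = W₂ :=
      Submodule.eq_of_le_of_finrank_le hle₂' 
        (by rw [finrank_span_finset_eq_card hins, hcins]; omega)
    rw [← this, Finset.coe_insert, Submodule.span_insert, sup_comm]

/-- If neither span maps onto ℂ³, both images lie in planes, and the product of the two linear forms
is the conic. -/
theorem ProjectsToConics.union {X₁ X₂ : Set V} {p : V} (hp0 : p ≠ 0) (hp₁ : p ∈ X₁) 
    (hp₂ : p ∈ X₂) (hdim : Module.finrank ℂ ↥(Submodule.span ℂ (X₁ ∪ X₂)) + 1 =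
      Module.finrank ℂ (Submodule.span ℂ X₁) + Module.finrank ℂ (Submodule.span ℂ X₂))
    (h₁ : ProjectsToConics X₁) (h₂ : ProjectsToConics X₂) : ProjectsToConics (X₁ ∪ X₂) := by
  intro J hJ hind hcard π hπ hπJ
  by_cases hW₁ : (Submodule.span ℂ X₁).map π = ⊤
  · exact exists_conic_of_map_eq_top hp0 hp₁ hp₂ hdim h₁ hJ hind hcard hW₁ hπJ
  by_cases hW₂ : (Submodule.span ℂ X₂).map π = ⊤
  · rw [Set.union_comm] at hJ hcard hdim ⊢
    rw [add_comm (Module.finrank ℂ (Submodule.span ℂ X₁))] at hdim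
    exact exists_conic_of_map_eq_top hp0 hp₂ hp₁ hdim h₂ hJ hind hcard hW₂ hπJ
  obtain ⟨ψ, hψ, hψ0⟩ := exists_dual_vanishing hW₁
  obtain ⟨χ, hχ, hχ0⟩ := exists_dual_vanishing hW₂
  refine ⟨QuadraticMap.linMulLin ψ χ, linMulLin_ne_zero hψ hχ, ?_⟩
  rintro v (hv | hv)
  · simp [hψ0 _ (Submodule.mem_map_of_mem (Submodule.subset_span hv))]
  · simp [hχ0 _ (Submodule.mem_map_of_mem (Submodule.subset_span hv))]

end Gluing

/-! ### Irreducible curves -/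

section CoordinateRing

variable {d : ℕ} {X : Set (ProjSpace d)}

/-- Evaluation of the homogeneous coordinate ring at a vector of the affine cone. -/
noncomputable def coordEval {v : Fin (d + 1) → ℂ} (hv : v ∈ cone X) :
    (MvPolynomial (Fin (d + 1)) ℂ ⧸ coneIdeal X) →ₐ[ℂ] ℂ :=
  Ideal.Quotient.liftₐ (coneIdeal X) (aeval v) (fun f hf => by
    rw [← hf v hv]; exact congrFun (congrArg DFunLike.coe (coe_aeval_eq_eval v)) f)

theorem coordEval_mk {v : Fin (d + 1) → ℂ} (hv : v ∈ cone X)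
    (f : MvPolynomial (Fin (d + 1)) ℂ) :
    coordEval hv (Ideal.Quotient.mk (coneIdeal X) f) = eval v f := by
  change aeval v f = _
  exact congrFun (congrArg DFunLike.coe (coe_aeval_eq_eval v)) f

theorem coord_eq_zero_iff (s : MvPolynomial (Fin (d + 1)) ℂ ⧸ coneIdeal X) :
    s = 0 ↔ ∀ v, ∀ hv : v ∈ cone X, coordEval hv s = 0 := by
  obtain ⟨f, rfl⟩ := Ideal.Quotient.mk_surjective s
  rw [Ideal.Quotient.eq_zero_iff_mem, mem_coneIdeal]
  simp only [coordEval_mk]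

theorem coord_separated (s : MvPolynomial (Fin (d + 1)) ℂ ⧸ coneIdeal X) (hs : s ≠ 0) :
    ∃ φ : (MvPolynomial (Fin (d + 1)) ℂ ⧸ coneIdeal X) →ₐ[ℂ] ℂ, φ s ≠ 0 := by
  rw [Ne, coord_eq_zero_iff] at hs
  push Not at hs
  obtain ⟨v, hv, h⟩ := hs
  exact ⟨_, h⟩

/-- The class of a dual vector in the homogeneous coordinate ring. -/
noncomputable def coordLinear (X : Set (ProjSpace d)) :
    Module.Dual ℂ (Fin (d + 1) → ℂ) →ₗ[ℂ] (MvPolynomial (Fin (d + 1)) ℂ ⧸ coneIdeal X) :=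
  ∑ i, (LinearMap.applyₗ (Pi.single i 1 : Fin (d + 1) → ℂ)).smulRight
    (Ideal.Quotient.mk (coneIdeal X) (MvPolynomial.X i))

theorem coordEval_coordLinear {v : Fin (d + 1) → ℂ} (hv : v ∈ cone X)
    (ψ : Module.Dual ℂ (Fin (d + 1) → ℂ)) : coordEval hv (coordLinear X ψ) = ψ v := by
  rw [coordLinear, LinearMap.sum_apply, map_sum]
  conv_rhs => rw [← LinearMap.sum_single_apply (fun _ : Fin (d + 1) => ℂ) v, map_sum]
  refine Finset.sum_congr rfl fun i _ => ?_
  have : (Pi.single i (v i) : Fin (d + 1) → ℂ) = v i • Pi.single i 1 := by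
    rw [← Pi.single_smul, smul_eq_mul, mul_one]
  rw [this, map_smul, LinearMap.smulRight_apply, map_smul, coordEval_mk]
  simp [mul_comm]

theorem ker_coordLinear : LinearMap.ker (coordLinear X) =
    (Submodule.span ℂ (cone X)).dualAnnihilator := by
  ext ψ
  rw [LinearMap.mem_ker, coord_eq_zero_iff, Submodule.mem_dualAnnihilator]
  simp only [coordEval_coordLinear]
  constructor
  · intro h v hv
    have : Submodule.span ℂ (cone X) ≤ LinearMap.ker ψ := Submodule.span_le.2 h
    exact this hv
  · exact fun h v hv => h v (Submodule.subset_span hv)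

theorem range_coordLinear : LinearMap.range (coordLinear X) = coordForms X 1 := by
  ext s
  constructor
  · rintro ⟨ψ, rfl⟩
    obtain ⟨f, hf, hfψ⟩ := exists_linear_form ψ
    refine ⟨f, hf, ?_⟩
    rw [← sub_eq_zero, coord_eq_zero_iff]
    intro v hv
    rw [map_sub, coordEval_coordLinear, ← hfψ, sub_eq_zero]
    exact coordEval_mk hv f
  · rintro ⟨f, hf, rfl⟩
    obtain ⟨ψ, hψ⟩ := exists_dual_of_form hf
    refine ⟨ψ, ?_⟩
    rw [← sub_eq_zero, coord_eq_zero_iff]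
    intro v hv
    rw [map_sub, coordEval_coordLinear, hψ, sub_eq_zero]
    exact (coordEval_mk hv f).symm

theorem finrank_coordForms_one :
    Module.finrank ℂ (coordForms X 1) = Module.finrank ℂ (Submodule.span ℂ (cone X)) := by
  have h1 := (coordLinear X).finrank_range_add_finrank_ker
  rw [ker_coordLinear, range_coordLinear, Subspace.dual_finrank_eq] at h1
  have h2 := Subspace.finrank_add_finrank_dualAnnihilator_eq (Submodule.span ℂ (cone X))
  omega

instance finiteDimensional_coordForms (m : ℕ) : FiniteDimensional ℂ (coordForms X m) :=
  inferInstance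

theorem nonempty_of_isPrime (hX : (coneIdeal X).IsPrime) : X.Nonempty := by
  by_contra h
  rw [Set.not_nonempty_iff_eq_empty] at h
  refine hX.ne_top ((Ideal.eq_top_iff_one _).2 ?_)
  rintro v ⟨p, hp, -⟩
  rw [h] at hp
  exact hp.elim

theorem finrank_span_cone_pos (hX : X.Nonempty) :
    0 < Module.finrank ℂ (Submodule.span ℂ (cone X)) := by
  obtain ⟨p, hp⟩ := hX
  refine Submodule.one_le_finrank_iff.2 ((Submodule.ne_bot_iff _).2
    ⟨p.rep, Submodule.subset_span (rep_mem_cone hp), p.rep_nonzero⟩)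

theorem le_hilbertFunction_of_isPrime (hX : (coneIdeal X).IsPrime) (m : ℕ) :
    Module.finrank ℂ (Submodule.span ℂ (cone X)) * m + 1 ≤ hilbertFunction X m + m := by
  have hpos := finrank_span_cone_pos (nonempty_of_isPrime hX)
  obtain ⟨n, hn⟩ := Nat.exists_eq_succ_of_ne_zero hpos.ne'
  rw [Nat.succ_eq_add_one] at hn
  have h1 := le_finrank_pow coord_separated n (coordForms X 1)
    (by rw [finrank_coordForms_one, hn]) m
  rw [← coordForms_eq_pow, finrank_coordForms] at h1
  rw [hn]
  have : (n + 1) * m = n * m + m := by ring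
  omega

/-- The classes of the linear forms vanishing on `J`. -/
noncomputable def coordLinearVanishing (X : Set (ProjSpace d)) (J : Finset (Fin (d + 1) → ℂ)) :
    Submodule ℂ (MvPolynomial (Fin (d + 1)) ℂ ⧸ coneIdeal X) :=
  (Submodule.span ℂ (J : Set (Fin (d + 1) → ℂ))).dualAnnihilator.map (coordLinear X)

instance (J : Finset (Fin (d + 1) → ℂ)) : FiniteDimensional ℂ (coordLinearVanishing X J) := by
  unfold coordLinearVanishing; infer_instance

/-- Each further independent vector of the cone imposes one condition on linear forms and, by
`finrank_pow_add_le`, at least m conditions on their m-th power. -/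
theorem finrank_coordLinearVanishing [hX : (coneIdeal X).IsPrime]
    (J : Finset (Fin (d + 1) → ℂ)) (hJX : (J : Set (Fin (d + 1) → ℂ)) ⊆ cone X)
    (hind : LinearIndepOn ℂ id (J : Set (Fin (d + 1) → ℂ)))
    (hcard : J.card < Module.finrank ℂ (Submodule.span ℂ (cone X))) :
    Module.finrank ℂ (coordLinearVanishing X J) + J.card =
      Module.finrank ℂ (Submodule.span ℂ (cone X)) ∧
    ∀ m, Module.finrank ℂ ↥(coordLinearVanishing X J ^ m) + J.card * m ≤
      hilbertFunction X m := by
  classical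
  induction J using Finset.induction_on with
  | empty =>
    have h0 : coordLinearVanishing X ∅ = coordForms X 1 := by
      rw [coordLinearVanishing, Finset.coe_empty, Submodule.span_empty,
        Submodule.dualAnnihilator_bot, Submodule.map_top, range_coordLinear]
    rw [h0]
    refine ⟨by rw [finrank_coordForms_one]; simp, fun m => ?_⟩
    rw [← finrank_coordForms, coordForms_eq_pow X m]
    simp
  | insert v J hv ih =>
    rw [Finset.card_insert_of_notMem hv] at hcard ⊢
    rw [Finset.coe_insert] at hJX hind
    have hvX : v ∈ cone X := hJX (Set.mem_insert _ _)
    obtain ⟨ih1, ih2⟩ := ih ((Set.subset_insert _ _).trans hJX) (hind.mono (Set.subset_insert _ _))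
      (by omega)
    have hvJ : v ∉ Submodule.span ℂ (J : Set (Fin (d + 1) → ℂ)) := by
      have := (linearIndepOn_id_insert (by simpa using hv)).1 hind
      exact this.2
    have hmem : ∀ y, y ∈ coordLinearVanishing X (insert v J) ↔
        y ∈ coordLinearVanishing X J ∧ coordEval hvX y = 0 := by
      intro y
      constructor
      · rintro ⟨ψ, hψ, rfl⟩
        rw [SetLike.mem_coe, Submodule.mem_dualAnnihilator, ] at hψ
        refine ⟨⟨ψ, ?_, rfl⟩, ?_⟩
        · rw [SetLike.mem_coe, Submodule.mem_dualAnnihilator]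
          exact fun w hw => hψ w (Submodule.span_mono (by simp) hw)
        · rw [coordEval_coordLinear]
          exact hψ v (Submodule.subset_span (by simp))
      · rintro ⟨⟨ψ, hψ, rfl⟩, h0⟩
        rw [coordEval_coordLinear] at h0
        refine ⟨ψ, ?_, rfl⟩
        rw [SetLike.mem_coe, Submodule.mem_dualAnnihilator] at hψ ⊢
        have : Submodule.span ℂ ((insert v J : Finset (Fin (d + 1) → ℂ)) : Set (Fin (d + 1) → ℂ)) ≤
            LinearMap.ker ψ := by
          rw [Submodule.span_le, Finset.coe_insert]
          exact Set.insert_subset h0 fun w hw => hψ w (Submodule.subset_span hw)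
        exact fun w hw => this hw
    have hex : ∃ x ∈ coordLinearVanishing X J, coordEval hvX x ≠ 0 := by
      obtain ⟨ψ, hψ, hψJ⟩ := Submodule.exists_le_ker_of_notMem hvJ
      refine ⟨coordLinear X ψ, ⟨ψ, ?_, rfl⟩, by rwa [coordEval_coordLinear]⟩
      rw [SetLike.mem_coe, Submodule.mem_dualAnnihilator]
      exact fun w hw => hψJ hw
    have h1 := finrank_inf_ker _ _ (coordEval hvX) hmem hex
    -- The strict bound on the cardinality keeps the space of forms nonzero, as the growth estimate
    -- requires.
    have hne : coordLinearVanishing X (insert v J) ≠ ⊥ := by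
      intro h
      rw [h, finrank_bot] at h1
      omega
    refine ⟨by omega, fun m => ?_⟩
    have h2 := finrank_pow_add_le _ _ (coordEval hvX) hmem hne hex m
    have h3 := ih2 m
    have : (J.card + 1) * m = J.card * m + m := by ring
    omega

/-- The coordinates of π restrict to a basis of the linear forms on X vanishing on J, whose m-th
power has dimension at most 2m + c. A quadratic relation among them is the equation of a conic
containing the projection. -/
theorem projectsToConics_of_isPrime (hX : (coneIdeal X).IsPrime) (c m₀ : ℕ)
    (hup : ∀ m ≥ m₀, hilbertFunction X m + m ≤
      Module.finrank ℂ (Submodule.span ℂ (cone X)) * m + c) : ProjectsToConics (cone X) := by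
  classical
  intro J hJX hind hcard π hπ hπJ
  obtain ⟨h1, h2⟩ := finrank_coordLinearVanishing J hJX hind (by omega)
  set b : Fin 3 → (MvPolynomial (Fin (d + 1)) ℂ ⧸ coneIdeal X) :=
    fun i => coordLinear X (LinearMap.proj i ∘ₗ π) with hb
  have hbv : ∀ v (hv : v ∈ cone X) i, coordEval hv (b i) = π v i := fun v hv i => by
    rw [hb]; simp only [coordEval_coordLinear]; rfl
  have hbf : ∀ v (hv : v ∈ cone X) (f : MvPolynomial (Fin 3) ℂ),
      coordEval hv (aeval b f) = eval (π v) f := by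
    intro v hv f
    have : (coordEval hv).comp (aeval b) = aeval (π v) := by
      ext i
      simp [hbv]
    rw [← AlgHom.comp_apply, this]
    exact congrFun (congrArg DFunLike.coe (coe_aeval_eq_eval (π v))) f
  have hli : LinearIndependent ℂ b := by
    rw [Fintype.linearIndependent_iff]
    intro g hg
    have hker : ∀ v ∈ cone X, ∑ i, g i * π v i = 0 := by
      intro v hv
      have := (coord_eq_zero_iff _).1 hg v hv
      rw [map_sum] at this
      rw [← this]
      refine Finset.sum_congr rfl fun i _ => ?_
      rw [map_smul, hbv, smul_eq_mul]
    have hall : ∀ w : Fin 3 → ℂ, ∑ i, g i * w i = 0 := by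
      intro w
      have hw : w ∈ (Submodule.span ℂ (cone X)).map π := by rw [hπ]; trivial
      obtain ⟨v, hv, rfl⟩ := hw
      induction hv using Submodule.span_induction with
      | mem v hv => exact hker v hv
      | zero => simp
      | add u v _ _ hu hv =>
        simp only [map_add, Pi.add_apply, mul_add, Finset.sum_add_distrib, hu, hv, add_zero]
      | smul a v _ hv =>
        simp only [map_smul, Pi.smul_apply, smul_eq_mul, mul_left_comm, ← Finset.mul_sum, hv,
          mul_zero]
    intro i
    simpa [Pi.single_apply] using hall (Pi.single i 1)
  have hspan : Submodule.span ℂ (Set.range b) = coordLinearVanishing X J := by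
    apply Submodule.eq_of_le_of_finrank_le
    · rw [Submodule.span_le]
      rintro _ ⟨i, rfl⟩
      refine ⟨_, ?_, rfl⟩
      rw [SetLike.mem_coe, Submodule.mem_dualAnnihilator]
      have : Submodule.span ℂ (J : Set (Fin (d + 1) → ℂ)) ≤ LinearMap.ker π :=
        Submodule.span_le.2 hπJ
      intro w hw
      have := this hw
      rw [LinearMap.mem_ker] at this
      simp [this]
    · rw [finrank_span_eq_card hli, Fintype.card_fin]
      omega
  obtain ⟨f, hf, hf0, hf2⟩ := exists_quadratic_relation coord_separated b hli (by
      intro f hf n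
      rw [coord_eq_zero_iff] at hf ⊢
      intro v hv
      rw [hbf]
      refine homogeneousComponent_vanishes (X := π '' cone X) ?_ ?_ n _ ⟨v, hv, rfl⟩
      · rintro _ ⟨u, hu, rfl⟩ a
        exact ⟨a • u, cone_smul_mem hu a, map_smul _ _ _⟩
      · rintro _ ⟨u, hu, rfl⟩
        rw [← hbf u hu]; exact hf u hu) c m₀ (by
      intro m hm
      rw [hspan]
      have h3 := h2 m
      have h4 := hup m hm
      rw [← hcard] at h4
      have : (J.card + 3) * m = J.card * m + 3 * m := by ring
      omega)
  obtain ⟨Q, hQ⟩ := exists_quadraticForm_of_form hf2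
  refine ⟨Q, ?_, fun v hv => ?_⟩
  · rintro rfl
    apply hf0
    apply MvPolynomial.funext
    intro v
    rw [← hQ]; simp
  · rw [hQ, ← hbf v hv, hf, map_zero]

end CoordinateRing

/-! ### Connected curves of minimal degree -/

theorem finrank_vanishing_add_hilbertFunction {d : ℕ} (X : Set (ProjSpace d)) (m : ℕ) :
    Module.finrank ℂ ↥((coneIdeal X).restrictScalars ℂ ⊓ homogeneousSubmodule (Fin (d + 1)) ℂ m) +
      hilbertFunction X m = Module.finrank ℂ (homogeneousSubmodule (Fin (d + 1)) ℂ m) := by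
  set ψ := (Ideal.Quotient.mkₐ ℂ (coneIdeal X)).toLinearMap with hψ
  have h := finrank_map_add_inf_ker (homogeneousSubmodule (Fin (d + 1)) ℂ m) ψ
  have hker : homogeneousSubmodule (Fin (d + 1)) ℂ m ⊓ LinearMap.ker ψ =
      (coneIdeal X).restrictScalars ℂ ⊓ homogeneousSubmodule (Fin (d + 1)) ℂ m := by
    ext f
    rw [inf_comm]
    refine and_congr ?_ Iff.rfl
    exact Ideal.Quotient.eq_zero_iff_mem
  rw [hker] at h
  change Module.finrank ℂ (coordForms X m) + _ = _ at h
  rw [← finrank_coordForms]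
  omega

/-- A multiple f * g that vanishes on X comes from a g that vanishes on X, because the ideal of X is
prime and omits f. So the multiples of f, which all vanish on Y, contribute the Hilbert function of
X in degree m to that of the union. -/
theorem hilbertFunction_union_ge {d : ℕ} {X Y : Set (ProjSpace d)} (hX : (coneIdeal X).IsPrime)
    {f : MvPolynomial (Fin (d + 1)) ℂ} {e : ℕ} (hf : f.IsHomogeneous e) (hfY : f ∈ coneIdeal Y)
    (hfX : f ∉ coneIdeal X) (m : ℕ) :
    hilbertFunction Y (e + m) + hilbertFunction X m ≤ hilbertFunction (Y ∪ X) (e + m) := by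
  have hf0 : f ≠ 0 := by rintro rfl; exact hfX (Ideal.zero_mem _)
  have hU : coneIdeal (Y ∪ X) = coneIdeal Y ⊓ coneIdeal X := by
    ext g
    simp only [mem_coneIdeal, cone_union, Ideal.mem_inf, Set.mem_union, or_imp, forall_and]
  have h1 := finrank_vanishing_add_hilbertFunction X m
  have h2 := finrank_vanishing_add_hilbertFunction Y (e + m)
  have h3 := finrank_vanishing_add_hilbertFunction (Y ∪ X) (e + m)
  set R := homogeneousSubmodule (Fin (d + 1)) ℂ
  set A := (coneIdeal (Y ∪ X)).restrictScalars ℂ ⊓ R (e + m) with hA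
  have hfd : ∀ I : Ideal (MvPolynomial (Fin (d + 1)) ℂ), ∀ k, FiniteDimensional ℂ
      ↥(I.restrictScalars ℂ ⊓ R k) :=
    fun I k => Submodule.finiteDimensional_of_le inf_le_right
  have hsup : formMultiples f m ⊔ A ≤ (coneIdeal Y).restrictScalars ℂ ⊓ R (e + m) := by
    refine sup_le ?_ ?_
    · rintro _ ⟨g, hg, rfl⟩
      exact ⟨Ideal.mul_mem_right _ _ hfY, hf.mul hg⟩
    · rintro g ⟨hg, hgm⟩
      exact ⟨coneIdeal_anti Set.subset_union_left hg, hgm⟩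
  have hinf : formMultiples f m ⊓ A ≤
      ((coneIdeal X).restrictScalars ℂ ⊓ R m).map (LinearMap.mulLeft ℂ f) := by
    rintro _ ⟨⟨g, hg, rfl⟩, hgA, -⟩
    refine ⟨g, ⟨?_, hg⟩, rfl⟩
    have : f * g ∈ coneIdeal X := coneIdeal_anti Set.subset_union_right hgA
    exact (hX.mem_or_mem this).resolve_left hfX
  have h4 := Submodule.finrank_sup_add_finrank_inf_eq (formMultiples f m) A
  have h5 := Submodule.finrank_mono hsup
  have h6 := Submodule.finrank_mono hinf
  have h7 := Submodule.finrank_map_le (LinearMap.mulLeft ℂ f) ((coneIdeal X).restrictScalars ℂ ⊓ R m)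
  rw [finrank_formMultiples hf0] at h4
  change _ = Module.finrank ℂ (R m) + _ at h4
  omega

/-- The growth of the Hilbert function of `X` is at least the one of a connected curve with the
same span, and sets of minimal growth project to conics. -/
structure MinimalGrowth {d : ℕ} (X : Set (ProjSpace d)) : Prop where
  lower : ∃ c : ℕ, ∀ m, Module.finrank ℂ (Submodule.span ℂ (cone X)) * m ≤
    hilbertFunction X m + m + c
  conics : ∀ c m₀ : ℕ, (∀ m ≥ m₀, hilbertFunction X m + m ≤
    Module.finrank ℂ (Submodule.span ℂ (cone X)) * m + c) → ProjectsToConics (cone X)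

theorem minimalGrowth_of_isPrime {d : ℕ} {X : Set (ProjSpace d)} (hX : (coneIdeal X).IsPrime) :
    MinimalGrowth X where
  lower := ⟨0, fun m => by have := le_hilbertFunction_of_isPrime hX m; omega⟩
  conics := fun c m₀ h => projectsToConics_of_isPrime hX c m₀ h

/-- The slopes of the Hilbert functions at least add, while spans with a common point satisfy n + 1
≤ a + b. Minimal growth of the union thus forces equality here and minimal growth of both parts, so
that their conics glue. -/
theorem MinimalGrowth.union {d : ℕ} {X Y : Set (ProjSpace d)} (hY : MinimalGrowth Y)
    (hYc : IsClosed Y) (hX : IsIrreducible X) (hXY : ¬ X ⊆ Y) (hne : (Y ∩ X).Nonempty) :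
    MinimalGrowth (Y ∪ X) := by
  have hprime := isPrime_coneIdeal hX
  have hX' := minimalGrowth_of_isPrime hprime
  obtain ⟨q, hqX, hqY⟩ := Set.not_subset.1 hXY
  obtain ⟨e, f, hfe, hfY, hfq⟩ := exists_form_of_isClosed hYc hqY
  have hfX : f ∉ coneIdeal X := fun h => hfq (h _ (rep_mem_cone hqX))
  have hadd := hilbertFunction_union_ge hprime hfe hfY hfX
  obtain ⟨c, hc⟩ := hY.lower
  have hlowX := le_hilbertFunction_of_isPrime hprime
  obtain ⟨p, hpY, hpX⟩ := hne
  set a := Module.finrank ℂ (Submodule.span ℂ (cone Y)) with ha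
  set b := Module.finrank ℂ (Submodule.span ℂ (cone X)) with hb
  set n := Module.finrank ℂ (Submodule.span ℂ (cone (Y ∪ X))) with hn
  have hnab : n + 1 ≤ a + b := by
    have h1 := Submodule.finrank_sup_add_finrank_inf_eq (Submodule.span ℂ (cone Y))
      (Submodule.span ℂ (cone X))
    rw [← Submodule.span_union, ← cone_union] at h1
    have h2 : 1 ≤ Module.finrank ℂ ↥(Submodule.span ℂ (cone Y) ⊓ Submodule.span ℂ (cone X)) :=
      Submodule.one_le_finrank_iff.2 ((Submodule.ne_bot_iff _).2 ⟨p.rep,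
        ⟨Submodule.subset_span (rep_mem_cone hpY), Submodule.subset_span (rep_mem_cone hpX)⟩,
        p.rep_nonzero⟩)
    omega
  have key : ∀ m, (a + b) * m + a * e ≤ hilbertFunction (Y ∪ X) (e + m) + 2 * m + e + c := by
    intro m
    have h1 := hadd m
    have h2 := hc (e + m)
    have h3 := hlowX m
    nlinarith
  constructor
  · refine ⟨c + n * e, fun m => ?_⟩
    rw [← hn]
    rcases Nat.lt_or_ge m e with hm | hm
    · have : n * m ≤ n * e := Nat.mul_le_mul_left _ hm.le
      omega
    · obtain ⟨k, rfl⟩ := Nat.exists_eq_add_of_le hm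
      have h1 := key k
      have h2 : (n + 1) * k ≤ (a + b) * k := Nat.mul_le_mul_right _ hnab
      nlinarith
  · intro c' m₀ h
    have hnab' : n + 1 = a + b := by
      refine le_antisymm hnab ?_
      by_contra hcon
      have h3 : n + 2 ≤ a + b := by omega
      -- The lower bound would have slope at least n and the upper bound has slope n - 1; this k is
      -- large enough for them to clash.
      set k := m₀ + n * e + c' + c + e + 1 with hk
      have h1 := key k
      have h2 := h (e + k) (by omega)
      have h4 : (n + 2) * k ≤ (a + b) * k := Nat.mul_le_mul_right _ h3
      nlinarith
    have hYK : ProjectsToConics (cone Y) := by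
      refine hY.conics (c' + b * e) (m₀ + e) fun m hm => ?_
      obtain ⟨k, rfl⟩ := Nat.exists_eq_add_of_le (show e ≤ m by omega)
      have h1 := h (e + k) (by omega)
      have h2 := hadd k
      have h3 := hlowX k
      have h4 : (n + 1) * (e + k) = (a + b) * (e + k) := by rw [hnab']
      nlinarith
    have hXK : ProjectsToConics (cone X) := by
      refine hX'.conics (c' + c + n * e) m₀ fun m hm => ?_
      have h1 := h (e + m) (by omega)
      have h2 := hadd m
      have h3 := hc (e + m)
      have h4 : (n + 1) * m = (a + b) * m := by rw [hnab']
      nlinarith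
    rw [cone_union]
    refine ProjectsToConics.union p.rep_nonzero (rep_mem_cone hpY) (rep_mem_cone hpX) ?_ hYK hXK
    rw [← cone_union]
    exact hnab'

/-- Take a maximal union of irreducible closed pieces having minimal growth. If it is not all of C,
connectedness provides a piece that meets it without being contained in it, and
`MinimalGrowth.union` enlarges it. -/
theorem minimalGrowth_of_isConnected {d : ℕ} {C : Set (ProjSpace d)} (hC : IsClosed C)
    (hconn : IsConnected C) : MinimalGrowth C := by
  obtain ⟨S, hSf, hSc, hSi, hCS⟩ :=
    TopologicalSpace.NoetherianSpace.exists_finite_set_isClosed_irreducible hC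
  set 𝒯 : Set (Set (Set (ProjSpace d))) :=
    {T | T ⊆ S ∧ (⋃₀ T).Nonempty ∧ MinimalGrowth (⋃₀ T)} with h𝒯
  have hfin : 𝒯.Finite := hSf.finite_subsets.subset fun T hT => hT.1
  have hne : 𝒯.Nonempty := by
    obtain ⟨p, hp⟩ := hconn.1
    rw [hCS] at hp
    obtain ⟨t, ht, hpt⟩ := hp
    refine ⟨{t}, Set.singleton_subset_iff.2 ht, ?_, ?_⟩
    · rw [Set.sUnion_singleton]; exact ⟨p, hpt⟩
    · rw [Set.sUnion_singleton]; exact minimalGrowth_of_isPrime (isPrime_coneIdeal (hSi t ht))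
  obtain ⟨T, ⟨hTS, hTne, hTg⟩, hmax⟩ := hfin.exists_maximal hne
  have hTclosed : IsClosed (⋃₀ T) := by
    rw [Set.sUnion_eq_biUnion]
    exact (hSf.subset hTS).isClosed_biUnion fun t ht => hSc t (hTS ht)
  suffices hall : ⋃₀ T = C by rw [← hall]; exact hTg
  have hTC : ⋃₀ T ⊆ C := by rw [hCS]; exact Set.sUnion_subset_sUnion hTS
  by_contra hneq
  set U : Set (Set (ProjSpace d)) := {t ∈ S | ¬ t ⊆ ⋃₀ T} with hU
  have hUclosed : IsClosed (⋃₀ U) := by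
    rw [Set.sUnion_eq_biUnion]
    exact (hSf.subset (Set.sep_subset _ _)).isClosed_biUnion fun t ht => hSc t ht.1
  have hcover : C ⊆ ⋃₀ T ∪ ⋃₀ U := by
    intro x hx
    rw [hCS] at hx
    obtain ⟨t, ht, hxt⟩ := hx
    by_cases h : t ⊆ ⋃₀ T
    · exact Or.inl (h hxt)
    · exact Or.inr ⟨t, ⟨ht, h⟩, hxt⟩
  have hCU : (C ∩ ⋃₀ U).Nonempty := by
    obtain ⟨x, hx, hxT⟩ := Set.not_subset.1 (fun h => hneq (Set.Subset.antisymm hTC h))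
    exact ⟨x, hx, (hcover hx).resolve_left hxT⟩
  have hCT : (C ∩ ⋃₀ T).Nonempty := by
    obtain ⟨x, hx⟩ := hTne
    exact ⟨x, hTC hx, hx⟩
  obtain ⟨x, -, hxT, t, ⟨htS, htT⟩, hxt⟩ := isPreconnected_closed_iff.1 hconn.2 _ _ hTclosed hUclosed
    hcover hCT hCU
  have hins : insert t T ∈ 𝒯 := by
    refine ⟨Set.insert_subset htS hTS, ⟨x, t, Set.mem_insert _ _, hxt⟩, ?_⟩
    rw [Set.sUnion_insert, Set.union_comm]
    exact hTg.union hTclosed (hSi t htS) htT ⟨x, hxT, hxt⟩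
  have := hmax hins (Set.subset_insert _ _)
  exact htT (Set.subset_sUnion_of_mem (this (Set.mem_insert _ _)))

theorem IsQuasiVeronese.projectsToConics {d : ℕ} {C : Set (ProjSpace d)}
    (hC : IsQuasiVeronese C) : ProjectsToConics (cone C) := by
  have hg := minimalGrowth_of_isConnected hC.isClosed hC.isConnected
  obtain ⟨c, hc⟩ := hC.degree
  obtain ⟨m₀, hm₀⟩ := Filter.eventually_atTop.1 hc
  have hspan : Module.finrank ℂ (Submodule.span ℂ (cone C)) = d + 1 := by
    rw [span_cone, not_onHyperplane_iff.1 hC.nondegenerate, finrank_top, Module.finrank_fin_fun]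
  refine hg.conics c.toNat m₀ fun m hm => ?_
  have h1 := hm₀ m hm
  have h2 := Int.self_le_toNat c
  rw [hspan]
  zify
  linarith

/-! ### Hexagons in the plane -/

section Hexagon

/-- The determinant of three vectors of `ℂ³`. -/
def bracket (u v w : Fin 3 → ℂ) : ℂ :=
  u 0 * (v 1 * w 2 - v 2 * w 1) - u 1 * (v 0 * w 2 - v 2 * w 0) + u 2 * (v 0 * w 1 - v 1 * w 0)

theorem bracket_eq_det (u v w : Fin 3 → ℂ) : bracket u v w = Matrix.det (Matrix.of ![u, v, w]) := by
  rw [Matrix.det_fin_three, bracket]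
  simp
  ring

theorem bracket_ne_zero_iff {u v w : Fin 3 → ℂ} :
    bracket u v w ≠ 0 ↔ LinearIndependent ℂ ![u, v, w] := by
  rw [bracket_eq_det, ← isUnit_iff_ne_zero, ← Matrix.isUnit_iff_isUnit_det,
    ← Matrix.linearIndependent_rows_iff_isUnit]
  rfl

theorem exists_comb_of_bracket_ne_zero {u v w : Fin 3 → ℂ} (h : bracket u v w ≠ 0)
    (x : Fin 3 → ℂ) : ∃ a b c : ℂ, x = a • u + b • v + c • w := by
  refine ⟨bracket x v w / bracket u v w, bracket u x w / bracket u v w,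
    bracket u v x / bracket u v w, ?_⟩
  ext i
  simp only [Pi.add_apply, Pi.smul_apply, smul_eq_mul]
  rw [div_mul_eq_mul_div, div_mul_eq_mul_div, div_mul_eq_mul_div, ← add_div, ← add_div,
    eq_div_iff h]
  fin_cases i <;> simp [bracket] <;> ring

theorem exists_comb_of_bracket_eq_zero {u v x : Fin 3 → ℂ} (hli : LinearIndependent ℂ ![u, v])
    (hx : bracket u v x = 0) : ∃ a b : ℂ, x = a • u + b • v := by
  by_contra hcon
  refine bracket_ne_zero_iff.2 ?_ hx
  have hsp : x ∉ Submodule.span ℂ (Set.range ![u, v]) := by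
    intro hmem
    rw [Matrix.range_cons, Matrix.range_cons, Matrix.range_empty, Set.union_empty,
      Set.singleton_union, Submodule.mem_span_pair] at hmem
    obtain ⟨a, b, h⟩ := hmem
    exact hcon ⟨a, b, h.symm⟩
  have e : ![u, v, x] = Fin.snoc ![u, v] x := by
    ext i
    fin_cases i <;> rfl
  rw [e]
  exact hli.finSnoc hsp

theorem exists_mulVec_of_bracket_eq_zero {u v w : Fin 3 → ℂ} (h : bracket u v w = 0) :
    ∃ a : Fin 3 → ℂ, a ≠ 0 ∧ (∑ i, u i * a i = 0) ∧ (∑ i, v i * a i = 0) ∧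
      (∑ i, w i * a i = 0) := by
  rw [bracket_eq_det] at h
  obtain ⟨a, ha, h0⟩ := Matrix.exists_mulVec_eq_zero_iff.2 h
  exact ⟨a, ha, congrFun h0 0, congrFun h0 1, congrFun h0 2⟩

theorem bracket_eq_zero_of_dual {u v w : Fin 3 → ℂ} {φ : Module.Dual ℂ (Fin 3 → ℂ)} (hφ : φ ≠ 0)
    (hu : φ u = 0) (hv : φ v = 0) (hw : φ w = 0) : bracket u v w = 0 := by
  by_contra h
  apply hφ
  refine LinearMap.ext fun x => ?_
  obtain ⟨a, b, c, rfl⟩ := exists_comb_of_bracket_ne_zero h x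
  simp [hu, hv, hw]

theorem exists_dual_of_bracket_eq_zero {u v w : Fin 3 → ℂ} (h : bracket u v w = 0) :
    ∃ φ : Module.Dual ℂ (Fin 3 → ℂ), φ ≠ 0 ∧ φ u = 0 ∧ φ v = 0 ∧ φ w = 0 := by
  obtain ⟨a, ha, hu, hv, hw⟩ := exists_mulVec_of_bracket_eq_zero h
  refine ⟨∑ i, a i • LinearMap.proj i, fun h0 => ha ?_, ?_, ?_, ?_⟩
  · ext i
    have := LinearMap.congr_fun h0 (Pi.single i 1)
    simpa [Pi.single_apply] using this
  · simpa [mul_comm] using hu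
  · simpa [mul_comm] using hv
  · simpa [mul_comm] using hw

theorem bracket_comb (a b c : Fin 3 → ℂ) (u v w : Fin 3 → ℂ) :
    bracket (a 0 • u + a 1 • v + a 2 • w) (b 0 • u + b 1 • v + b 2 • w)
      (c 0 • u + c 1 • v + c 2 • w) = bracket a b c * bracket u v w := by
  simp only [bracket, Pi.add_apply, Pi.smul_apply, smul_eq_mul]
  ring

/-- The intersection of the line `a b` with the line `c e`. -/
def lineMeet (a b c e : Fin 3 → ℂ) : Fin 3 → ℂ := bracket a c e • b - bracket b c e • a

theorem lineMeet_swap (a b c e : Fin 3 → ℂ) : lineMeet c e a b = - lineMeet a b c e := by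
  ext i
  fin_cases i <;> simp [lineMeet, bracket] <;> ring

/-- The expression whose vanishing means that the three intersections of opposite sides of a
hexagon are collinear. -/
def hexagonBracket (p : Fin 6 → Fin 3 → ℂ) : ℂ :=
  bracket (lineMeet (p 0) (p 1) (p 3) (p 4)) (lineMeet (p 1) (p 2) (p 4) (p 5))
    (lineMeet (p 2) (p 3) (p 5) (p 0))

/-- The three meets are permuted cyclically and one changes sign. This moves a degenerate triple of
consecutive vertices out of the way. -/
theorem hexagonBracket_rotate (p : Fin 6 → Fin 3 → ℂ) :
    hexagonBracket (fun i => p (i + 1)) = - hexagonBracket p := by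
  have h1 : hexagonBracket (fun i => p (i + 1)) =
      bracket (lineMeet (p 1) (p 2) (p 4) (p 5)) (lineMeet (p 2) (p 3) (p 5) (p 0))
        (lineMeet (p 3) (p 4) (p 0) (p 1)) := rfl
  rw [h1, lineMeet_swap (p 0) (p 1), hexagonBracket]
  simp only [bracket, Pi.neg_apply]
  ring

theorem lineMeet_comb (a b c e : Fin 3 → ℂ) (u v w : Fin 3 → ℂ) :
    lineMeet (a 0 • u + a 1 • v + a 2 • w) (b 0 • u + b 1 • v + b 2 • w)
      (c 0 • u + c 1 • v + c 2 • w) (e 0 • u + e 1 • v + e 2 • w) =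
    bracket u v w • (lineMeet a b c e 0 • u + lineMeet a b c e 1 • v + lineMeet a b c e 2 • w) := by
  rw [lineMeet, bracket_comb, bracket_comb]
  ext i
  simp only [lineMeet, Pi.sub_apply, Pi.add_apply, Pi.smul_apply, smul_eq_mul]
  ring

theorem bracket_smul (r s t : ℂ) (u v w : Fin 3 → ℂ) :
    bracket (r • u) (s • v) (t • w) = r * s * t * bracket u v w := by
  simp only [bracket, Pi.smul_apply, smul_eq_mul]
  ring

/-- Each of the three meets contributes one factor and the outer determinant the fourth. -/
theorem hexagonBracket_comb (a : Fin 6 → Fin 3 → ℂ) (u v w : Fin 3 → ℂ) :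
    hexagonBracket (fun i => a i 0 • u + a i 1 • v + a i 2 • w) =
      bracket u v w ^ 4 * hexagonBracket a := by
  simp only [hexagonBracket, lineMeet_comb, bracket_smul, bracket_comb]
  ring

/-- The determinant expressing that a conic through the coordinate points passes through `u`, `v`,
`w`. -/
def conicBracket (u v w : Fin 3 → ℂ) : ℂ :=
  bracket ![u 0 * u 1, u 1 * u 2, u 2 * u 0] ![v 0 * v 1, v 1 * v 2, v 2 * v 0]
    ![w 0 * w 1, w 1 * w 2, w 2 * w 0]

theorem hexagonBracket_basis (u v w : Fin 3 → ℂ) :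
    hexagonBracket ![![1, 0, 0], ![0, 1, 0], ![0, 0, 1], u, v, w] = - conicBracket u v w := by
  simp [hexagonBracket, conicBracket, lineMeet, bracket]
  ring

/-- The symmetry behind the converse of Pascal's theorem: Gale duality transposes the 3 × 3 matrix
of coordinates, and the conic condition is unchanged. -/
theorem conicBracket_transpose (u v w : Fin 3 → ℂ) :
    conicBracket ![u 0, v 0, w 0] ![u 1, v 1, w 1] ![u 2, v 2, w 2] = conicBracket u v w := by
  simp [conicBracket, bracket]
  ring

/-- The quadratic form with given coefficients. -/
noncomputable def conicForm : (Fin 6 → ℂ) →ₗ[ℂ] QuadraticForm ℂ (Fin 3 → ℂ) :=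
  ∑ k, (LinearMap.proj k).smulRight
    (QuadraticMap.linMulLin (LinearMap.proj ((![0, 1, 2, 0, 1, 2] : Fin 6 → Fin 3) k))
      (LinearMap.proj ((![0, 1, 2, 1, 2, 0] : Fin 6 → Fin 3) k)))

theorem conicForm_apply (a : Fin 6 → ℂ) (v : Fin 3 → ℂ) :
    conicForm a v = a 0 * (v 0 * v 0) + a 1 * (v 1 * v 1) + a 2 * (v 2 * v 2) +
      a 3 * (v 0 * v 1) + a 4 * (v 1 * v 2) + a 5 * (v 2 * v 0) := by
  rw [conicForm, Fin.sum_univ_six]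
  rfl

theorem conicForm_ne_zero {a : Fin 6 → ℂ} (ha : a ≠ 0) : conicForm a ≠ 0 := by
  intro h
  apply ha
  have h' : ∀ v, conicForm a v = 0 := fun v => by rw [h]; rfl
  have h0 := h' ![1, 0, 0]
  have h1 := h' ![0, 1, 0]
  have h2 := h' ![0, 0, 1]
  have h3 := h' ![1, 1, 0]
  have h4 := h' ![0, 1, 1]
  have h5 := h' ![1, 0, 1]
  simp [conicForm_apply] at h0 h1 h2 h3 h4 h5
  simp [h0, h1, h2] at h3 h4 h5
  ext k
  fin_cases k <;> simp [h0, h1, h2, h3, h4, h5]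

/-- The values at `v` of all quadratic forms. -/
noncomputable def conicEval (v : Fin 3 → ℂ) : Module.Dual ℂ (Fin 6 → ℂ) where
  toFun a := conicForm a v
  map_add' a b := by rw [map_add]; rfl
  map_smul' r a := by rw [map_smul]; rfl

theorem exists_conic_through_five (v : Fin 5 → Fin 3 → ℂ) :
    ∃ Q : QuadraticForm ℂ (Fin 3 → ℂ), Q ≠ 0 ∧ ∀ i, Q (v i) = 0 := by
  have h : LinearMap.ker (LinearMap.pi fun i => conicEval (v i)) ≠ ⊥ :=
    LinearMap.ker_ne_bot_of_finrank_lt (by simp)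
  obtain ⟨a, ha, ha0⟩ := (Submodule.ne_bot_iff _).1 h
  refine ⟨conicForm a, conicForm_ne_zero ha0, fun i => ?_⟩
  exact congrFun ha i

theorem map_comb_three (Q : QuadraticForm ℂ (Fin 3 → ℂ)) (u v w : Fin 3 → ℂ) (a b c : ℂ) :
    Q (a • u + b • v + c • w) = a * a * Q u + b * b * Q v + c * c * Q w +
      a * b * QuadraticMap.polar Q u v + b * c * QuadraticMap.polar Q v w +
        c * a * QuadraticMap.polar Q w u := by
  rw [QuadraticMap.map_add Q, QuadraticMap.map_add Q, QuadraticMap.polar_add_left]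
  simp only [QuadraticMap.map_smul, QuadraticMap.polar_smul_left, QuadraticMap.polar_smul_right,
    smul_eq_mul]
  rw [QuadraticMap.polar_comm Q w u]
  ring

theorem conicForm_surjective : Function.Surjective conicForm := by
  intro Q
  refine ⟨![Q ![1, 0, 0], Q ![0, 1, 0], Q ![0, 0, 1], QuadraticMap.polar Q ![1, 0, 0] ![0, 1, 0],
    QuadraticMap.polar Q ![0, 1, 0] ![0, 0, 1], QuadraticMap.polar Q ![0, 0, 1] ![1, 0, 0]], ?_⟩
  ext v
  have hv : v = v 0 • ![1, 0, 0] + v 1 • ![0, 1, 0] + v 2 • ![0, 0, 1] := by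
    ext i; fin_cases i <;> simp
  conv_rhs => rw [hv, map_comb_three]
  rw [conicForm_apply]
  simp
  ring

/-- If each six of a finite family of points lie on a conic, then all of them do. -/
theorem exists_conic_of_six {ι : Type*} [Finite ι] (q : ι → Fin 3 → ℂ)
    (h : ∀ I : Finset ι, I.card = 6 → ∃ Q : QuadraticForm ℂ (Fin 3 → ℂ), Q ≠ 0 ∧
      ∀ i ∈ I, Q (q i) = 0) :
    ∃ Q : QuadraticForm ℂ (Fin 3 → ℂ), Q ≠ 0 ∧ ∀ i, Q (q i) = 0 := by
  classical
  -- If the evaluations at the q i span the six-dimensional dual, six of them form a basis, and a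
  -- conic through those six points would be zero.
  by_cases hs : Submodule.span ℂ (Set.range fun i => conicEval (q i)) = ⊤
  · obtain ⟨κ, a, ha, hspan, hli⟩ := exists_linearIndependent' ℂ fun i => conicEval (q i)
    have : Finite κ := Finite.of_injective a ha
    have := Fintype.ofFinite κ
    have hcard : Fintype.card κ = 6 := by
      rw [← finrank_span_eq_card hli, hspan, hs, finrank_top, Subspace.dual_finrank_eq]
      simp
    obtain ⟨Q, hQ, hQI⟩ := h (Finset.univ.image a)
      (by rw [Finset.card_image_of_injective _ ha, Finset.card_univ, hcard])
    obtain ⟨c, rfl⟩ := conicForm_surjective Q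
    exfalso
    apply hQ
    have hle : Submodule.span ℂ (Set.range ((fun i => conicEval (q i)) ∘ a)) ≤
        LinearMap.ker (Module.Dual.eval ℂ (Fin 6 → ℂ) c) := by
      rw [Submodule.span_le]
      rintro _ ⟨k, rfl⟩
      exact hQI (a k) (Finset.mem_image_of_mem a (Finset.mem_univ k))
    rw [hspan, hs, top_le_iff, LinearMap.ker_eq_top] at hle
    have : c = 0 := (Module.eval_apply_eq_zero_iff ℂ c).1 hle
    rw [this, map_zero]
  · obtain ⟨Φ, hΦ, hΦ0⟩ := exists_dual_vanishing hs
    obtain ⟨c, rfl⟩ := (Module.evalEquiv ℂ (Fin 6 → ℂ)).surjective Φ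
    refine ⟨conicForm c, conicForm_ne_zero ?_, fun i => ?_⟩
    · rintro rfl; simp at hΦ
    · exact hΦ0 _ (Submodule.subset_span ⟨i, rfl⟩)

theorem bracket_eq_zero_of_comb_two (u v : Fin 3 → ℂ) (a b c a' b' c' : ℂ) :
    bracket (a • u + a' • v) (b • u + b' • v) (c • u + c' • v) = 0 := by
  simp only [bracket, Pi.add_apply, Pi.smul_apply, smul_eq_mul]
  ring

/-- In the basis p 0, p 1, p 2 the conic has only its three mixed coefficients. As it passes through
p 3, p 4, p 5, they annihilate the three rows of `conicBracket`. -/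
theorem hexagonBracket_eq_zero_of_bracket_ne_zero {p : Fin 6 → Fin 3 → ℂ} (h : bracket (p 0) (p 1) (p 2) ≠ 0)
    {Q : QuadraticForm ℂ (Fin 3 → ℂ)} (hQ : Q ≠ 0) (hQp : ∀ i, Q (p i) = 0) :
    hexagonBracket p = 0 := by
  obtain ⟨a3, b3, c3, h3⟩ := exists_comb_of_bracket_ne_zero h (p 3)
  obtain ⟨a4, b4, c4, h4⟩ := exists_comb_of_bracket_ne_zero h (p 4)
  obtain ⟨a5, b5, c5, h5⟩ := exists_comb_of_bracket_ne_zero h (p 5)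
  have hp : p = fun i => (![![1, 0, 0], ![0, 1, 0], ![0, 0, 1], ![a3, b3, c3], ![a4, b4, c4],
      ![a5, b5, c5]] : Fin 6 → Fin 3 → ℂ) i 0 • p 0 + (![![1, 0, 0], ![0, 1, 0], ![0, 0, 1],
      ![a3, b3, c3], ![a4, b4, c4], ![a5, b5, c5]] : Fin 6 → Fin 3 → ℂ) i 1 • p 1 +
      (![![1, 0, 0], ![0, 1, 0], ![0, 0, 1], ![a3, b3, c3], ![a4, b4, c4],
      ![a5, b5, c5]] : Fin 6 → Fin 3 → ℂ) i 2 • p 2 := by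
    funext i
    fin_cases i <;> simp [← h3, ← h4, ← h5]
  rw [hp, hexagonBracket_comb, hexagonBracket_basis]
  have hexp : ∀ a b c : ℂ, Q (a • p 0 + b • p 1 + c • p 2) =
      a * b * QuadraticMap.polar Q (p 0) (p 1) + b * c * QuadraticMap.polar Q (p 1) (p 2) +
        c * a * QuadraticMap.polar Q (p 2) (p 0) := by
    intro a b c
    rw [map_comb_three, hQp, hQp, hQp]
    ring
  suffices conicBracket ![a3, b3, c3] ![a4, b4, c4] ![a5, b5, c5] = 0 by rw [this]; simp
  by_contra hne
  set B : Fin 3 → ℂ := ![QuadraticMap.polar Q (p 0) (p 1), QuadraticMap.polar Q (p 1) (p 2),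
    QuadraticMap.polar Q (p 2) (p 0)] with hB
  have hrow : ∀ a b c : ℂ, Q (a • p 0 + b • p 1 + c • p 2) = 0 →
      (∑ i, B i • LinearMap.proj (R := ℂ) (φ := fun _ : Fin 3 => ℂ) i) ![a * b, b * c, c * a] = 0 := by
    intro a b c h
    rw [hexp] at h
    rw [← h, LinearMap.sum_apply, Fin.sum_univ_three]
    simp [hB]
    ring
  by_cases hB0 : B = 0
  · apply hQ
    ext x
    obtain ⟨a, b, c, rfl⟩ := exists_comb_of_bracket_ne_zero h x
    have e0 := congrFun hB0 0
    have e1 := congrFun hB0 1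
    have e2 := congrFun hB0 2
    simp [hB] at e0 e1 e2
    rw [hexp, e0, e1, e2]
    simp
  · apply hne
    refine bracket_eq_zero_of_dual
      (φ := ∑ i, B i • LinearMap.proj (R := ℂ) (φ := fun _ : Fin 3 => ℂ) i) ?_ ?_ ?_ ?_
    · intro h0
      apply hB0
      ext i
      have := LinearMap.congr_fun h0 (Pi.single i 1)
      simpa [Pi.single_apply] using this
    · exact hrow a3 b3 c3 (by rw [← h3]; exact hQp 3)
    · exact hrow a4 b4 c4 (by rw [← h4]; exact hQp 4)
    · exact hrow a5 b5 c5 (by rw [← h5]; exact hQp 5)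

/-- **Pascal's theorem**, including all degenerate cases. -/
theorem hexagonBracket_eq_zero_of_conic {p : Fin 6 → Fin 3 → ℂ}
    {Q : QuadraticForm ℂ (Fin 3 → ℂ)} (hQ : Q ≠ 0) (hQp : ∀ i, Q (p i) = 0) :
    hexagonBracket p = 0 := by
  by_cases h012 : bracket (p 0) (p 1) (p 2) = 0
  swap
  · exact hexagonBracket_eq_zero_of_bracket_ne_zero h012 hQ hQp
  by_cases h123 : bracket (p 1) (p 2) (p 3) = 0
  swap
  · have := hexagonBracket_eq_zero_of_bracket_ne_zero (p := fun i => p (i + 1)) h123 hQ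
      (fun i => hQp _)
    rwa [hexagonBracket_rotate, neg_eq_zero] at this
  by_cases hli : LinearIndependent ℂ ![p 1, p 2]
  -- Here p 0, p 1, p 2, p 3 are on one line, and this line contains all three meets.
  · have hcomb := fun x => exists_comb_of_bracket_eq_zero (x := x) hli
    obtain ⟨a, b, h0⟩ := hcomb (p 0) (by rw [← h012]; simp only [bracket]; ring)
    obtain ⟨a', b', h3⟩ := hcomb (p 3) h123
    have hX : lineMeet (p 0) (p 1) (p 3) (p 4) = (bracket (p 0) (p 3) (p 4) -
        bracket (p 1) (p 3) (p 4) * a) • p 1 + (- bracket (p 1) (p 3) (p 4) * b) • p 2 := by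
      rw [lineMeet]
      nth_rewrite 2 [h0]
      module
    have hY : lineMeet (p 1) (p 2) (p 4) (p 5) = (- bracket (p 2) (p 4) (p 5)) • p 1 +
        bracket (p 1) (p 4) (p 5) • p 2 := by
      rw [lineMeet]
      module
    have hZ : lineMeet (p 2) (p 3) (p 5) (p 0) = (bracket (p 2) (p 5) (p 0) * a') • p 1 +
        (bracket (p 2) (p 5) (p 0) * b' - bracket (p 3) (p 5) (p 0)) • p 2 := by
      rw [lineMeet]
      nth_rewrite 1 [h3]
      module
    rw [hexagonBracket, hX, hY, hZ, bracket_eq_zero_of_comb_two]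
  -- If p 1 and p 2 are proportional, the second meet is the zero vector.
  · rw [LinearIndependent.pair_iff] at hli
    push Not at hli
    obtain ⟨a, b, hab, hne⟩ := hli
    have hY : lineMeet (p 1) (p 2) (p 4) (p 5) = 0 := by
      by_cases ha : a = 0
      · have h2 : p 2 = 0 := by
          rw [ha, zero_smul, zero_add] at hab
          exact (smul_eq_zero.1 hab).resolve_left (hne ha)
        simp [lineMeet, h2, bracket]
      · have h1 : p 1 = (- b / a) • p 2 := by
          rw [eq_comm, div_eq_inv_mul, mul_smul, inv_smul_eq_iff₀ ha, neg_smul, neg_eq_iff_add_eq_zero,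
            add_comm]
          exact hab
        rw [lineMeet, h1]
        ext i
        simp only [bracket, Pi.sub_apply, Pi.smul_apply, Pi.zero_apply, smul_eq_mul]
        ring
    rw [hexagonBracket, hY]
    simp [bracket]

end Hexagon

/-! ### Gale duality -/

/-- `q` is a Gale dual of `p`: the linear relations of `p` are given by the linear functions of
`q`. -/
def IsGaleDual {ι V W : Type*} [Fintype ι] [AddCommGroup V] [Module ℂ V] [AddCommGroup W]
    [Module ℂ W] (p : ι → V) (q : ι → W) : Prop :=
  ∀ c : ι → ℂ, ∑ i, c i • p i = 0 ↔ ∃ y : Module.Dual ℂ W, ∀ i, c i = y (q i)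

theorem exists_conic_of_smul_eq {q : Fin 6 → Fin 3 → ℂ} {i j : Fin 6} (hij : i ≠ j) {a : ℂ}
    (h : q i = a • q j) : ∃ Q : QuadraticForm ℂ (Fin 3 → ℂ), Q ≠ 0 ∧ ∀ k, Q (q k) = 0 := by
  obtain ⟨Q, hQ, hQ0⟩ := exists_conic_through_five (q ∘ i.succAbove)
  have hne : ∀ k, k ≠ i → Q (q k) = 0 := by
    intro k hk
    obtain ⟨l, rfl⟩ := Fin.exists_succAbove_eq hk
    exact hQ0 l
  refine ⟨Q, hQ, fun k => ?_⟩
  by_cases hk : k = i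
  · rw [hk, h, QuadraticMap.map_smul, hne j hij.symm, smul_zero]
  · exact hne k hk

/-- One of the two vectors is a multiple of the other, and a conic passes through any five vectors.
-/
theorem exists_conic_of_not_linearIndependent_pair {q : Fin 6 → Fin 3 → ℂ} {i j : Fin 6}
    (hij : i ≠ j) (h : ¬ LinearIndependent ℂ ![q i, q j]) :
    ∃ Q : QuadraticForm ℂ (Fin 3 → ℂ), Q ≠ 0 ∧ ∀ k, Q (q k) = 0 := by
  rw [LinearIndependent.pair_iff] at h
  push Not at h
  obtain ⟨a, b, hab, hne⟩ := h
  by_cases ha : a = 0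
  · have h2 : q j = (0 : ℂ) • q i := by
      rw [ha, zero_smul, zero_add] at hab
      rw [zero_smul]
      exact (smul_eq_zero.1 hab).resolve_left (hne ha)
    exact exists_conic_of_smul_eq hij.symm h2
  · have h1 : q i = (- b / a) • q j := by
      rw [eq_comm, div_eq_inv_mul, mul_smul, inv_smul_eq_iff₀ ha, neg_smul, neg_eq_iff_add_eq_zero,
        add_comm]
      exact hab
    exact exists_conic_of_smul_eq hij h1

/-- The conic consists of the plane y = 0 and a plane through the two exceptional vectors. -/
theorem exists_conic_of_coplanar {q : Fin 6 → Fin 3 → ℂ} {y : Module.Dual ℂ (Fin 3 → ℂ)}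
    (hy : y ≠ 0) (i j : Fin 6) (h : ∀ k, k ≠ i → k ≠ j → y (q k) = 0) :
    ∃ Q : QuadraticForm ℂ (Fin 3 → ℂ), Q ≠ 0 ∧ ∀ k, Q (q k) = 0 := by
  obtain ⟨χ, hχ, hi, hj, -⟩ := exists_dual_of_bracket_eq_zero
    (show bracket (q i) (q j) 0 = 0 by simp [bracket])
  refine ⟨QuadraticMap.linMulLin y χ, linMulLin_ne_zero hy hχ, fun k => ?_⟩
  rw [QuadraticMap.linMulLin_apply]
  by_cases hki : k = i
  · rw [hki, hi, mul_zero]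
  by_cases hkj : k = j
  · rw [hkj, hj, mul_zero]
  rw [h k hki hkj, zero_mul]

theorem dual_eq_zero_of_bracket_ne_zero {u v w : Fin 3 → ℂ} (h : bracket u v w ≠ 0)
    {y : Module.Dual ℂ (Fin 3 → ℂ)} (hu : y u = 0) (hv : y v = 0) (hw : y w = 0) : y = 0 := by
  by_contra hy
  exact h (bracket_eq_zero_of_dual hy hu hv hw)

/-- In the basis p 0, p 1, p 2 the hexagon condition concerns the coordinate matrix of p 3, p 4, p
5. In the coordinates dual, up to sign, to q 3, q 4, q 5, the vectors q 0, q 1, q 2 have the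
transposed matrix. -/
theorem exists_conic_of_hexagon_of_bracket_ne_zero {p q : Fin 6 → Fin 3 → ℂ}
    (hpq : IsGaleDual p q) (hH : hexagonBracket p = 0)
    (h345 : bracket (q 3) (q 4) (q 5) ≠ 0) :
    ∃ Q : QuadraticForm ℂ (Fin 3 → ℂ), Q ≠ 0 ∧ ∀ k, Q (q k) = 0 := by
  have h012 : bracket (p 0) (p 1) (p 2) ≠ 0 := by
    rw [bracket_ne_zero_iff, Fintype.linearIndependent_iff]
    intro c hc
    obtain ⟨y, hy⟩ := (hpq ![c 0, c 1, c 2, 0, 0, 0]).1 (by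
      rw [Fin.sum_univ_three] at hc
      rw [Fin.sum_univ_six]
      simpa using hc)
    have hy0 : y = 0 := dual_eq_zero_of_bracket_ne_zero h345 (hy 3).symm (hy 4).symm (hy 5).symm
    intro i
    fin_cases i
    · exact (hy 0).trans (by rw [hy0]; rfl)
    · exact (hy 1).trans (by rw [hy0]; rfl)
    · exact (hy 2).trans (by rw [hy0]; rfl)
  obtain ⟨a3, b3, c3, h3⟩ := exists_comb_of_bracket_ne_zero h012 (p 3)
  obtain ⟨a4, b4, c4, h4⟩ := exists_comb_of_bracket_ne_zero h012 (p 4)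
  obtain ⟨a5, b5, c5, h5⟩ := exists_comb_of_bracket_ne_zero h012 (p 5)
  have hp : p = fun i => (![![1, 0, 0], ![0, 1, 0], ![0, 0, 1], ![a3, b3, c3], ![a4, b4, c4],
      ![a5, b5, c5]] : Fin 6 → Fin 3 → ℂ) i 0 • p 0 + (![![1, 0, 0], ![0, 1, 0], ![0, 0, 1],
      ![a3, b3, c3], ![a4, b4, c4], ![a5, b5, c5]] : Fin 6 → Fin 3 → ℂ) i 1 • p 1 +
      (![![1, 0, 0], ![0, 1, 0], ![0, 0, 1], ![a3, b3, c3], ![a4, b4, c4],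
      ![a5, b5, c5]] : Fin 6 → Fin 3 → ℂ) i 2 • p 2 := by
    funext i
    fin_cases i <;> simp [← h3, ← h4, ← h5]
  rw [hp, hexagonBracket_comb, hexagonBracket_basis, ← conicBracket_transpose] at hH
  have hC := (mul_eq_zero.1 hH).resolve_left (pow_ne_zero _ h012)
  rw [neg_eq_zero] at hC
  obtain ⟨α, hα, e0, e1, e2⟩ := exists_mulVec_of_bracket_eq_zero hC
  -- Expanding p 3 in the basis is a relation, hence a linear form: it takes the coordinates of p 3
  -- on q 0, q 1, q 2, the value -1 on q 3, and zero on q 4, q 5.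
  obtain ⟨y3, hy3⟩ := (hpq ![a3, b3, c3, -1, 0, 0]).1 (by
    rw [Fin.sum_univ_six]; simp only [Matrix.cons_val]; rw [h3]; module)
  obtain ⟨y4, hy4⟩ := (hpq ![a4, b4, c4, 0, -1, 0]).1 (by
    rw [Fin.sum_univ_six]; simp only [Matrix.cons_val]; rw [h4]; module)
  obtain ⟨y5, hy5⟩ := (hpq ![a5, b5, c5, 0, 0, -1]).1 (by
    rw [Fin.sum_univ_six]; simp only [Matrix.cons_val]; rw [h5]; module)
  set Q : QuadraticForm ℂ (Fin 3 → ℂ) := α 0 • QuadraticMap.linMulLin y3 y4 +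
    α 1 • QuadraticMap.linMulLin y4 y5 + α 2 • QuadraticMap.linMulLin y5 y3 with hQdef
  have hQ : ∀ v, Q v = α 0 * (y3 v * y4 v) + α 1 * (y4 v * y5 v) + α 2 * (y5 v * y3 v) :=
    fun v => rfl
  have f3 := fun k => (hy3 k).symm
  have f4 := fun k => (hy4 k).symm
  have f5 := fun k => (hy5 k).symm
  refine ⟨Q, fun h0 => hα ?_, ?_⟩
  -- The values at sums of two of q 3, q 4, q 5 recover the coefficients α.
  · have g1 : Q (q 3 + q 4) = 0 := by rw [h0]; rfl
    have g2 : Q (q 4 + q 5) = 0 := by rw [h0]; rfl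
    have g3 : Q (q 5 + q 3) = 0 := by rw [h0]; rfl
    rw [hQ] at g1 g2 g3
    simp [f3, f4, f5] at g1 g2 g3
    ext i
    fin_cases i
    · exact g1
    · exact g2
    · exact g3
  · rw [Fin.sum_univ_three] at e0 e1 e2
    simp only [Matrix.cons_val] at e0 e1 e2
    intro k
    rw [hQ, f3, f4, f5]
    fin_cases k
    · simp only [Fin.zero_eta, Matrix.cons_val]
      rw [← e0]; ring
    · simp only [Fin.mk_one, Matrix.cons_val]
      rw [← e1]; ring
    · simp only [Fin.reduceFinMk, Matrix.cons_val]
      rw [← e2]; ring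
    · simp
    · simp
    · simp

theorem IsGaleDual.comp_equiv {ι κ V W : Type*} [Fintype ι] [Fintype κ] [AddCommGroup V]
    [Module ℂ V] [AddCommGroup W] [Module ℂ W] {p : ι → V} {q : ι → W} (h : IsGaleDual p q)
    (e : κ ≃ ι) : IsGaleDual (p ∘ e) (q ∘ e) := by
  intro c
  have h1 := h (c ∘ e.symm)
  have h2 : ∑ i, (c ∘ e.symm) i • p i = ∑ k, c k • (p ∘ e) k := by
    rw [← Equiv.sum_comp e]
    simp
  rw [← h2, h1]
  constructor
  · rintro ⟨y, hy⟩
    exact ⟨y, fun k => by simpa using hy (e k)⟩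
  · rintro ⟨y, hy⟩
    exact ⟨y, fun i => by simpa using hy (e.symm i)⟩

/-- The converse of Pascal's theorem for the Gale dual of a hexagon. -/
theorem exists_conic_of_hexagon {p q : Fin 6 → Fin 3 → ℂ}
    (hpq : IsGaleDual p q) (hH : hexagonBracket p = 0) :
    ∃ Q : QuadraticForm ℂ (Fin 3 → ℂ), Q ≠ 0 ∧ ∀ k, Q (q k) = 0 := by
  by_cases h345 : bracket (q 3) (q 4) (q 5) = 0
  swap
  · exact exists_conic_of_hexagon_of_bracket_ne_zero hpq hH h345
  by_cases h450 : bracket (q 4) (q 5) (q 0) = 0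
  swap
  · obtain ⟨Q, hQ, hQ0⟩ := exists_conic_of_hexagon_of_bracket_ne_zero
      (p := fun i => p (i + 1)) (q := fun i => q (i + 1)) (hpq.comp_equiv (Equiv.addRight 1))
      (by rw [hexagonBracket_rotate, hH, neg_zero]) h450
    refine ⟨Q, hQ, fun k => ?_⟩
    have := hQ0 (k - 1)
    simpa using this
  -- If q 4, q 5 are independent, q 0 and q 3 lie in their plane, so only q 1 and q 2 can lie
  -- outside it.
  by_cases hli : LinearIndependent ℂ ![q 4, q 5]
  · obtain ⟨a, b, h3⟩ := exists_comb_of_bracket_eq_zero (x := q 3) hli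
      (by rw [← h345]; simp only [bracket]; ring)
    obtain ⟨a', b', h0⟩ := exists_comb_of_bracket_eq_zero hli h450
    obtain ⟨y, hy, h4, h5, -⟩ := exists_dual_of_bracket_eq_zero
      (show bracket (q 4) (q 5) 0 = 0 by simp [bracket])
    refine exists_conic_of_coplanar hy 1 2 fun k h1 h2 => ?_
    fin_cases k
    · simp only [Fin.zero_eta]
      rw [h0, map_add, map_smul, map_smul, h4, h5]; simp
    · exact absurd rfl h1
    · exact absurd rfl h2
    · simp only [Fin.reduceFinMk]
      rw [h3, map_add, map_smul, map_smul, h4, h5]; simp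
    · exact h4
    · exact h5
  · exact exists_conic_of_not_linearIndependent_pair (by decide) hli

/-! ### The incidence condition and projections -/

theorem linSpan_eq_span_rep {d : ℕ} (S : Set (ProjSpace d)) :
    linSpan S = Submodule.span ℂ (Projectivization.rep '' S) := by
  apply le_antisymm
  · refine iSup₂_le fun p hp => ?_
    rw [Projectivization.submodule_eq, Submodule.span_singleton_le_iff_mem]
    exact Submodule.subset_span ⟨p, hp, rfl⟩
  · rw [Submodule.span_le]
    rintro _ ⟨p, hp, rfl⟩
    exact (le_iSup₂_of_le (f := fun (p : ProjSpace d) (_ : p ∈ S) => p.submodule) p hp le_rfl)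
      (rep_mem_submodule p)

theorem linSpan_union {d : ℕ} (S T : Set (ProjSpace d)) :
    linSpan (S ∪ T) = linSpan S ⊔ linSpan T := by
  rw [linSpan_eq_span_rep, linSpan_eq_span_rep, linSpan_eq_span_rep, Set.image_union,
    Submodule.span_union]

theorem linSpan_pair {d : ℕ} (a b : ProjSpace d) :
    linSpan {a, b} = Submodule.span ℂ {a.rep, b.rep} := by
  rw [linSpan_eq_span_rep, Set.image_pair]

theorem finrank_span_pair_eq_two_iff {V : Type*} [AddCommGroup V] [Module ℂ V] {u v : V} :
    Module.finrank ℂ (Submodule.span ℂ {u, v}) = 2 ↔ LinearIndependent ℂ ![u, v] := by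
  have h : Set.range ![u, v] = {u, v} := by
    rw [Matrix.range_cons, Matrix.range_cons, Matrix.range_empty, Set.union_empty,
      Set.singleton_union]
  rw [linearIndependent_iff_card_eq_finrank_span, Set.finrank, h, Fintype.card_fin, eq_comm]

theorem exists_projection {d : ℕ} {U : Submodule ℂ (Fin (d + 1) → ℂ)}
    (hU : Module.finrank ℂ U + 3 = d + 1) :
    ∃ π : (Fin (d + 1) → ℂ) →ₗ[ℂ] (Fin 3 → ℂ), LinearMap.ker π = U ∧ LinearMap.range π = ⊤ := by
  have h := Submodule.finrank_quotient_add_finrank U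
  rw [Module.finrank_fin_fun] at h
  have e : ((Fin (d + 1) → ℂ) ⧸ U) ≃ₗ[ℂ] (Fin 3 → ℂ) :=
    LinearEquiv.ofFinrankEq _ _ (by rw [Module.finrank_fin_fun]; omega)
  refine ⟨e.toLinearMap ∘ₗ U.mkQ, ?_, ?_⟩
  · rw [LinearMap.ker_comp, LinearEquiv.ker, Submodule.comap_bot, Submodule.ker_mkQ]
  · rw [LinearMap.range_comp, Submodule.range_mkQ, Submodule.map_top, LinearEquiv.range]

/-! ### Intersections of lines and hyperplanes under projection. -/

section Meets

variable {d : ℕ} {J : Set (ProjSpace d)} {π : (Fin (d + 1) → ℂ) →ₗ[ℂ] (Fin 3 → ℂ)}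

theorem linSpan_pair_union_eq_comap (hker : LinearMap.ker π = linSpan J) (c e : ProjSpace d) :
    linSpan ({c, e} ∪ J) = (Submodule.span ℂ {π c.rep, π e.rep}).comap π := by
  rw [linSpan_union, ← hker, linSpan_pair, ← Set.image_pair (f := π), ← Submodule.map_span,
    Submodule.comap_map_eq]

theorem finrank_linSpan_pair_union (hker : LinearMap.ker π = linSpan J)
    (hJ : Module.finrank ℂ (linSpan J) + 3 = d + 1) (c e : ProjSpace d) :
    Module.finrank ℂ (linSpan ({c, e} ∪ J)) = d ↔ LinearIndependent ℂ ![π c.rep, π e.rep] := by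
  have h := finrank_map_add_inf_ker (linSpan ({c, e} ∪ J)) π
  have h1 : (linSpan ({c, e} ∪ J)).map π = Submodule.span ℂ {π c.rep, π e.rep} := by
    rw [linSpan_union, ← hker, linSpan_pair, ← Set.image_pair (f := π), ← Submodule.map_span,
      Submodule.map_sup, sup_eq_left]
    rintro _ ⟨v, hv, rfl⟩
    rw [LinearMap.mem_ker.1 hv]
    exact Submodule.zero_mem _
  have h2 : linSpan ({c, e} ∪ J) ⊓ LinearMap.ker π = linSpan J := by
    rw [hker, inf_eq_right, linSpan_union]
    exact le_sup_right
  rw [h1, h2] at h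
  rw [← finrank_span_pair_eq_two_iff]
  omega

theorem mem_linSpan_pair_union_iff (hker : LinearMap.ker π = linSpan J) {c e : ProjSpace d}
    (hce : LinearIndependent ℂ ![π c.rep, π e.rep]) (v : Fin (d + 1) → ℂ) :
    v ∈ linSpan ({c, e} ∪ J) ↔ bracket (π v) (π c.rep) (π e.rep) = 0 := by
  have hrot : bracket (π v) (π c.rep) (π e.rep) = bracket (π c.rep) (π e.rep) (π v) := by
    simp only [bracket]; ring
  rw [linSpan_pair_union_eq_comap hker, Submodule.mem_comap, Submodule.mem_span_pair, hrot]
  constructor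
  · rintro ⟨a, b, h⟩
    rw [← h]
    simp only [bracket, Pi.add_apply, Pi.smul_apply, smul_eq_mul]
    ring
  · intro h
    obtain ⟨a, b, h⟩ := exists_comb_of_bracket_eq_zero hce h
    exact ⟨a, b, h.symm⟩

theorem bracket_comb_left (r s : ℂ) (u v c e : Fin 3 → ℂ) :
    bracket (r • u + s • v) c e = r * bracket u c e + s * bracket v c e := by
  simp only [bracket, Pi.add_apply, Pi.smul_apply, smul_eq_mul]
  ring

/-- The intersection point of a line with a hyperplane through the center of a projection to the
plane is projected to the intersection of the two projected lines. -/
theorem MeetsAt.exists_smul_eq (hker : LinearMap.ker π = linSpan J)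
    (hJ : Module.finrank ℂ (linSpan J) + 3 = d + 1) {a b c e x : ProjSpace d}
    (h : MeetsAt a b ({c, e} ∪ J) x) :
    ∃ r : ℂ, π x.rep = r • lineMeet (π a.rep) (π b.rep) (π c.rep) (π e.rep) := by
  obtain ⟨hab, hS, hx⟩ := h
  rw [finrank_linSpan_pair_union hker hJ] at hS
  have hmem := mem_linSpan_pair_union_iff hker hS
  have hx' : x.rep ∈ linSpan {a, b} ⊓ linSpan ({c, e} ∪ J) := by
    rw [hx]; exact rep_mem_submodule x
  obtain ⟨hxl, hxS⟩ := hx'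
  rw [SetLike.mem_coe, linSpan_pair, Submodule.mem_span_pair] at hxl
  obtain ⟨r, s, hrs⟩ := hxl
  rw [SetLike.mem_coe, hmem, ← hrs, map_add, map_smul, map_smul, bracket_comb_left] at hxS
  rw [← hrs, map_add, map_smul, map_smul]
  by_cases h1 : bracket (π a.rep) (π c.rep) (π e.rep) = 0
  · by_cases h2 : bracket (π b.rep) (π c.rep) (π e.rep) = 0
    -- The line would lie in the hyperplane, and the intersection would have dimension two.
    · exfalso
      have hle : linSpan {a, b} ≤ linSpan ({c, e} ∪ J) := by
        rw [linSpan_pair, Submodule.span_le]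
        rintro v (rfl | rfl)
        · exact (hmem _).2 h1
        · exact (hmem _).2 h2
      rw [inf_eq_left.2 hle] at hx
      rw [hx, Projectivization.finrank_submodule] at hab
      omega
    · rw [h1, mul_zero, zero_add] at hxS
      have hs := (mul_eq_zero.1 hxS).resolve_right h2
      refine ⟨- r / bracket (π b.rep) (π c.rep) (π e.rep), ?_⟩
      simp only [lineMeet, h1, hs, zero_smul, zero_sub, add_zero, smul_neg, smul_smul,
        div_mul_cancel₀ _ h2, neg_smul, neg_neg]
  · refine ⟨s / bracket (π a.rep) (π c.rep) (π e.rep), ?_⟩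
    have hr : r = - (s / bracket (π a.rep) (π c.rep) (π e.rep) *
        bracket (π b.rep) (π c.rep) (π e.rep)) := by
      field_simp
      linear_combination hxS
    rw [lineMeet, smul_sub, smul_smul, smul_smul, div_mul_cancel₀ _ h1]
    nth_rewrite 1 [hr]
    module

/-- With A, B the brackets of a and b against the projected line, A b - B a spans the intersection.
A vector projecting to the meet itself, not just to a multiple, is provided so that the hexagon
determinant is obtained on the nose. -/
theorem exists_meetsAt (hker : LinearMap.ker π = linSpan J)
    (hJ : Module.finrank ℂ (linSpan J) + 3 = d + 1) {a b c e : ProjSpace d}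
    (hab : LinearIndependent ℂ ![a.rep, b.rep]) (hce : LinearIndependent ℂ ![π c.rep, π e.rep])
    (hne : bracket (π a.rep) (π c.rep) (π e.rep) ≠ 0 ∨
      bracket (π b.rep) (π c.rep) (π e.rep) ≠ 0) :
    ∃ x : ProjSpace d, MeetsAt a b ({c, e} ∪ J) x ∧ ∃ v ∈ x.submodule,
      π v = lineMeet (π a.rep) (π b.rep) (π c.rep) (π e.rep) := by
  have hmem := mem_linSpan_pair_union_iff hker hce
  set A := bracket (π a.rep) (π c.rep) (π e.rep) with hA
  set B := bracket (π b.rep) (π c.rep) (π e.rep) with hB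
  set v : Fin (d + 1) → ℂ := A • b.rep - B • a.rep with hv
  have hv0 : v ≠ 0 := by
    intro h0
    rw [LinearIndependent.pair_iff] at hab
    obtain ⟨h1, h2⟩ := hab (-B) A (by rw [← h0, hv]; module)
    rw [neg_eq_zero] at h1
    exact hne.elim (fun h => h h2) (fun h => h h1)
  have hπv : π v = lineMeet (π a.rep) (π b.rep) (π c.rep) (π e.rep) := by
    rw [hv, map_sub, map_smul, map_smul, lineMeet]
  refine ⟨Projectivization.mk ℂ v hv0, ⟨?_, ?_, ?_⟩, v, ?_, hπv⟩
  · rw [linSpan_pair, finrank_span_pair_eq_two_iff]; exact hab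
  · rw [finrank_linSpan_pair_union hker hJ]; exact hce
  · rw [Projectivization.submodule_mk]
    apply le_antisymm
    · rintro w ⟨hwl, hwS⟩
      rw [SetLike.mem_coe, linSpan_pair, Submodule.mem_span_pair] at hwl
      obtain ⟨r, s, rfl⟩ := hwl
      rw [SetLike.mem_coe, hmem, map_add, map_smul, map_smul, bracket_comb_left, ← hA, ← hB] at hwS
      rw [Submodule.mem_span_singleton]
      by_cases h1 : A = 0
      · have h2 : B ≠ 0 := hne.resolve_left (fun h => h h1)
        rw [h1, mul_zero, zero_add] at hwS
        have hs := (mul_eq_zero.1 hwS).resolve_right h2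
        refine ⟨- r / B, ?_⟩
        simp only [hv, h1, hs, zero_smul, zero_sub, add_zero, smul_neg, smul_smul,
          div_mul_cancel₀ _ h2, neg_smul, neg_neg]
      · refine ⟨s / A, ?_⟩
        have hr : r = - (s / A * B) := by
          field_simp
          linear_combination hwS
        rw [hv, smul_sub, smul_smul, smul_smul, div_mul_cancel₀ _ h1, hr]
        module
    · rw [Submodule.span_singleton_le_iff_mem]
      refine ⟨?_, ?_⟩
      · rw [SetLike.mem_coe, linSpan_pair, Submodule.mem_span_pair]
        exact ⟨-B, A, by rw [hv]; module⟩
      · rw [SetLike.mem_coe, hmem, hπv]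
        simp only [lineMeet, bracket, Pi.sub_apply, Pi.smul_apply, smul_eq_mul]
        ring
  · rw [Projectivization.submodule_mk]; exact Submodule.mem_span_singleton_self _

end Meets

/-! ### From conics to the incidence condition. -/

section Pascal

variable {d : ℕ}

open Classical in
/-- Representatives of the points outside of the hexagon. -/
noncomputable def complementVectors (P : Fin (d + 4) → ProjSpace d) (i : Fin 6 ↪o Fin (d + 4)) :
    Finset (Fin (d + 1) → ℂ) :=
  (Finset.univ.filter fun k => k ∉ Set.range i).image fun k => (P k).rep

theorem card_filter_notMem_range (i : Fin 6 ↪o Fin (d + 4)) [DecidablePred (· ∉ Set.range i)] :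
    (Finset.univ.filter fun k => k ∉ Set.range i).card + 6 = d + 4 := by
  classical
  have h := Finset.card_filter_add_card_filter_not (s := (Finset.univ : Finset (Fin (d + 4))))
    (fun k => k ∈ Set.range i)
  have h6 : (Finset.univ.filter fun k => k ∈ Set.range i).card = 6 := by
    have : (Finset.univ.filter fun k => k ∈ Set.range i) = Finset.univ.image i := by
      ext k; simp
    rw [this, Finset.card_image_of_injective _ i.injective, Finset.card_univ, Fintype.card_fin]
  rw [h6, Finset.card_univ, Fintype.card_fin] at h
  rw [add_comm]
  convert h

theorem span_complementVectors (P : Fin (d + 4) → ProjSpace d) (i : Fin 6 ↪o Fin (d + 4)) :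
    Submodule.span ℂ (complementVectors P i : Set (Fin (d + 1) → ℂ)) =
      linSpan (complementPoints P i) := by
  classical
  rw [linSpan_eq_span_rep, complementVectors, complementPoints, Finset.coe_image, Set.image_image]
  congr 2
  ext k
  simp

theorem card_complementVectors_le (P : Fin (d + 4) → ProjSpace d) (i : Fin 6 ↪o Fin (d + 4)) :
    (complementVectors P i).card + 6 ≤ d + 4 := by
  classical
  have h1 := card_filter_notMem_range i
  have h2 : (complementVectors P i).card ≤
      (Finset.univ.filter fun k => k ∉ Set.range i).card := Finset.card_image_le
  omega

theorem onHyperplane_of_finrank_lt {S : Set (ProjSpace d)}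
    (h : Module.finrank ℂ (linSpan S) < d + 1) : OnHyperplane S := by
  by_contra hcon
  rw [not_onHyperplane_iff] at hcon
  rw [hcon, finrank_top, Module.finrank_fin_fun] at h
  exact lt_irrefl _ h

theorem linSpan_triple (x y z : ProjSpace d) :
    linSpan {x, y, z} = Submodule.span ℂ {x.rep, y.rep, z.rep} := by
  rw [linSpan_eq_span_rep, Set.image_insert_eq, Set.image_pair]

/-- Projection from P_J sends the six points to a hexagon on a conic. Pascal's theorem puts the
projected intersections on a line, whose preimage is the required hyperplane. -/
theorem ProjectsToConics.pascalCondition {C : Set (ProjSpace d)}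
    (hC : ProjectsToConics (cone C)) (hspan : linSpan C = ⊤) {P : Fin (d + 4) → ProjSpace d}
    (hP : ∀ k, P k ∈ C) : PascalCondition P := by
  classical
  rintro i x y z ⟨hx, hy, hz⟩
  set J := complementPoints P i with hJ
  have hcard := card_complementVectors_le P i
  have hfin : Module.finrank ℂ (linSpan J) ≤ (complementVectors P i).card := by
    rw [hJ, ← span_complementVectors]; exact finrank_span_finset_le_card _
  have hle : Module.finrank ℂ ↥(linSpan ({x, y, z} ∪ J)) ≤ 3 + Module.finrank ℂ (linSpan J) := by
    rw [linSpan_union]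
    refine (Submodule.finrank_add_le_finrank_add_finrank _ _).trans ?_
    gcongr
    rw [linSpan_triple]
    have h3 := finrank_span_finset_le_card (R := ℂ) {x.rep, y.rep, z.rep}
    rw [Finset.coe_insert, Finset.coe_pair] at h3
    exact h3.trans Finset.card_le_three
  -- If the span of P_J is too small to be such a center, three further points cannot complete it to
  -- the whole space.
  by_cases hdim : Module.finrank ℂ (linSpan J) + 3 = d + 1
  swap
  · exact onHyperplane_of_finrank_lt (by omega)
  obtain ⟨π, hker, hrange⟩ := exists_projection hdim
  obtain ⟨r, hr⟩ := hx.exists_smul_eq hker hdim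
  obtain ⟨s, hs⟩ := hy.exists_smul_eq hker hdim
  obtain ⟨t, ht⟩ := hz.exists_smul_eq hker hdim
  have hcardeq : (complementVectors P i).card = Module.finrank ℂ (linSpan J) := by omega
  have hind : LinearIndepOn ℂ id (complementVectors P i : Set (Fin (d + 1) → ℂ)) := by
    rw [LinearIndepOn, linearIndependent_iff_card_eq_finrank_span, Set.finrank]
    have hrg : Set.range (fun v : ↥(complementVectors P i : Set (Fin (d + 1) → ℂ)) =>
        id (v : Fin (d + 1) → ℂ)) = (complementVectors P i : Set (Fin (d + 1) → ℂ)) :=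
      Subtype.range_coe
    rw [hrg, span_complementVectors, ← hJ, ← hcardeq]
    simp
  obtain ⟨Q, hQ, hQ0⟩ := hC (complementVectors P i) (by
      intro v hv
      obtain ⟨k, -, rfl⟩ := Finset.mem_image.1 hv
      exact rep_mem_cone (hP k)) hind (by
      rw [hcardeq, span_cone, hspan, finrank_top, Module.finrank_fin_fun, hdim]) π (by
      rw [span_cone, hspan, Submodule.map_top, hrange]) (by
      intro v hv
      have : v ∈ LinearMap.ker π := by
        rw [hker, hJ, ← span_complementVectors]
        exact Submodule.subset_span hv
      exact this)
  have hH := hexagonBracket_eq_zero_of_conic (p := fun k => π (P (i k)).rep) hQ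
    (fun k => hQ0 _ (rep_mem_cone (hP _)))
  have hbr : bracket (π x.rep) (π y.rep) (π z.rep) = 0 := by
    rw [hr, hs, ht, bracket_smul]
    change _ * hexagonBracket (fun k => π (P (i k)).rep) = 0
    rw [hH, mul_zero]
  obtain ⟨φ, hφ, hφx, hφy, hφz⟩ := exists_dual_of_bracket_eq_zero hbr
  refine ⟨φ ∘ₗ π, ?_, ?_⟩
  · intro h0
    apply hφ
    refine LinearMap.ext fun w => ?_
    obtain ⟨v, rfl⟩ := LinearMap.range_eq_top.1 hrange w
    exact LinearMap.congr_fun h0 v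
  · rintro p (hp | hp)
    · rw [Projectivization.submodule_eq, Submodule.span_singleton_le_iff_mem]
      rcases hp with rfl | rfl | rfl
      · exact hφx
      · exact hφy
      · exact hφz
    · intro v hv
      have hvk : v ∈ LinearMap.ker π := by
        rw [hker]
        exact (le_iSup₂_of_le (f := fun (p : ProjSpace d) (_ : p ∈ J) => p.submodule) p hp le_rfl) hv
      rw [LinearMap.mem_ker, LinearMap.comp_apply, LinearMap.mem_ker.1 hvk, map_zero]

theorem pascalCondition_of_isQuasiVeronese {C : Set (ProjSpace d)} (hC : IsQuasiVeronese C)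
    {P : Fin (d + 4) → ProjSpace d} (hP : ∀ k, P k ∈ C) : PascalCondition P :=
  hC.projectsToConics.pascalCondition (not_onHyperplane_iff.1 hC.nondegenerate) hP

end Pascal

/-! ### Pascal's condition and Gale duality -/

/-- The space of relations is three-dimensional; identified with the dual of ℂ³, its i-th coordinate
function is a vector q i. -/
theorem exists_isGaleDual {ι V : Type*} [Fintype ι] [AddCommGroup V] [Module ℂ V] (p : ι → V)
    (h : Module.finrank ℂ (Submodule.span ℂ (Set.range p)) + 3 = Fintype.card ι) :
    ∃ q : ι → Fin 3 → ℂ, IsGaleDual p q ∧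
      ∀ y : Module.Dual ℂ (Fin 3 → ℂ), (∀ i, y (q i) = 0) → y = 0 := by
  have h1 := LinearMap.finrank_range_add_finrank_ker (Fintype.linearCombination ℂ p)
  rw [Fintype.range_linearCombination, Module.finrank_fintype_fun_eq_card] at h1
  let e : Module.Dual ℂ (Fin 3 → ℂ) ≃ₗ[ℂ] LinearMap.ker (Fintype.linearCombination ℂ p) :=
    LinearEquiv.ofFinrankEq _ _ (by rw [Subspace.dual_finrank_eq, Module.finrank_fin_fun]; omega)
  let f : ι → Module.Dual ℂ (Module.Dual ℂ (Fin 3 → ℂ)) := fun i =>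
    LinearMap.proj i ∘ₗ Submodule.subtype _ ∘ₗ e.toLinearMap
  have hf : ∀ i y, y ((Module.evalEquiv ℂ (Fin 3 → ℂ)).symm (f i)) = (e y : ι → ℂ) i := by
    intro i y
    rw [Module.apply_evalEquiv_symm_apply]
    rfl
  refine ⟨fun i => (Module.evalEquiv ℂ (Fin 3 → ℂ)).symm (f i), fun c => ?_, fun y hy => ?_⟩
  swap
  · simp only [hf] at hy
    rw [← map_eq_zero_iff e e.injective]
    exact Subtype.ext (funext hy)
  simp only [hf]
  constructor
  · intro hc
    refine ⟨e.symm ⟨c, hc⟩, fun i => ?_⟩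
    rw [LinearEquiv.apply_symm_apply]
  · rintro ⟨y, hy⟩
    have h2 : c = (e y : ι → ℂ) := funext hy
    rw [h2]
    exact (e y).2

/-- A relation between p a and p b alone is a linear form vanishing on all the other q k. -/
theorem IsGaleDual.linearIndependent_pair {ι V W : Type*} [Fintype ι] [AddCommGroup V] [Module ℂ V]
    [AddCommGroup W] [Module ℂ W] {p : ι → V} {q : ι → W} (h : IsGaleDual p q) {a b : ι}
    (hab : a ≠ b)
    (hy : ∀ y : Module.Dual ℂ W, (∀ k, k ≠ a → k ≠ b → y (q k) = 0) → y = 0) :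
    LinearIndependent ℂ ![p a, p b] := by
  classical
  rw [LinearIndependent.pair_iff]
  intro r s hrs
  obtain ⟨y, hyc⟩ := (h (Pi.single a r + Pi.single b s)).1 (by
    simp only [Pi.add_apply, add_smul, Finset.sum_add_distrib, Pi.single_apply, ite_smul, zero_smul,
      Finset.sum_ite_eq', Finset.mem_univ, if_true]
    exact hrs)
  have hy0 := hy y (fun k hka hkb => by
    rw [← hyc k, Pi.add_apply, Pi.single_eq_of_ne hka, Pi.single_eq_of_ne hkb, add_zero])
  constructor
  · have := hyc a
    rw [hy0] at this
    simpa [Pi.single_eq_of_ne hab] using this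
  · have := hyc b
    rw [hy0] at this
    simpa [Pi.single_eq_of_ne hab.symm] using this

/-- If p 0 and p 1 were both on the line p 3 p 4, two relations would give forms y, z vanishing on q
2, q 5 with z (q 0) = 0, z ≠ 0 and y (q 0) = -1. Then q 0 lies in the span of q 2, q 5, where y
vanishes. -/
theorem hexagon_nondegenerate {p q : Fin 6 → Fin 3 → ℂ} (hpq : IsGaleDual p q)
    (hcop : ∀ (a b : Fin 6) (y : Module.Dual ℂ (Fin 3 → ℂ)),
      (∀ k, k ≠ a → k ≠ b → y (q k) = 0) → y = 0)
    (hli : ∀ a b, a ≠ b → LinearIndependent ℂ ![q a, q b]) :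
    LinearIndependent ℂ ![p 0, p 1] ∧ LinearIndependent ℂ ![p 3, p 4] ∧
      (bracket (p 0) (p 3) (p 4) ≠ 0 ∨ bracket (p 1) (p 3) (p 4) ≠ 0) := by
  have h34 := hpq.linearIndependent_pair (a := 3) (b := 4) (by decide) (hcop _ _)
  refine ⟨hpq.linearIndependent_pair (by decide) (hcop _ _), h34, ?_⟩
  by_contra hcon
  push Not at hcon
  have hrot : ∀ u v w, bracket u v w = bracket v w u := by
    intro u v w; simp only [bracket]; ring
  rw [hrot (p 0), hrot (p 1)] at hcon
  obtain ⟨a, b, h0⟩ := exists_comb_of_bracket_eq_zero h34 hcon.1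
  obtain ⟨a', b', h1⟩ := exists_comb_of_bracket_eq_zero h34 hcon.2
  obtain ⟨y, hy⟩ := (hpq ![-1, 0, 0, a, b, 0]).1 (by
    rw [Fin.sum_univ_six]; simp only [Matrix.cons_val]; rw [h0]; module)
  obtain ⟨z, hz⟩ := (hpq ![0, -1, 0, a', b', 0]).1 (by
    rw [Fin.sum_univ_six]; simp only [Matrix.cons_val]; rw [h1]; module)
  have h25 : LinearIndependent ℂ ![q 2, q 5] := hli 2 5 (by decide)
  have hz0 : z ≠ 0 := by
    intro h
    have := hz 1
    rw [h] at this
    simp at this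
  obtain ⟨r, s, hrs⟩ := exists_comb_of_bracket_eq_zero h25
    (bracket_eq_zero_of_dual hz0 (hz 2).symm (hz 5).symm (hz 0).symm)
  have hy0 := hy 0
  rw [hrs, map_add, map_smul, map_smul, ← hy 2, ← hy 5] at hy0
  simp at hy0

section

variable {d : ℕ} {P : Fin (d + 4) → ProjSpace d}

/-- A relation among the P_J is a linear form vanishing on the six q (i k), so the P_J are
independent. -/
theorem finrank_linSpan_complementPoints {q : Fin (d + 4) → Fin 3 → ℂ}
    (hq : IsGaleDual (fun k => (P k).rep) q) (i : Fin 6 ↪o Fin (d + 4))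
    (hy : ∀ y : Module.Dual ℂ (Fin 3 → ℂ), (∀ k, y (q (i k)) = 0) → y = 0) :
    Module.finrank ℂ (linSpan (complementPoints P i)) + 3 = d + 1 := by
  classical
  set s := Finset.univ.filter fun k => k ∉ Set.range i with hs
  have hcard : s.card + 6 = d + 4 := card_filter_notMem_range i
  have hli : LinearIndepOn ℂ (fun k => (P k).rep) (s : Set (Fin (d + 4))) := by
    rw [linearIndepOn_finset_iff]
    intro c hc
    obtain ⟨y, hyc⟩ := (hq fun k => if k ∈ s then c k else 0).1 (by
      rw [← hc]
      simp only [ite_smul, zero_smul, Finset.sum_ite_mem, Finset.univ_inter])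
    have hy0 := hy y (fun k => by rw [← hyc, if_neg]; simp [hs])
    intro k hk
    have := hyc k
    rw [if_pos hk, hy0] at this
    exact this
  have h := finrank_span_eq_card hli
  have hrange : Set.range (fun k : (s : Set (Fin (d + 4))) => (P k).rep) =
      Projectivization.rep '' complementPoints P i := by
    ext v
    simp [complementPoints, hs]
  rw [hrange, ← linSpan_eq_span_rep] at h
  rw [h]
  simp only [Fintype.card_coe, Finset.coe_sort_coe]
  omega

/-- Contraction is dual to restriction: a relation of the projected vectors is a combination of the
P (i k) lying in the span of P_J, that is, a relation of all P k with the coefficients outside I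
forgotten. -/
theorem IsGaleDual.projection {q : Fin (d + 4) → Fin 3 → ℂ}
    (hq : IsGaleDual (fun k => (P k).rep) q) (i : Fin 6 ↪o Fin (d + 4))
    {π : (Fin (d + 1) → ℂ) →ₗ[ℂ] (Fin 3 → ℂ)}
    (hker : LinearMap.ker π = linSpan (complementPoints P i)) :
    IsGaleDual (fun k => π (P (i k)).rep) (fun k => q (i k)) := by
  classical
  intro c
  have hsum : ∀ b : Fin (d + 4) → ℂ, ∑ k, b k • (P k).rep = ∑ k, b (i k) • (P (i k)).rep +
      ∑ k ∈ Finset.univ.filter (fun k => k ∉ Set.range i), b k • (P k).rep := by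
    intro b
    rw [← Finset.sum_filter_add_sum_filter_not Finset.univ (fun k => k ∈ Set.range i)]
    congr 1
    rw [← Finset.sum_image (s := Finset.univ) (g := i) (f := fun k => b k • (P k).rep)
      (fun _ _ _ _ h => i.injective h)]
    congr 1
    ext k
    simp
  have hmem : ∑ k, c k • π (P (i k)).rep = 0 ↔
      ∑ k, c k • (P (i k)).rep ∈ linSpan (complementPoints P i) := by
    rw [← hker, LinearMap.mem_ker, map_sum]
    simp only [map_smul]
  rw [hmem]
  constructor
  · intro h
    rw [linSpan_eq_span_rep, complementPoints, Set.image_image] at h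
    rw [← Set.coe_toFinset ((Set.range i)ᶜ)] at h
    obtain ⟨g, hg⟩ := Submodule.mem_span_image_finset_iff_exists_fun ℂ |>.1 h
    obtain ⟨f, hf⟩ : ∃ f : Fin (d + 4) → ℂ, ∑ k ∈ (Set.range i)ᶜ.toFinset, f k • (P k).rep =
        ∑ k, c k • (P (i k)).rep := by
      refine ⟨fun k => if h : k ∈ (Set.range i)ᶜ.toFinset then g ⟨k, h⟩ else 0, ?_⟩
      rw [← hg, ← Finset.sum_coe_sort]
      refine Finset.sum_congr rfl fun k _ => ?_
      beta_reduce
      rw [dif_pos k.2]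
    obtain ⟨y, hy⟩ := (hq (fun k => if h : k ∈ Set.range i then c h.choose else - f k)).1 (by
      rw [hsum]
      have h1 : ∀ k, (if h : i k ∈ Set.range i then c h.choose else - f (i k)) = c k := by
        intro k
        have hk : i k ∈ Set.range i := ⟨k, rfl⟩
        rw [dif_pos hk]
        exact congrArg c (i.injective hk.choose_spec)
      simp only [h1]
      rw [← hf]
      have hset : (Set.range i)ᶜ.toFinset = Finset.univ.filter (fun k => k ∉ Set.range i) := by
        ext k; simp
      rw [hset, ← Finset.sum_add_distrib]
      refine Finset.sum_eq_zero fun k hk => ?_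
      rw [dif_neg (Finset.mem_filter.1 hk).2]
      module)
    refine ⟨y, fun k => ?_⟩
    rw [← hy (i k)]
    have hk : i k ∈ Set.range i := ⟨k, rfl⟩
    rw [dif_pos hk]
    exact congrArg c (i.injective hk.choose_spec).symm
  · rintro ⟨y, hy⟩
    have h0 := (hq (fun k => y (q k))).2 ⟨y, fun _ => rfl⟩
    rw [hsum] at h0
    simp only [← hy] at h0
    rw [eq_neg_of_add_eq_zero_left h0]
    refine Submodule.neg_mem _ (Submodule.sum_mem _ fun k hk => Submodule.smul_mem _ _ ?_)
    rw [linSpan_eq_span_rep]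
    exact Submodule.subset_span ⟨P k, ⟨k, (Finset.mem_filter.1 hk).2, rfl⟩, rfl⟩

theorem linearIndependent_pair_of_map {V W : Type*} [AddCommGroup V] [Module ℂ V] [AddCommGroup W]
    [Module ℂ W] (f : V →ₗ[ℂ] W) {u v : V} (h : LinearIndependent ℂ ![f u, f v]) :
    LinearIndependent ℂ ![u, v] := by
  rw [LinearIndependent.pair_iff] at h ⊢
  intro r s hrs
  refine h r s ?_
  rw [← map_smul, ← map_smul, ← map_add, hrs, map_zero]

/-- In a sufficiently general situation, the three intersections are points, which are projected to
the intersections of opposite sides of a plane hexagon. -/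
theorem exists_isPascalTriple {i : Fin 6 ↪o Fin (d + 4)}
    {π : (Fin (d + 1) → ℂ) →ₗ[ℂ] (Fin 3 → ℂ)}
    (hker : LinearMap.ker π = linSpan (complementPoints P i))
    (hJ : Module.finrank ℂ (linSpan (complementPoints P i)) + 3 = d + 1)
    {q : Fin 6 → Fin 3 → ℂ} (hpq : IsGaleDual (fun k => π (P (i k)).rep) q)
    (hcop : ∀ (a b : Fin 6) (y : Module.Dual ℂ (Fin 3 → ℂ)),
      (∀ k, k ≠ a → k ≠ b → y (q k) = 0) → y = 0)
    (hli : ∀ a b, a ≠ b → LinearIndependent ℂ ![q a, q b]) :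
    ∃ x y z : ProjSpace d, IsPascalTriple P i x y z ∧ ∃ u ∈ x.submodule, ∃ v ∈ y.submodule,
      ∃ w ∈ z.submodule, bracket (π u) (π v) (π w) = hexagonBracket fun k => π (P (i k)).rep := by
  -- The hypotheses on q are invariant under rotation, so the statement for the first pair of
  -- opposite sides serves for the other two.
  have hshift : ∀ m : Fin 6, (∀ (a b : Fin 6) (y : Module.Dual ℂ (Fin 3 → ℂ)),
      (∀ k, k ≠ a → k ≠ b → y ((q ∘ Equiv.addRight m) k) = 0) → y = 0) := by
    intro m a b y h
    refine hcop (a + m) (b + m) y fun k hka hkb => ?_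
    have := h (k - m) (fun e => hka (by rw [← e, sub_add_cancel]))
      (fun e => hkb (by rw [← e, sub_add_cancel]))
    simpa using this
  have hshift' : ∀ m : Fin 6, ∀ a b, a ≠ b → LinearIndependent ℂ
      ![(q ∘ Equiv.addRight m) a, (q ∘ Equiv.addRight m) b] := fun m a b hab =>
    hli _ _ fun e => hab ((Equiv.addRight m).injective e)
  obtain ⟨a1, b1, c1⟩ := hexagon_nondegenerate hpq hcop hli
  obtain ⟨a2, b2, c2⟩ := hexagon_nondegenerate (hpq.comp_equiv (Equiv.addRight 1)) (hshift 1)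
    (hshift' 1)
  obtain ⟨a3, b3, c3⟩ := hexagon_nondegenerate (hpq.comp_equiv (Equiv.addRight 2)) (hshift 2)
    (hshift' 2)
  obtain ⟨x, hx, u, hu, hxu⟩ := exists_meetsAt hker hJ (linearIndependent_pair_of_map π a1) b1 c1
  obtain ⟨y, hy, v, hv, hyv⟩ := exists_meetsAt hker hJ (a := P (i 1)) (b := P (i 2)) (c := P (i 4))
    (e := P (i 5)) (linearIndependent_pair_of_map π a2) b2 c2
  obtain ⟨z, hz, w, hw, hzw⟩ := exists_meetsAt hker hJ (a := P (i 2)) (b := P (i 3)) (c := P (i 5))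
    (e := P (i 0)) (linearIndependent_pair_of_map π a3) b3 c3
  refine ⟨x, y, z, ⟨hx, hy, hz⟩, u, hu, v, hv, w, hw, ?_⟩
  rw [hxu, hyv, hzw]
  rfl

theorem PascalCondition.exists_conic (hP : PascalCondition P) {q : Fin (d + 4) → Fin 3 → ℂ}
    (hq : IsGaleDual (fun k => (P k).rep) q) :
    ∃ Q : QuadraticForm ℂ (Fin 3 → ℂ), Q ≠ 0 ∧ ∀ k, Q (q k) = 0 := by
  apply exists_conic_of_six
  intro I hI
  set i := I.orderEmbOfFin hI with hi
  suffices h : ∃ Q : QuadraticForm ℂ (Fin 3 → ℂ), Q ≠ 0 ∧ ∀ k, Q (q (i k)) = 0 by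
    obtain ⟨Q, hQ, h0⟩ := h
    refine ⟨Q, hQ, fun k hk => ?_⟩
    rw [← Finset.mem_coe, ← Finset.range_orderEmbOfFin I hI] at hk
    obtain ⟨l, rfl⟩ := hk
    exact h0 l
  -- Each degeneracy of the hexagon would itself put the six vectors on a conic; without such a
  -- conic, I imposes a genuine condition.
  by_contra hno
  have hJ := finrank_linSpan_complementPoints hq i (fun y h => by
    by_contra hy
    exact hno (exists_conic_of_coplanar hy 0 0 fun k _ _ => h k))
  obtain ⟨π, hker, hrange⟩ := exists_projection hJ
  have hpq := hq.projection i hker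
  obtain ⟨x, y, z, hxyz, u, hu, v, hv, w, hw, hbr⟩ := exists_isPascalTriple hker hJ hpq
    (fun a b y h => by
      by_contra hy
      exact hno (exists_conic_of_coplanar hy a b h))
    (fun a b hab => by
      by_contra hli
      exact hno (exists_conic_of_not_linearIndependent_pair hab hli))
  obtain ⟨φ, hφ, hφ0⟩ := hP i x y z hxyz
  -- The hyperplane contains the center P_J of π, so it is the preimage of a line in the plane.
  have hmem : φ ∈ LinearMap.range π.dualMap := by
    rw [LinearMap.range_dualMap_eq_dualAnnihilator_ker, Submodule.mem_dualAnnihilator]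
    intro v hv
    rw [hker] at hv
    have hle : linSpan (complementPoints P i) ≤ LinearMap.ker φ :=
      iSup₂_le fun p hp => hφ0 p (Or.inr hp)
    exact hle hv
  obtain ⟨χ, rfl⟩ := hmem
  have hχ : χ ≠ 0 := by
    rintro rfl
    exact hφ (map_zero _)
  refine hno (exists_conic_of_hexagon hpq ?_)
  rw [← hbr]
  exact bracket_eq_zero_of_dual hχ (hφ0 x (by simp) hu) (hφ0 y (by simp) hv) (hφ0 z (by simp) hw)

theorem span_rep_eq_top (hP : ¬ OnHyperplane (Set.range P)) :
    Submodule.span ℂ (Set.range fun k => (P k).rep) = ⊤ := by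
  rw [not_onHyperplane_iff, linSpan_eq_span_rep, ← Set.range_comp] at hP
  exact hP

end

/-! ### Points of rational normal curves -/

theorem veroneseVector_zero (s t : ℂ) : veroneseVector 0 s t = fun _ => 1 := by
  ext k
  simp [veroneseVector]

theorem veroneseVector_castSucc (n : ℕ) (s t : ℂ) :
    (fun k : Fin (n + 1) => veroneseVector (n + 1) s t k.castSucc) = s • veroneseVector n s t := by
  ext k
  have h : n + 1 - (k : ℕ) = (n - k) + 1 := by omega
  simp only [veroneseVector, Fin.val_castSucc, Pi.smul_apply, smul_eq_mul, h]
  ring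

theorem veroneseVector_succ (n : ℕ) (s t : ℂ) :
    (fun k : Fin (n + 1) => veroneseVector (n + 1) s t k.succ) = t • veroneseVector n s t := by
  ext k
  have h : n + 1 - ((k : ℕ) + 1) = n - k := by omega
  simp only [veroneseVector, Fin.val_succ, Pi.smul_apply, smul_eq_mul, h]
  ring

theorem veroneseVector_smul (n : ℕ) (a s t : ℂ) :
    veroneseVector n (a * s) (a * t) = a ^ n • veroneseVector n s t := by
  ext k
  have h : n = (n - k) + (k : ℕ) := by omega
  simp only [veroneseVector, Pi.smul_apply, smul_eq_mul, mul_pow]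
  have h2 : a ^ n = a ^ (n - (k : ℕ)) * a ^ (k : ℕ) := by rw [← pow_add, ← h]
  rw [h2]
  ring

/-- Multiplication of binary forms of degree `n`, considered as linear functions of the Veronese
vector, by linear forms. -/
theorem exists_dual_mul_linear {n : ℕ} (y : Module.Dual ℂ (Fin (n + 1) → ℂ)) (a b : ℂ) :
    ∃ z : Module.Dual ℂ (Fin (n + 2) → ℂ), ∀ s t,
      z (veroneseVector (n + 1) s t) = (a * s + b * t) * y (veroneseVector n s t) := by
  refine ⟨a • y ∘ₗ LinearMap.funLeft ℂ ℂ Fin.castSucc + b • y ∘ₗ LinearMap.funLeft ℂ ℂ Fin.succ,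
    fun s t => ?_⟩
  have h1 : LinearMap.funLeft ℂ ℂ Fin.castSucc (veroneseVector (n + 1) s t) =
      s • veroneseVector n s t := veroneseVector_castSucc n s t
  have h2 : LinearMap.funLeft ℂ ℂ Fin.succ (veroneseVector (n + 1) s t) =
      t • veroneseVector n s t := veroneseVector_succ n s t
  simp only [LinearMap.add_apply, LinearMap.smul_apply, LinearMap.comp_apply, h1, h2, map_smul,
    smul_eq_mul]
  ring

/-- The binary form is the product of the linear forms vanishing at the [s i : t i], filled up to
degree n with linear forms not vanishing at [a : b]. -/
theorem exists_dual_separating {ι : Type*} (s t : ι → ℂ) {a b : ℂ} (hab : (a, b) ≠ (0, 0))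
    (n : ℕ) (S : Finset ι) (hS : S.card ≤ n) (h : ∀ i ∈ S, a * t i ≠ b * s i) :
    ∃ y : Module.Dual ℂ (Fin (n + 1) → ℂ), (∀ i ∈ S, y (veroneseVector n (s i) (t i)) = 0) ∧
      y (veroneseVector n a b) ≠ 0 := by
  classical
  induction n generalizing S with
  | zero =>
    rw [Nat.le_zero, Finset.card_eq_zero] at hS
    subst hS
    refine ⟨LinearMap.proj 0, by simp, ?_⟩
    rw [veroneseVector_zero]
    simp
  | succ n ih =>
    rcases S.eq_empty_or_nonempty with rfl | ⟨i, hi⟩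
    · obtain ⟨y, -, hy⟩ := ih ∅ (by simp) (by simp)
      obtain ⟨u, v, huv⟩ : ∃ u v : ℂ, u * a + v * b ≠ 0 := by
        by_cases ha : a = 0
        · refine ⟨0, 1, fun hb => hab ?_⟩
          rw [ha]
          simpa using hb
        · exact ⟨1, 0, by simpa using ha⟩
      obtain ⟨z, hz⟩ := exists_dual_mul_linear y u v
      refine ⟨z, by simp, ?_⟩
      rw [hz]
      exact mul_ne_zero huv hy
    · obtain ⟨y, hy0, hy⟩ := ih (S.erase i) (by rw [Finset.card_erase_of_mem hi]; omega)
        fun j hj => h j (Finset.mem_of_mem_erase hj)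
      obtain ⟨z, hz⟩ := exists_dual_mul_linear y (t i) (-s i)
      refine ⟨z, fun j hj => ?_, ?_⟩
      · rw [hz]
        by_cases hji : j = i
        · subst hji
          ring
        · rw [hy0 j (Finset.mem_erase.2 ⟨hji, hj⟩), mul_zero]
      · rw [hz]
        refine mul_ne_zero (fun h0 => h i hi ?_) hy
        linear_combination h0

section Family

variable {ι : Type*} {s t : ι → ℂ} (hst : ∀ i j, i ≠ j → s i * t j ≠ t i * s j)
  (h0 : ∀ i, (s i, t i) ≠ (0, 0))

include hst h0

theorem exists_dual_separating_family [Fintype ι] [DecidableEq ι] {n : ℕ}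
    (hn : Fintype.card ι ≤ n + 1) (i : ι) :
    ∃ y : Module.Dual ℂ (Fin (n + 1) → ℂ), (∀ j, j ≠ i → y (veroneseVector n (s j) (t j)) = 0) ∧
      y (veroneseVector n (s i) (t i)) = 1 := by
  obtain ⟨y, hy, hne⟩ := exists_dual_separating s t (h0 i) n (Finset.univ.erase i)
    (by rw [Finset.card_erase_of_mem (Finset.mem_univ _), Finset.card_univ]; omega)
    (fun j hj => hst i j (Finset.ne_of_mem_erase hj).symm)
  refine ⟨(y (veroneseVector n (s i) (t i)))⁻¹ • y, fun j hj => ?_, ?_⟩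
  · rw [LinearMap.smul_apply, hy j (Finset.mem_erase.2 ⟨hj, Finset.mem_univ _⟩), smul_zero]
  · rw [LinearMap.smul_apply, smul_eq_mul, inv_mul_cancel₀ hne]

theorem linearIndependent_veroneseVector [Fintype ι] {n : ℕ} (hn : Fintype.card ι ≤ n + 1) :
    LinearIndependent ℂ fun i => veroneseVector n (s i) (t i) := by
  classical
  rw [Fintype.linearIndependent_iff]
  intro c hc i
  obtain ⟨y, hy, h1⟩ := exists_dual_separating_family hst h0 hn i
  have h2 := congrArg y hc
  rw [map_sum, map_zero, Finset.sum_eq_single i (fun j _ hj => by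
    rw [map_smul, hy j hj, smul_zero]) (by simp), map_smul, h1, smul_eq_mul, mul_one] at h2
  exact h2

theorem span_veroneseVector [Fintype ι] {n : ℕ} (hn : n + 1 ≤ Fintype.card ι) :
    Submodule.span ℂ (Set.range fun i => veroneseVector n (s i) (t i)) = ⊤ := by
  obtain ⟨S, -, hS⟩ := Finset.exists_subset_card_eq (s := (Finset.univ : Finset ι)) hn
  have hli := linearIndependent_veroneseVector (ι := S) (s := fun i => s i) (t := fun i => t i)
    (n := n) (fun i j hij => hst i j fun h => hij (Subtype.ext h)) (fun i => h0 i)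
    (by rw [Fintype.card_coe, hS])
  have h1 := hli.span_eq_top_of_card_eq_finrank' (by
    rw [Fintype.card_coe, hS, Module.finrank_fin_fun])
  rw [eq_top_iff, ← h1]
  apply Submodule.span_mono
  rintro _ ⟨i, rfl⟩
  exact ⟨i, rfl⟩

/-- There is a dependency for dimension reasons. A zero coefficient would leave a nontrivial
dependency of at most n + 1 of the vectors, which are independent. -/
theorem exists_dependency_veroneseVector [Fintype ι] {n : ℕ} (hn : Fintype.card ι = n + 2) :
    ∃ c : ι → ℂ, (∀ i, c i ≠ 0) ∧ ∑ i, c i • veroneseVector n (s i) (t i) = 0 := by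
  classical
  have hdep : ¬ LinearIndependent ℂ fun i => veroneseVector n (s i) (t i) := by
    intro h
    have := h.fintype_card_le_finrank
    rw [Module.finrank_fin_fun] at this
    omega
  rw [Fintype.not_linearIndependent_iff] at hdep
  obtain ⟨c, hc, k, hk⟩ := hdep
  refine ⟨c, fun i hi => hk ?_, hc⟩
  have hki : k ≠ i := by
    rintro rfl
    exact hk hi
  obtain ⟨y, hy, hne⟩ := exists_dual_separating s t (h0 k) n ((Finset.univ.erase i).erase k)
    (by
      rw [Finset.card_erase_of_mem (Finset.mem_erase.2 ⟨hki, Finset.mem_univ _⟩),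
        Finset.card_erase_of_mem (Finset.mem_univ _), Finset.card_univ]
      omega)
    (fun j hj => hst k j (Finset.ne_of_mem_erase hj).symm)
  have h2 := congrArg y hc
  rw [map_sum, map_zero, Finset.sum_eq_single k (fun j _ hj => by
    by_cases hji : j = i
    · rw [hji, hi, zero_smul, map_zero]
    · rw [map_smul, hy j (by simp [hj, hji]), smul_zero]) (by simp), map_smul, smul_eq_mul] at h2
  exact (mul_eq_zero.1 h2).resolve_right hne

end Family

theorem span_range_veroneseVector (n : ℕ) :
    Submodule.span ℂ (Set.range fun x : ℂ => veroneseVector n 1 x) = ⊤ := by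
  have h := span_veroneseVector (ι := Fin (n + 1)) (s := fun _ => 1) (t := fun i => ((i : ℕ) : ℂ))
    (n := n) (fun i j hij => by
      rw [one_mul, mul_one]
      exact fun h => hij (Fin.ext (Nat.cast_injective h)).symm) (by simp) (by simp)
  rw [eq_top_iff, ← h]
  apply Submodule.span_mono
  rintro _ ⟨i, rfl⟩
  exact ⟨_, rfl⟩

/-! ### Rational normal curves in their linear spans -/

section NormalCurve

variable {d n : ℕ}

/-- The image of `[s : t] ↦ g [s^n : s^(n-1) t : ⋯ : t^n]`. -/
def normalCurve (g : (Fin (n + 1) → ℂ) →ₗ[ℂ] (Fin (d + 1) → ℂ)) : Set (ProjSpace d) :=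
  {p | ∃ s t : ℂ, (s, t) ≠ (0, 0) ∧ p.submodule = ℂ ∙ g (veroneseVector n s t)}

theorem veroneseVector_ne_zero {s t : ℂ} (h : (s, t) ≠ (0, 0)) : veroneseVector n s t ≠ 0 := by
  obtain ⟨y, -, hy⟩ := exists_dual_separating (ι := Empty) Empty.elim Empty.elim h n ∅
    (by simp) (by simp)
  intro h0
  rw [h0, map_zero] at hy
  exact hy rfl

theorem mem_cone_of_submodule_eq {X : Set (ProjSpace d)} {v : Fin (d + 1) → ℂ} (hv : v ≠ 0)
    (h : Projectivization.mk ℂ v hv ∈ X) : v ∈ cone X :=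
  ⟨_, h, by rw [Projectivization.submodule_mk]; exact Submodule.mem_span_singleton_self v⟩

variable {g : (Fin (n + 1) → ℂ) →ₗ[ℂ] (Fin (d + 1) → ℂ)} (hg : Function.Injective g)

include hg in
theorem mem_cone_normalCurve {s t : ℂ} (h : (s, t) ≠ (0, 0)) :
    g (veroneseVector n s t) ∈ cone (normalCurve g) := by
  have h0 : g (veroneseVector n s t) ≠ 0 := by
    rw [Ne, map_eq_zero_iff g hg]
    exact veroneseVector_ne_zero h
  exact mem_cone_of_submodule_eq h0 ⟨s, t, h, Projectivization.submodule_mk _ _⟩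

include hg in
theorem linSpan_normalCurve : linSpan (normalCurve g) = LinearMap.range g := by
  apply le_antisymm
  · refine iSup₂_le fun p hp => ?_
    obtain ⟨s, t, -, h⟩ := hp
    rw [h, Submodule.span_singleton_le_iff_mem]
    exact LinearMap.mem_range_self _ _
  · rw [← Submodule.map_top, ← span_range_veroneseVector n, Submodule.map_span, Submodule.span_le,
      ← span_cone]
    rintro _ ⟨_, ⟨x, rfl⟩, rfl⟩
    exact Submodule.subset_span (mem_cone_normalCurve hg (by simp))

/-- The restriction of polynomials to the parametrized curve. -/
noncomputable def curvePullback (g : (Fin (n + 1) → ℂ) →ₗ[ℂ] (Fin (d + 1) → ℂ)) :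
    MvPolynomial (Fin (d + 1)) ℂ →ₐ[ℂ] MvPolynomial (Fin 2) ℂ :=
  aeval fun k => ∑ j : Fin (n + 1), C (g (Pi.single j 1) k) * (X 0 ^ (n - (j : ℕ)) * X 1 ^ (j : ℕ))

theorem eval_curvePullback (f : MvPolynomial (Fin (d + 1)) ℂ) (v : Fin 2 → ℂ) :
    eval v (curvePullback g f) = eval (g (veroneseVector n (v 0) (v 1))) f := by
  rw [curvePullback, aeval_def, eval_eval₂, eval, eval₂Hom]
  simp only [RingHom.coe_mk, MonoidHom.coe_mk, OneHom.coe_mk]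
  congr 1
  · ext; simp
  · funext k
    conv_rhs => rw [← LinearMap.sum_single_apply (fun _ : Fin (n + 1) => ℂ)
      (veroneseVector n (v 0) (v 1)), map_sum, Finset.sum_apply]
    rw [← coe_eval₂Hom, map_sum]
    refine Finset.sum_congr rfl fun j _ => ?_
    have : (Pi.single j (veroneseVector n (v 0) (v 1) j) : Fin (n + 1) → ℂ) =
        veroneseVector n (v 0) (v 1) j • Pi.single j 1 := by
      rw [← Pi.single_smul, smul_eq_mul, mul_one]
    rw [this, map_smul]
    simp [veroneseVector, mul_comm]

theorem isHomogeneous_curvePullback {f : MvPolynomial (Fin (d + 1)) ℂ} {m : ℕ}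
    (hf : f.IsHomogeneous m) : (curvePullback g f).IsHomogeneous (n * m) := by
  refine hf.aeval _ fun k => IsHomogeneous.sum _ _ _ fun j _ => ?_
  have h : n = 0 + ((n - (j : ℕ)) + j) := by omega
  have h2 := (isHomogeneous_C _ (g (Pi.single j 1) k)).mul
    (((isHomogeneous_X ℂ (0 : Fin 2)).pow (n - (j : ℕ))).mul
    ((isHomogeneous_X ℂ (1 : Fin 2)).pow (j : ℕ)))
  rw [one_mul, one_mul, ← h] at h2
  exact h2

include hg in
theorem mem_coneIdeal_normalCurve {f : MvPolynomial (Fin (d + 1)) ℂ} {m : ℕ}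
    (hf : f.IsHomogeneous m) : f ∈ coneIdeal (normalCurve g) ↔ curvePullback g f = 0 := by
  constructor
  · intro h
    -- The factor X 0 disposes of the vectors with first coordinate zero, among them the origin,
    -- which parametrizes no point.
    have h1 : X 0 * curvePullback g f = 0 := by
      refine MvPolynomial.funext fun v => ?_
      rw [map_mul, eval_X, eval_curvePullback, map_zero]
      by_cases hv : v 0 = 0
      · rw [hv, zero_mul]
      · rw [h _ (mem_cone_normalCurve hg (by simp [hv])), mul_zero]
    exact (mul_eq_zero.1 h1).resolve_left (X_ne_zero 0)
  · rintro h v ⟨p, ⟨s, t, -, hp⟩, hv⟩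
    rw [hp] at hv
    obtain ⟨a, rfl⟩ := Submodule.mem_span_singleton.1 hv
    have h1 := eval_curvePullback (g := g) f ![s, t]
    rw [h, map_zero] at h1
    rw [eval_smul_of_isHomogeneous hf]
    simp only [Matrix.cons_val_zero, Matrix.cons_val_one] at h1
    rw [← h1, mul_zero]

include hg in
-- A form vanishes on the curve exactly when its pullback is zero, and the pullback takes values in
-- a domain.
theorem isPrime_coneIdeal_normalCurve : (coneIdeal (normalCurve g)).IsPrime := by
  refine isPrime_of_homogeneous (fun f hf n => homogeneousComponent_mem_coneIdeal hf n) ?_ ?_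
  · intro h
    have h1 : (1 : MvPolynomial (Fin (d + 1)) ℂ) ∈ coneIdeal (normalCurve g) := by rw [h]; trivial
    rw [mem_coneIdeal_normalCurve hg (isHomogeneous_one _ _), map_one] at h1
    exact one_ne_zero h1
  · intro a b f f' hf hf' h
    rw [mem_coneIdeal_normalCurve hg (hf.mul hf'), map_mul] at h
    rw [mem_coneIdeal_normalCurve hg hf, mem_coneIdeal_normalCurve hg hf']
    exact mul_eq_zero.1 h

include hg in
-- Forms of degree m pull back to binary forms of degree n * m, a space of dimension n * m + 1.
theorem hilbertFunction_normalCurve_le (m : ℕ) : hilbertFunction (normalCurve g) m ≤ n * m + 1 := by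
  let φ : homogeneousSubmodule (Fin (d + 1)) ℂ m →ₗ[ℂ] homogeneousSubmodule (Fin 2) ℂ (n * m) :=
    ((curvePullback g).toLinearMap ∘ₗ Submodule.subtype _).codRestrict _
      fun f => isHomogeneous_curvePullback f.2
  have hker : LinearMap.ker φ = vanishingForms (normalCurve g) m := by
    ext f
    have h := mem_coneIdeal_normalCurve hg f.2
    rw [mem_coneIdeal_iff_rep f.2] at h
    refine Iff.trans ?_ h.symm
    rw [LinearMap.mem_ker, ← Subtype.coe_inj]
    rfl
  rw [hilbertFunction, ← hker, φ.quotKerEquivRange.finrank_eq]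
  refine (Submodule.finrank_le _).trans ?_
  rw [finrank_homogeneousSubmodule, Fintype.card_fin, Nat.multichoose_two]

end NormalCurve

/-- A connected set of points whose Hilbert function is that of a curve of minimal degree in its
linear span. -/
structure IsMinimalCurve {d : ℕ} (X : Set (ProjSpace d)) : Prop where
  isConnected : IsConnected X
  hilbertFunction_eq : ∀ m, hilbertFunction X m + m = Module.finrank ℂ (linSpan X) * m + 1

theorem isMinimalCurve_normalCurve {d n : ℕ} {g : (Fin (n + 1) → ℂ) →ₗ[ℂ] (Fin (d + 1) → ℂ)}
    (hg : Function.Injective g) : IsMinimalCurve (normalCurve g) := by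
  have hp := isPrime_coneIdeal_normalCurve hg
  refine ⟨(isIrreducible_of_isPrime hp).isConnected, fun m => ?_⟩
  have h1 := le_hilbertFunction_of_isPrime hp m
  have h2 := hilbertFunction_normalCurve_le hg m
  have h3 : Module.finrank ℂ (linSpan (normalCurve g)) = n + 1 := by
    rw [linSpan_normalCurve hg, LinearMap.finrank_range_of_inj hg, Module.finrank_fin_fun]
  rw [span_cone] at h1
  rw [h3] at h1 ⊢
  have h4 : (n + 1) * m = n * m + m := by ring
  omega

/-! ### Gluing curves of minimal degree at a point -/

section Glue

variable {d : ℕ}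

/-- A complement of L in W₂ meets W₁ trivially, so some projection onto W₁ kills it; W₂ is thereby
sent into L. -/
theorem exists_linearMap_of_inf_eq {W₁ W₂ L : Submodule ℂ (Fin (d + 1) → ℂ)} (h : W₁ ⊓ W₂ = L) :
    ∃ e : (Fin (d + 1) → ℂ) →ₗ[ℂ] (Fin (d + 1) → ℂ), (∀ v ∈ W₁, e v = v) ∧
      ∀ v ∈ W₂, e v ∈ L := by
  obtain ⟨C, hC⟩ := exists_isCompl L
  have hL1 : L ≤ W₁ := h ▸ inf_le_left
  have hL2 : L ≤ W₂ := h ▸ inf_le_right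
  have hsup : L ⊔ C ⊓ W₂ = W₂ := by
    rw [← sup_inf_assoc_of_le C hL2, hC.sup_eq_top, top_inf_eq]
  have hdisj : W₁ ⊓ (C ⊓ W₂) = ⊥ := by
    rw [inf_comm C, ← inf_assoc, h, hC.inf_eq_bot]
  obtain ⟨l, hl⟩ := LinearMap.exists_leftInverse_of_injective
    ((C ⊓ W₂).mkQ ∘ₗ W₁.subtype) (by
      rw [LinearMap.ker_eq_bot']
      intro w hw
      have hw' : (w : Fin (d + 1) → ℂ) ∈ W₁ ⊓ (C ⊓ W₂) :=
        ⟨w.2, (Submodule.Quotient.mk_eq_zero _).1 hw⟩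
      rw [hdisj, Submodule.mem_bot] at hw'
      exact Subtype.ext hw')
  refine ⟨W₁.subtype ∘ₗ l ∘ₗ (C ⊓ W₂).mkQ, ?_, ?_⟩
  · intro v hv
    exact congrArg Subtype.val (LinearMap.congr_fun hl ⟨v, hv⟩)
  · intro v hv
    rw [← hsup] at hv
    obtain ⟨u, hu, w, hw, rfl⟩ := Submodule.mem_sup.1 hv
    have h1 : (W₁.subtype ∘ₗ l ∘ₗ (C ⊓ W₂).mkQ) u = u :=
      congrArg Subtype.val (LinearMap.congr_fun hl ⟨u, hL1 hu⟩)
    have h2 : (W₁.subtype ∘ₗ l ∘ₗ (C ⊓ W₂).mkQ) w = 0 := by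
      simp only [LinearMap.comp_apply]
      rw [Submodule.mkQ_apply, (Submodule.Quotient.mk_eq_zero _).2 hw, map_zero, map_zero]
    rw [map_add, h1, h2, add_zero]
    exact hu

/-- A point is a normal curve of degree zero. -/
theorem normalCurve_point (p : ProjSpace d) :
    IsMinimalCurve {p} ∧ linSpan {p} = p.submodule := by
  have hg : Function.Injective ((LinearMap.proj 0).smulRight p.rep : (Fin 1 → ℂ) →ₗ[ℂ] _) := by
    rw [injective_iff_map_eq_zero]
    intro v hv
    ext i
    rw [Subsingleton.elim i 0]
    exact (smul_eq_zero.1 hv).resolve_right p.rep_nonzero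
  have h : {p} = normalCurve (n := 0)
      ((LinearMap.proj 0).smulRight p.rep : (Fin 1 → ℂ) →ₗ[ℂ] _) := by
    have h1 : ∀ s t, ((LinearMap.proj 0).smulRight p.rep : (Fin 1 → ℂ) →ₗ[ℂ] _)
        (veroneseVector 0 s t) = p.rep := by
      intro s t
      simp [veroneseVector]
    ext x
    constructor
    · rintro rfl
      refine ⟨1, 0, by simp, ?_⟩
      rw [h1, Projectivization.submodule_eq]
    · rintro ⟨s, t, -, hx⟩
      rw [h1, ← Projectivization.submodule_eq] at hx
      exact Projectivization.submodule_injective hx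
  refine ⟨?_, ?_⟩
  · rw [h]
    exact isMinimalCurve_normalCurve hg
  · simp [linSpan]

/-- In each degree the forms vanishing on X and those vanishing on Y add up to the forms vanishing
at p and intersect in those vanishing on X ∪ Y. So the Hilbert functions add up, less the 1 of the
common point, just as the dimensions of the spans do. -/
theorem IsMinimalCurve.union {X Y : Set (ProjSpace d)} (hX : IsMinimalCurve X)
    (hY : IsMinimalCurve Y) {p : ProjSpace d} (hpX : p ∈ X) (hpY : p ∈ Y)
    (h : linSpan X ⊓ linSpan Y = p.submodule) : IsMinimalCurve (X ∪ Y) := by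
  refine ⟨IsConnected.union ⟨p, hpX, hpY⟩ hX.1 hY.1, fun m => ?_⟩
  obtain ⟨e, he1, he2⟩ := exists_linearMap_of_inf_eq h
  set U : Set (ProjSpace d) → Submodule ℂ (MvPolynomial (Fin (d + 1)) ℂ) := fun Z =>
    (coneIdeal Z).restrictScalars ℂ ⊓ homogeneousSubmodule (Fin (d + 1)) ℂ m with hU
  have hfin : ∀ Z, FiniteDimensional ℂ (U Z) := fun Z =>
    Submodule.finiteDimensional_of_le (S₂ := homogeneousSubmodule (Fin (d + 1)) ℂ m) inf_le_right
  have hinf : U X ⊓ U Y = U (X ∪ Y) := by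
    ext f
    constructor
    · rintro ⟨⟨h1, h2⟩, h3, -⟩
      refine ⟨?_, h2⟩
      rintro v hv
      rw [cone_union] at hv
      exact hv.elim (h1 v) (h3 v)
    · rintro ⟨h1, h2⟩
      exact ⟨⟨coneIdeal_anti Set.subset_union_left h1, h2⟩,
        coneIdeal_anti Set.subset_union_right h1, h2⟩
  have hsup : U X ⊔ U Y = U {p} := by
    apply le_antisymm
    · refine sup_le ?_ ?_
      · rintro f ⟨h1, h2⟩
        exact ⟨coneIdeal_anti (Set.singleton_subset_iff.2 hpX) h1, h2⟩
      · rintro f ⟨h1, h2⟩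
        exact ⟨coneIdeal_anti (Set.singleton_subset_iff.2 hpY) h1, h2⟩
    · rintro f ⟨h1, h2⟩
      -- With e fixing the span of X and sending that of Y into the line of p, the form f ∘ e agrees
      -- with f on X and vanishes on Y; then f = (f - f ∘ e) + f ∘ e.
      obtain ⟨f', hf', hev⟩ := exists_form_comp e (m := m) h2
      rw [Submodule.mem_sup]
      refine ⟨f - f', ⟨fun v hv => ?_, Submodule.sub_mem _ h2 hf'⟩, f', ⟨fun v hv => ?_, hf'⟩,
        sub_add_cancel _ _⟩
      · rw [map_sub, hev, he1 v (by rw [← span_cone]; exact Submodule.subset_span hv), sub_self]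
      · rw [hev]
        exact h1 _ ⟨p, rfl, he2 v (by rw [← span_cone]; exact Submodule.subset_span hv)⟩
  have hdim := Submodule.finrank_sup_add_finrank_inf_eq (U X) (U Y)
  rw [hsup, hinf] at hdim
  have hspan := Submodule.finrank_sup_add_finrank_inf_eq (linSpan X) (linSpan Y)
  rw [h, Projectivization.finrank_submodule, ← linSpan_union] at hspan
  have e1 := finrank_vanishing_add_hilbertFunction X m
  have e2 := finrank_vanishing_add_hilbertFunction Y m
  have e3 := finrank_vanishing_add_hilbertFunction (X ∪ Y) m
  have e4 := finrank_vanishing_add_hilbertFunction {p} m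
  have f1 := hX.2 m
  have f2 := hY.2 m
  have f4 := (normalCurve_point p).1.2 m
  rw [(normalCurve_point p).2, Projectivization.finrank_submodule] at f4
  have f5 : Module.finrank ℂ (linSpan (X ∪ Y)) * m + m = Module.finrank ℂ (linSpan X) * m +
      Module.finrank ℂ (linSpan Y) * m := by
    rw [← add_mul, ← hspan]; ring
  change Module.finrank ℂ (U _) + _ = _ at e1 e2 e3 e4
  omega

theorem exists_line {u v : Fin (d + 1) → ℂ} (h : LinearIndependent ℂ ![u, v]) :
    ∃ X : Set (ProjSpace d), IsMinimalCurve X ∧ linSpan X = Submodule.span ℂ {u, v} ∧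
      ∀ a b : ℂ, a • u + b • v ∈ cone X := by
  set g := Fintype.linearCombination ℂ ![u, v] with hg
  have hinj : Function.Injective g := by
    rw [injective_iff_map_eq_zero]
    intro c hc
    exact funext (Fintype.linearIndependent_iff.1 h c hc)
  have hv : ∀ s t, g (veroneseVector 1 s t) = s • u + t • v := by
    intro s t
    rw [hg, Fintype.linearCombination_apply, Fin.sum_univ_two]
    simp [veroneseVector]
  refine ⟨normalCurve g, isMinimalCurve_normalCurve hinj, ?_, fun a b => ?_⟩
  · rw [linSpan_normalCurve hinj, hg, Fintype.range_linearCombination, Matrix.range_cons,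
      Matrix.range_cons, Matrix.range_empty, Set.union_empty, Set.singleton_union]
  · by_cases hab : (a, b) = (0, 0)
    · obtain ⟨rfl, rfl⟩ := Prod.mk_inj.1 hab
      have := cone_smul_mem (mem_cone_normalCurve hinj (s := 1) (t := 0) (by simp)) 0
      simpa using this
    · rw [← hv]
      exact mem_cone_normalCurve hinj hab

theorem exists_mem_of_mem_cone {X : Set (ProjSpace d)} {v : Fin (d + 1) → ℂ} (hv : v ∈ cone X)
    (h0 : v ≠ 0) : ∃ p ∈ X, p.submodule = ℂ ∙ v := by
  obtain ⟨p, hp, hvp⟩ := hv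
  refine ⟨p, hp, ?_⟩
  obtain ⟨a, rfl⟩ := (mem_submodule_iff p v).1 hvp
  have ha : a ≠ 0 := by
    rintro rfl
    exact h0 (zero_smul _ _)
  rw [Projectivization.submodule_eq, Submodule.span_singleton_smul_eq ha.isUnit]

theorem IsMinimalCurve.union' {X Y : Set (ProjSpace d)} (hX : IsMinimalCurve X)
    (hY : IsMinimalCurve Y) {v : Fin (d + 1) → ℂ} (h0 : v ≠ 0) (hvX : v ∈ cone X)
    (hvY : v ∈ cone Y) (h : linSpan X ⊓ linSpan Y ≤ ℂ ∙ v) : IsMinimalCurve (X ∪ Y) := by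
  obtain ⟨p, hp, hpv⟩ := exists_mem_of_mem_cone hvX h0
  obtain ⟨p', hp', hpv'⟩ := exists_mem_of_mem_cone hvY h0
  obtain rfl : p = p' := Projectivization.submodule_injective (hpv.trans hpv'.symm)
  refine hX.union hY hp hp' (le_antisymm (h.trans hpv.ge) ?_)
  rw [hpv, Submodule.span_singleton_le_iff_mem, ← span_cone, ← span_cone]
  exact ⟨Submodule.subset_span hvX, Submodule.subset_span hvY⟩

/-- Adding a line through a point of a curve of minimal degree. -/
theorem IsMinimalCurve.exists_union_line {X : Set (ProjSpace d)} (hX : IsMinimalCurve X)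
    {u v : Fin (d + 1) → ℂ} (hu : u ∈ cone X) (hu0 : u ≠ 0) (hv : v ∉ linSpan X) :
    ∃ Y : Set (ProjSpace d), IsMinimalCurve Y ∧ linSpan Y = linSpan X ⊔ ℂ ∙ v ∧ X ⊆ Y ∧
      ∀ a b : ℂ, a • u + b • v ∈ cone Y := by
  have huX : u ∈ linSpan X := by rw [← span_cone]; exact Submodule.subset_span hu
  have huv : LinearIndependent ℂ ![u, v] := by
    rw [LinearIndependent.pair_iff]
    intro a b hab
    have hb : b = 0 := by
      by_contra hb
      apply hv
      rw [← Submodule.smul_mem_iff _ hb, eq_neg_of_add_eq_zero_right hab]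
      exact Submodule.neg_mem _ (Submodule.smul_mem _ _ huX)
    rw [hb, zero_smul, add_zero] at hab
    exact ⟨(smul_eq_zero.1 hab).resolve_right hu0, hb⟩
  obtain ⟨L, hL, hLs, hLc⟩ := exists_line huv
  refine ⟨X ∪ L, hX.union' hL hu0 hu (by simpa using hLc 1 0) ?_, ?_, Set.subset_union_left, ?_⟩
  · rintro w ⟨hwX, hwL⟩
    rw [SetLike.mem_coe, hLs, Submodule.mem_span_pair] at hwL
    obtain ⟨a, b, rfl⟩ := hwL
    have hb : b = 0 := by
      by_contra hb
      apply hv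
      rw [← Submodule.smul_mem_iff _ hb]
      have := Submodule.sub_mem _ hwX (Submodule.smul_mem _ a huX)
      rwa [add_sub_cancel_left] at this
    rw [hb, zero_smul, add_zero]
    exact Submodule.smul_mem _ _ (Submodule.mem_span_singleton_self u)
  · rw [linSpan_union, hLs, Submodule.span_insert, ← sup_assoc,
      sup_eq_left.2 ((Submodule.span_singleton_le_iff_mem _ _).2 huX)]
  · intro a b
    rw [cone_union]
    exact Or.inr (hLc a b)

/-- Taking the closure supplies closedness and affects neither connectedness nor the Hilbert
function. -/
theorem IsMinimalCurve.isQuasiVeronese_closure {X : Set (ProjSpace d)} (hX : IsMinimalCurve X)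
    (h : linSpan X = ⊤) : IsQuasiVeronese (closure X) := by
  refine ⟨isClosed_closure, hX.1.closure, ⟨1, Filter.Eventually.of_forall fun m => ?_⟩, ?_⟩
  · have h1 := hX.2 m
    rw [h, finrank_top, Module.finrank_fin_fun, ← hilbertFunction_congr (coneIdeal_closure X)] at h1
    have h2 : hilbertFunction (closure X) m = d * m + 1 := by
      have : (d + 1) * m = d * m + m := by ring
      omega
    rw [h2]
    push_cast
    ring
  · rw [not_onHyperplane_iff, eq_top_iff, ← h, ← span_cone, ← span_cone]
    apply Submodule.span_mono
    rintro v ⟨p, hp, hv⟩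
    exact ⟨p, subset_closure hp, hv⟩

end Glue

/-! ### Rational normal curves from Gale duality -/

theorem LinearMap.exists_injective_factor {A B V : Type*} [AddCommGroup A] [Module ℂ A]
    [AddCommGroup B] [Module ℂ B] [AddCommGroup V] [Module ℂ V] {f : A →ₗ[ℂ] B} {f' : A →ₗ[ℂ] V}
    (hf : Function.Surjective f) (h : LinearMap.ker f = LinearMap.ker f') :
    ∃ g : B →ₗ[ℂ] V, Function.Injective g ∧ ∀ a, f' a = g (f a) := by
  obtain ⟨r, hr⟩ := f.exists_rightInverse_of_surjective (LinearMap.range_eq_top.2 hf)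
  have hr' : ∀ b, f (r b) = b := fun b => LinearMap.congr_fun hr b
  refine ⟨f' ∘ₗ r, ?_, fun a => ?_⟩
  · rw [injective_iff_map_eq_zero]
    intro b hb
    have : r b ∈ LinearMap.ker f' := hb
    rw [← h, LinearMap.mem_ker, hr'] at this
    exact this
  · have : a - r (f a) ∈ LinearMap.ker f := by
      rw [LinearMap.mem_ker, map_sub, hr', sub_self]
    rw [h, LinearMap.mem_ker, map_sub, sub_eq_zero] at this
    exact this

section GaleNormal

variable {ι V : Type*} [Fintype ι] [AddCommGroup V] [Module ℂ V] {p : ι → V} {s t : ι → ℂ}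
  (hst : ∀ i j, i ≠ j → s i * t j ≠ t i * s j) (h0 : ∀ i, (s i, t i) ≠ (0, 0))

include hst h0

/-- With at most e + 1 vectors, a binary form of degree e could vanish at all parameters but one,
and the resulting relation would make p i zero. -/
theorem IsGaleDual.card_lt_of_veroneseVector {e : ℕ} [Nonempty ι]
    (h : IsGaleDual p fun i => veroneseVector e (s i) (t i)) (hp : ∀ i, p i ≠ 0) :
    e + 2 ≤ Fintype.card ι := by
  classical
  by_contra hcon
  obtain ⟨i⟩ := ‹Nonempty ι›
  obtain ⟨y, hy, h1⟩ := exists_dual_separating_family hst h0 (n := e) (by omega) i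
  have h2 := (h fun j => y (veroneseVector e (s j) (t j))).2 ⟨y, fun _ => rfl⟩
  rw [Finset.sum_eq_single i (fun j _ hj => by rw [hy j hj, zero_smul]) (by simp), h1,
    one_smul] at h2
  exact hp i h2

/-- Vectors whose linear relations are given by the binary forms of some degree lie on a rational
normal curve in their linear span. -/
theorem IsGaleDual.exists_normalCurve {e n : ℕ}
    (h : IsGaleDual p fun i => veroneseVector e (s i) (t i)) (hN : Fintype.card ι = n + e + 2) :
    ∃ (g : (Fin (n + 1) → ℂ) →ₗ[ℂ] V) (b : ι → ℂ), Function.Injective g ∧ (∀ i, b i ≠ 0) ∧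
      (∀ i, p i = b i • g (veroneseVector n (s i) (t i))) ∧
      LinearMap.range g = Submodule.span ℂ (Set.range p) := by
  classical
  obtain ⟨b, hb, hdep⟩ := exists_dependency_veroneseVector hst h0 (n := n + e) hN
  -- Monomials of degrees e and n multiply to monomials of degree n + e. So multiplying the
  -- coefficients by a binary form of degree e turns the dependency in degree n + e into one in
  -- degree n.
  have hdep' : ∀ y : Module.Dual ℂ (Fin (e + 1) → ℂ),
      ∑ i, (y (veroneseVector e (s i) (t i)) * b i) • veroneseVector n (s i) (t i) = 0 := by
    intro y
    ext k
    have hy : ∀ v, y v = ∑ l, v l * y (Pi.single l 1) := by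
      intro v
      conv_lhs => rw [← LinearMap.sum_single_apply (fun _ : Fin (e + 1) => ℂ) v, map_sum]
      refine Finset.sum_congr rfl fun l _ => ?_
      have : (Pi.single l (v l) : Fin (e + 1) → ℂ) = v l • Pi.single l 1 := by
        rw [← Pi.single_smul, smul_eq_mul, mul_one]
      rw [this, map_smul, smul_eq_mul]
    have hmul : ∀ i (l : Fin (e + 1)), veroneseVector e (s i) (t i) l *
        veroneseVector n (s i) (t i) k = veroneseVector (n + e) (s i) (t i) ⟨k + l, by omega⟩ := by
      intro i l
      have h1 : n + e - ((k : ℕ) + l) = (e - l) + (n - k) := by omega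
      simp only [veroneseVector, h1, pow_add]
      ring
    have hcoord : ∀ l : Fin (e + 1),
        ∑ i, b i * veroneseVector (n + e) (s i) (t i) ⟨k + l, by omega⟩ = 0 := by
      intro l
      have := congrFun hdep ⟨k + l, by omega⟩
      rwa [Finset.sum_apply] at this
    rw [Finset.sum_apply, Pi.zero_apply]
    calc ∑ i, ((y (veroneseVector e (s i) (t i)) * b i) • veroneseVector n (s i) (t i)) k
        = ∑ i, ∑ l, y (Pi.single l 1) *
            (b i * veroneseVector (n + e) (s i) (t i) ⟨k + l, by omega⟩) := by
          refine Finset.sum_congr rfl fun i _ => ?_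
          rw [Pi.smul_apply, smul_eq_mul, hy, Finset.sum_mul, Finset.sum_mul]
          refine Finset.sum_congr rfl fun l _ => ?_
          rw [← hmul]
          ring
      _ = 0 := by
          rw [Finset.sum_comm]
          refine Finset.sum_eq_zero fun l _ => ?_
          rw [← Finset.mul_sum, hcoord, mul_zero]
  set f := Fintype.linearCombination ℂ fun i => b i • veroneseVector n (s i) (t i) with hf
  set f' := Fintype.linearCombination ℂ p with hf'
  have hsurj : Function.Surjective f := by
    rw [← LinearMap.range_eq_top, hf, Fintype.range_linearCombination, eq_top_iff,
      ← span_veroneseVector hst h0 (n := n) (by omega), Submodule.span_le]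
    rintro _ ⟨i, rfl⟩
    rw [SetLike.mem_coe, ← Submodule.smul_mem_iff _ (hb i)]
    exact Submodule.subset_span ⟨i, rfl⟩
  let φ : Module.Dual ℂ (Fin (e + 1) → ℂ) →ₗ[ℂ] (ι → ℂ) :=
    LinearMap.pi fun i => LinearMap.applyₗ (veroneseVector e (s i) (t i))
  have hφ : ∀ y i, φ y i = y (veroneseVector e (s i) (t i)) := fun _ _ => rfl
  have hφinj : Function.Injective φ := by
    rw [injective_iff_map_eq_zero]
    intro y hy
    have hle : Submodule.span ℂ (Set.range fun i => veroneseVector e (s i) (t i)) ≤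
        LinearMap.ker y := by
      rw [Submodule.span_le]
      rintro _ ⟨i, rfl⟩
      exact congrFun hy i
    rw [span_veroneseVector hst h0 (by omega), top_le_iff] at hle
    exact LinearMap.ker_eq_top.1 hle
  have hker' : LinearMap.ker f' = LinearMap.range φ := by
    ext c
    rw [LinearMap.mem_ker, hf', Fintype.linearCombination_apply, h c, LinearMap.mem_range]
    refine exists_congr fun y => ⟨fun hy => funext fun i => (hy i).symm, fun hy i => ?_⟩
    rw [← hy]
    rfl
  have hle : LinearMap.range φ ≤ LinearMap.ker f := by
    rintro _ ⟨y, rfl⟩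
    rw [LinearMap.mem_ker, hf, Fintype.linearCombination_apply, ← hdep' y]
    simp only [hφ, smul_smul]
  -- The relations of p, given by binary forms of degree e, are relations of the scaled Veronese
  -- vectors; both spaces of relations have dimension e + 1.
  have hker : LinearMap.ker f = LinearMap.ker f' := by
    rw [hker']
    refine (Submodule.eq_of_le_of_finrank_eq hle ?_).symm
    have h1 := f.finrank_range_add_finrank_ker
    rw [LinearMap.range_eq_top.2 hsurj, finrank_top, Module.finrank_fin_fun,
      Module.finrank_fintype_fun_eq_card, hN] at h1
    rw [LinearMap.finrank_range_of_inj hφinj, Subspace.dual_finrank_eq, Module.finrank_fin_fun]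
    omega
  obtain ⟨g, hg, hgf⟩ := LinearMap.exists_injective_factor hsurj hker
  refine ⟨g, b, hg, hb, fun i => ?_, ?_⟩
  · have := hgf (Pi.single i 1)
    rw [hf', hf, Fintype.linearCombination_apply_single, Fintype.linearCombination_apply_single,
      one_smul, one_smul, map_smul] at this
    exact this
  · have hcomp : f' = g ∘ₗ f := LinearMap.ext hgf
    rw [← Fintype.range_linearCombination ℂ, ← hf', hcomp, LinearMap.range_comp,
      LinearMap.range_eq_top.2 hsurj, Submodule.map_top]

end GaleNormal

/-! ### Plane conics -/

theorem exists_weightedSumSquares {V : Type*} [AddCommGroup V] [Module ℂ V] [FiniteDimensional ℂ V]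
    {k : ℕ} (hk : Module.finrank ℂ V = k) (Q : QuadraticForm ℂ V) :
    ∃ w : Fin k → ℂ, Q.Equivalent (QuadraticMap.weightedSumSquares ℂ w) := by
  subst hk
  exact QuadraticForm.equivalent_weightedSumSquares Q

theorem exists_linear_factors {V : Type*} [AddCommGroup V] [Module ℂ V] {Q : QuadraticForm ℂ V}
    (hQ : Q ≠ 0) (ψ χ : Module.Dual ℂ V) (h : ∀ v, Q v = ψ v ^ 2 + χ v ^ 2) :
    ∃ ℓ₁ ℓ₂ : Module.Dual ℂ V, ℓ₁ ≠ 0 ∧ ℓ₂ ≠ 0 ∧ ∀ v, Q v = ℓ₁ v * ℓ₂ v := by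
  have hprod : ∀ v, Q v = (ψ + Complex.I • χ) v * (ψ - Complex.I • χ) v := by
    intro v
    rw [h]
    simp only [LinearMap.add_apply, LinearMap.sub_apply, LinearMap.smul_apply, smul_eq_mul]
    linear_combination (χ v ^ 2) * Complex.I_sq
  refine ⟨_, _, fun h0 => hQ ?_, fun h0 => hQ ?_, hprod⟩
  · ext v
    rw [hprod, h0, LinearMap.zero_apply, zero_mul]
    rfl
  · ext v
    rw [hprod, h0, LinearMap.zero_apply, mul_zero]
    rfl

/-- The product (a + ib)(a - ib) = -c² is the square of ic, so after adjusting the sign of one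
square root s t = ic. -/
theorem exists_veronese_of_sum_squares {a b c : ℂ} (h : a ^ 2 + b ^ 2 + c ^ 2 = 0) :
    ∃ s t : ℂ, s ^ 2 = a + Complex.I * b ∧ t ^ 2 = a - Complex.I * b ∧ s * t = Complex.I * c := by
  obtain ⟨s, hs⟩ := IsAlgClosed.exists_pow_nat_eq (a + Complex.I * b) (n := 2) (by norm_num)
  obtain ⟨t, ht⟩ := IsAlgClosed.exists_pow_nat_eq (a - Complex.I * b) (n := 2) (by norm_num)
  have h1 : (s * t - Complex.I * c) * (s * t + Complex.I * c) = 0 := by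
    have : (s * t - Complex.I * c) * (s * t + Complex.I * c) =
        s ^ 2 * t ^ 2 - Complex.I ^ 2 * c ^ 2 := by ring
    rw [this, hs, ht]
    linear_combination h + (-b ^ 2 - c ^ 2) * Complex.I_sq
  rcases mul_eq_zero.1 h1 with h2 | h2
  · exact ⟨s, t, hs, ht, sub_eq_zero.1 h2⟩
  · exact ⟨s, -t, hs, by rw [neg_sq, ht], by linear_combination -h2⟩

/-- A plane conic is a pair of lines or parametrized by binary quadratic forms. -/
theorem conic_cases {Q : QuadraticForm ℂ (Fin 3 → ℂ)} (hQ : Q ≠ 0) :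
    (∃ ℓ₁ ℓ₂ : Module.Dual ℂ (Fin 3 → ℂ), ℓ₁ ≠ 0 ∧ ℓ₂ ≠ 0 ∧ ∀ v, Q v = ℓ₁ v * ℓ₂ v) ∨
      ∃ f : (Fin 3 → ℂ) →ₗ[ℂ] (Fin 3 → ℂ), Function.Injective f ∧
        ∀ v, Q v = 0 → ∃ s t, v = f (veroneseVector 2 s t) := by
  obtain ⟨w, ⟨e⟩⟩ := exists_weightedSumSquares (k := 3) (by simp) Q
  have hsq : ∀ i, ∃ a, a ^ 2 = w i := fun i => IsAlgClosed.exists_pow_nat_eq (w i) (by norm_num)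
  choose a ha using hsq
  let u : Fin 3 → Module.Dual ℂ (Fin 3 → ℂ) := fun i =>
    a i • ((LinearMap.proj i : (Fin 3 → ℂ) →ₗ[ℂ] ℂ) ∘ₗ e.toLinearEquiv.toLinearMap)
  have hu : ∀ i v, u i v = a i * e v i := fun _ _ => rfl
  have hQu : ∀ v, Q v = u 0 v ^ 2 + u 1 v ^ 2 + u 2 v ^ 2 := by
    intro v
    rw [← e.map_app, QuadraticMap.weightedSumSquares_apply, Fin.sum_univ_three]
    simp only [hu, ← ha, smul_eq_mul]
    ring
  have hz : ∀ i, a i = 0 → ∀ v, u i v = 0 := fun i hi v => by rw [hu, hi, zero_mul]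
  -- If a coefficient is zero, the conic is a sum of two squares and splits into linear factors over
  -- ℂ.
  by_cases h0 : a 0 = 0
  · exact Or.inl (exists_linear_factors hQ (u 1) (u 2) fun v => by rw [hQu, hz 0 h0]; ring)
  by_cases h1 : a 1 = 0
  · exact Or.inl (exists_linear_factors hQ (u 0) (u 2) fun v => by rw [hQu, hz 1 h1]; ring)
  by_cases h2 : a 2 = 0
  · exact Or.inl (exists_linear_factors hQ (u 0) (u 1) fun v => by rw [hQu, hz 2 h2]; ring)
  right
  let ξ : Fin 3 → Module.Dual ℂ (Fin 3 → ℂ) := fun i => LinearMap.proj i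
  -- M solves s² = u 0 + i u 1, t² = u 0 - i u 1, s t = i u 2 for the diagonalizing coordinates,
  -- from x = (s², s t, t²).
  let M : (Fin 3 → ℂ) →ₗ[ℂ] (Fin 3 → ℂ) := LinearMap.pi
    ![(2 * a 0)⁻¹ • (ξ 0 + ξ 2), (2 * Complex.I * a 1)⁻¹ • (ξ 0 - ξ 2), (Complex.I * a 2)⁻¹ • ξ 1]
  have hM0 : ∀ x, M x 0 = (2 * a 0)⁻¹ * (x 0 + x 2) := fun _ => rfl
  have hM1 : ∀ x, M x 1 = (2 * Complex.I * a 1)⁻¹ * (x 0 - x 2) := fun _ => rfl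
  have hM2 : ∀ x, M x 2 = (Complex.I * a 2)⁻¹ * x 1 := fun _ => rfl
  have hI := Complex.I_ne_zero
  have hMinj : Function.Injective M := by
    rw [injective_iff_map_eq_zero]
    intro x hx
    have e0 := hM0 x
    have e1 := hM1 x
    have e2 := hM2 x
    rw [hx, Pi.zero_apply, eq_comm, mul_eq_zero] at e0 e1 e2
    have f0 := e0.resolve_left (by simp [h0])
    have f1 := e1.resolve_left (by simp [h1])
    have f2 := e2.resolve_left (by simp [h2])
    ext i
    fin_cases i
    · change x 0 = 0
      linear_combination (f0 + f1) / 2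
    · exact f2
    · change x 2 = 0
      linear_combination (f0 - f1) / 2
  refine ⟨e.toLinearEquiv.symm.toLinearMap ∘ₗ M,
    e.toLinearEquiv.symm.injective.comp hMinj, fun v hv => ?_⟩
  rw [hQu] at hv
  obtain ⟨s, t, hs, ht, hst⟩ := exists_veronese_of_sum_squares hv
  refine ⟨s, t, ?_⟩
  rw [LinearMap.comp_apply, LinearEquiv.coe_coe, LinearEquiv.eq_symm_apply]
  have v0 : veroneseVector 2 s t 0 = s ^ 2 := by simp [veroneseVector]
  have v1 : veroneseVector 2 s t 1 = s * t := by simp [veroneseVector]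
  have v2 : veroneseVector 2 s t 2 = t ^ 2 := by simp [veroneseVector]
  rw [hu, hu] at hs ht
  rw [hu] at hst
  ext i
  fin_cases i
  · change e v 0 = M _ 0
    rw [hM0, v0, v2, hs, ht]
    field_simp
    ring
  · change e v 1 = M _ 1
    rw [hM1, v0, v2, hs, ht]
    field_simp
    ring
  · change e v 2 = M _ 2
    rw [hM2, v1, hst]
    field_simp

/-! ### Vectors on a connected curve of minimal degree -/

/-- The points given by the nonzero vectors `p i` lie on a connected curve of minimal degree in
their linear span. -/
def OnMinimalCurve {d : ℕ} {ι : Type*} (p : ι → Fin (d + 1) → ℂ) : Prop :=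
  ∃ X : Set (ProjSpace d), IsMinimalCurve X ∧ linSpan X = Submodule.span ℂ (Set.range p) ∧
    ∀ i, p i ∈ cone X

theorem IsGaleDual.of_injective {ι V W W' : Type*} [Fintype ι] [AddCommGroup V] [Module ℂ V]
    [AddCommGroup W] [Module ℂ W] [AddCommGroup W'] [Module ℂ W'] {p : ι → V} {q : ι → W}
    {q' : ι → W'} (h : IsGaleDual p q) {f : W' →ₗ[ℂ] W} (hf : Function.Injective f)
    (hq : ∀ i, q i = f (q' i)) : IsGaleDual p q' := by
  intro c
  rw [h c]
  constructor
  · rintro ⟨y, hy⟩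
    exact ⟨y ∘ₗ f, fun i => by rw [hy, hq]; rfl⟩
  · rintro ⟨y, hy⟩
    obtain ⟨l, hl⟩ := f.exists_leftInverse_of_injective (LinearMap.ker_eq_bot.2 hf)
    refine ⟨y ∘ₗ l, fun i => ?_⟩
    rw [hy, hq, LinearMap.comp_apply, ← LinearMap.comp_apply l, hl]
    rfl

section

variable {d : ℕ} {ι : Type*} {p : ι → Fin (d + 1) → ℂ} {q : ι → Fin 3 → ℂ}

theorem onMinimalCurve_of_subsingleton [Subsingleton ι] [Nonempty ι] (hp : ∀ i, p i ≠ 0) :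
    OnMinimalCurve p := by
  obtain ⟨i⟩ := ‹Nonempty ι›
  obtain ⟨h1, h2⟩ := normalCurve_point (Projectivization.mk ℂ (p i) (hp i))
  have : Unique ι := ⟨⟨i⟩, fun j => Subsingleton.elim _ _⟩
  refine ⟨_, h1, ?_, fun j => ?_⟩
  · rw [h2, Projectivization.submodule_mk, Set.range_unique, Subsingleton.elim default i]
  · rw [Subsingleton.elim j i]
    exact mem_cone_of_submodule_eq (hp i) rfl

/-- Proportional parameters would give proportional vectors q, and zero parameters a zero vector
since e ≠ 0. -/
theorem pairwise_of_veroneseVector {e m : ℕ} (he : e ≠ 0) {q : ι → Fin m → ℂ}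
    {f : (Fin (e + 1) → ℂ) →ₗ[ℂ] (Fin m → ℂ)} {s t : ι → ℂ}
    (hq : ∀ i, q i = f (veroneseVector e (s i) (t i))) (h0 : ∀ i, q i ≠ 0)
    (hpar : ∀ i j, i ≠ j → ∀ a : ℂ, q i ≠ a • q j) :
    (∀ i j, i ≠ j → s i * t j ≠ t i * s j) ∧ ∀ i, (s i, t i) ≠ (0, 0) := by
  have h0' : ∀ i, (s i, t i) ≠ (0, 0) := by
    intro i hi
    obtain ⟨hs, ht⟩ := Prod.mk_inj.1 hi
    apply h0 i
    have := veroneseVector_smul e 0 0 0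
    rw [mul_zero, zero_pow he, zero_smul] at this
    rw [hq, hs, ht, this, map_zero]
  refine ⟨fun i j hij h => ?_, h0'⟩
  have hmul : ∃ a, s i = a * s j ∧ t i = a * t j := by
    by_cases hsj : s j = 0
    · have htj : t j ≠ 0 := fun htj => h0' j (by rw [hsj, htj])
      refine ⟨t i / t j, ?_, (div_mul_cancel₀ _ htj).symm⟩
      rw [hsj, mul_zero] at h ⊢
      exact (mul_eq_zero.1 h).resolve_right htj
    · refine ⟨s i / s j, (div_mul_cancel₀ _ hsj).symm, ?_⟩
      field_simp
      linear_combination -h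
  obtain ⟨a, hs, ht⟩ := hmul
  apply hpar i j hij (a ^ e)
  rw [hq, hq, hs, ht, veroneseVector_smul, map_smul]

/-- Duality exchanges degree e for the degree n such that n + e + 2 is the number of vectors. It
serves for e = 1, when q lies in a plane, and for e = 2. -/
theorem IsGaleDual.onMinimalCurve_of_veroneseVector [Fintype ι] [Nonempty ι] (h : IsGaleDual p q)
    (hp : ∀ i, p i ≠ 0) (h0 : ∀ i, q i ≠ 0) (hpar : ∀ i j, i ≠ j → ∀ a : ℂ, q i ≠ a • q j) {e : ℕ}
    (he : e ≠ 0) {f : (Fin (e + 1) → ℂ) →ₗ[ℂ] (Fin 3 → ℂ)} (hf : Function.Injective f)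
    (hq : ∀ i, ∃ s t, q i = f (veroneseVector e s t)) : OnMinimalCurve p := by
  choose s t hst using hq
  obtain ⟨h1, h2⟩ := pairwise_of_veroneseVector he hst h0 hpar
  have hG := h.of_injective hf hst
  obtain ⟨n, hn⟩ := Nat.exists_eq_add_of_le' (hG.card_lt_of_veroneseVector h1 h2 hp)
  obtain ⟨g, b, hg, -, hpg, hr⟩ := hG.exists_normalCurve h1 h2 (n := n) (by omega)
  refine ⟨normalCurve g, isMinimalCurve_normalCurve hg, ?_, fun i => ?_⟩
  · rw [linSpan_normalCurve hg, hr]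
  · rw [hpg]
    exact cone_smul_mem (mem_cone_normalCurve hg (h2 i)) _

end

/-! ### Proportional vectors in the Gale dual. -/

section Merge

variable {d : ℕ} {ι : Type*} [Fintype ι] [DecidableEq ι] {p : ι → Fin (d + 1) → ℂ}
  {q : ι → Fin 3 → ℂ} {i j : ι} {a : ℂ}

theorem sum_merge (c : {k // k ≠ i} → ℂ) (hij : j ≠ i) :
    ∑ k, c k • (p k + if (k : ι) = j then a • p i else 0) =
      ∑ k, (if h : k ≠ i then c ⟨k, h⟩ else a * c ⟨j, hij⟩) • p k := by
  rw [Fintype.sum_eq_add_sum_subtype_ne _ i, dif_neg (not_not.2 rfl)]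
  simp only [smul_add, Finset.sum_add_distrib, smul_ite, smul_zero]
  have h1 : ∑ k : {k // k ≠ i}, (if (k : ι) = j then c k • a • p i else 0) =
      c ⟨j, hij⟩ • a • p i := by
    rw [Finset.sum_eq_single ⟨j, hij⟩ (fun k _ hk => if_neg fun h => hk (Subtype.ext h)) (by simp),
      if_pos rfl]
  rw [h1, smul_smul, mul_comm]
  refine (add_comm _ _).trans ?_
  congr 1
  refine Finset.sum_congr rfl fun k _ => ?_
  rw [dif_pos k.2]

/-- Relations of the merged family are relations of p whose coefficient at i is a times the one at
j; every relation of p is of this kind because q i = a • q j. -/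
theorem IsGaleDual.merge (h : IsGaleDual p q) (hij : j ≠ i) (hq : q i = a • q j) :
    IsGaleDual (fun k : {k // k ≠ i} => p k + if (k : ι) = j then a • p i else 0)
      (fun k => q k) := by
  intro c
  rw [sum_merge c hij, h]
  refine exists_congr fun y => ⟨fun hy k => ?_, fun hy k => ?_⟩
  · rw [← hy, dif_pos k.2]
  · by_cases hk : k = i
    · subst hk
      rw [dif_neg (not_not.2 rfl), hy, hq, map_smul, smul_eq_mul]
    · rw [dif_pos hk, hy]

/-- The line through p i and p j meets the curve of the merged family in p j + a • p i; adding it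
recovers both points. -/
theorem IsGaleDual.onMinimalCurve_of_merge (h : IsGaleDual p q) (hij : j ≠ i) (hq : q i = a • q j)
    (hne : p j + a • p i ≠ 0)
    (hC : OnMinimalCurve fun k : {k // k ≠ i} => p k + if (k : ι) = j then a • p i else 0) :
    OnMinimalCurve p := by
  obtain ⟨X, hX, hspan, hmem⟩ := hC
  have hj : p j + a • p i ∈ cone X := by simpa using hmem ⟨j, hij⟩
  -- Otherwise p would have a relation whose coefficient at i is not a times the one at j.
  have hi : p i ∉ linSpan X := by
    rw [hspan, Submodule.mem_span_range_iff_exists_fun]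
    rintro ⟨c, hc⟩
    rw [sum_merge c hij] at hc
    obtain ⟨y, hy⟩ := (h (fun k => (if h : k ≠ i then c ⟨k, h⟩ else a * c ⟨j, hij⟩) -
      if k = i then 1 else 0)).1 (by
      simp only [sub_smul, Finset.sum_sub_distrib, hc, ite_smul, one_smul, zero_smul,
        Finset.sum_ite_eq', Finset.mem_univ, if_true, sub_self])
    have h1 := hy i
    have h2 := hy j
    simp only [ne_eq, not_true_eq_false, dite_false, if_true, hq, map_smul, smul_eq_mul] at h1
    rw [dif_pos hij, if_neg hij, sub_zero] at h2
    rw [← h2] at h1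
    exact one_ne_zero (sub_eq_self.1 h1)
  obtain ⟨Y, hY, hYspan, hXY, hline⟩ := hX.exists_union_line hj hne hi
  have hpi : p i ∈ cone Y := by simpa using hline 0 1
  have hpj : p j ∈ cone Y := by
    have := hline 1 (-a)
    rwa [one_smul, neg_smul, add_neg_cancel_right] at this
  have hall : ∀ k, p k ∈ cone Y := by
    intro k
    by_cases hki : k = i
    · exact hki ▸ hpi
    by_cases hkj : k = j
    · exact hkj ▸ hpj
    obtain ⟨x, hx, hxk⟩ := hmem ⟨k, hki⟩
    refine ⟨x, hXY hx, ?_⟩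
    simpa [hkj] using hxk
  refine ⟨Y, hY, le_antisymm ?_ ?_, hall⟩
  · rw [hYspan, hspan, sup_le_iff, Submodule.span_le, Submodule.span_singleton_le_iff_mem]
    refine ⟨?_, Submodule.subset_span ⟨i, rfl⟩⟩
    rintro _ ⟨k, rfl⟩
    refine Submodule.add_mem _ (Submodule.subset_span ⟨k, rfl⟩) ?_
    split_ifs
    · exact Submodule.smul_mem _ _ (Submodule.subset_span ⟨i, rfl⟩)
    · exact Submodule.zero_mem _
  · rw [Submodule.span_le, ← span_cone]
    rintro _ ⟨k, rfl⟩
    exact Submodule.subset_span (hall k)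

/-- The relation p j + a • p i = 0 is a form y vanishing on all q k except possibly q i and q j.
Without j, a dual is obtained by replacing q i with zero, and it lies in the plane y = 0. -/
theorem IsGaleDual.exists_drop (h : IsGaleDual p q) (hij : j ≠ i) (hq : q i = a • q j)
    (h0 : p j + a • p i = 0) :
    ∃ y : Module.Dual ℂ (Fin 3 → ℂ), y ≠ 0 ∧ (∀ k, k ≠ i → k ≠ j → y (q k) = 0) ∧
      IsGaleDual (fun k : {k // k ≠ j} => p k) (fun k => if (k : ι) = i then 0 else q k) := by
  obtain ⟨y, hy⟩ := (h (Pi.single j 1 + Pi.single i a)).1 (by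
    simp only [Pi.add_apply, add_smul, Finset.sum_add_distrib, Pi.single_apply, ite_smul, zero_smul,
      Finset.sum_ite_eq', Finset.mem_univ, if_true, one_smul]
    exact h0)
  have hyj : y (q j) = 1 := by
    rw [← hy, Pi.add_apply, Pi.single_eq_same, Pi.single_eq_of_ne hij, add_zero]
  have hyk : ∀ k, k ≠ i → k ≠ j → y (q k) = 0 := by
    intro k hki hkj
    rw [← hy, Pi.add_apply, Pi.single_eq_of_ne hkj, Pi.single_eq_of_ne hki, add_zero]
  refine ⟨y, fun hy0 => ?_, hyk, fun c => ?_⟩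
  · rw [hy0] at hyj
    exact zero_ne_one hyj
  have hsum : ∑ k, c k • p k = ∑ k, (if h : k ≠ j then c ⟨k, h⟩ else 0) • p k := by
    rw [Fintype.sum_eq_add_sum_subtype_ne _ j, dif_neg (not_not.2 rfl), zero_smul, zero_add]
    refine Finset.sum_congr rfl fun k _ => ?_
    rw [dif_pos k.2]
  rw [hsum, h]
  constructor
  · rintro ⟨z, hz⟩
    have hzj : z (q j) = 0 := by
      rw [← hz, dif_neg (not_not.2 rfl)]
    refine ⟨z, fun k => ?_⟩
    have hk := hz k
    rw [dif_pos k.2] at hk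
    change c k = _ at hk
    rw [hk]
    beta_reduce
    split_ifs with hki
    · rw [hki, hq, map_smul, hzj, smul_zero, map_zero]
    · rfl
  · rintro ⟨z, hz⟩
    -- The correction makes the form vanish at q j, and with it at q i = a • q j, and leaves the
    -- other values unchanged.
    refine ⟨z - z (q j) • y, fun k => ?_⟩
    rw [LinearMap.sub_apply, LinearMap.smul_apply, smul_eq_mul]
    by_cases hkj : k = j
    · rw [dif_neg (not_not.2 hkj), hkj, hyj, mul_one, sub_self]
    rw [dif_pos hkj, hz]
    beta_reduce
    split_ifs with hki
    · change k = i at hki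
      rw [hki, hq, map_smul, map_smul, hyj, map_zero, smul_eq_mul, smul_eq_mul]
      ring
    · change k ≠ i at hki
      rw [hyk k hki hkj, mul_zero, sub_zero]

end Merge

theorem onMinimalCurve_of_drop {d : ℕ} {ι : Type*} {p : ι → Fin (d + 1) → ℂ} {i j : ι} {a : ℂ}
    (hij : i ≠ j) (h0 : p j + a • p i = 0)
    (hC : OnMinimalCurve fun k : {k // k ≠ j} => p k) : OnMinimalCurve p := by
  obtain ⟨X, hX, hspan, hmem⟩ := hC
  have hj : p j = (-a) • p i := by
    rw [neg_smul]; exact eq_neg_of_add_eq_zero_left h0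
  have hall : ∀ k, p k ∈ cone X := by
    intro k
    by_cases hk : k = j
    · rw [hk, hj]
      exact cone_smul_mem (hmem ⟨i, hij⟩) _
    · exact hmem ⟨k, hk⟩
  refine ⟨X, hX, le_antisymm ?_ ?_, hall⟩
  · rw [hspan]
    apply Submodule.span_mono
    rintro _ ⟨k, rfl⟩
    exact ⟨k, rfl⟩
  · rw [Submodule.span_le, ← span_cone]
    rintro _ ⟨k, rfl⟩
    exact Submodule.subset_span (hall k)

/-! ### Gale duals on two planes. -/

section Split

variable {d : ℕ} {ι : Type*} [Fintype ι] {p : ι → Fin (d + 1) → ℂ} {q : ι → Fin 3 → ℂ}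

/-- If the Gale dual lies on two planes meeting in the line spanned by `v`, then this line gives a
point common to the linear spans of the two parts of the configuration. -/
theorem IsGaleDual.sum_plane (h : IsGaleDual p q) {A : ι → Prop} [DecidablePred A]
    {ℓ₁ ℓ₂ ℓ₃ : Module.Dual ℂ (Fin 3 → ℂ)} {v : Fin 3 → ℂ} (hA : ∀ i, A i → ℓ₁ (q i) = 0)
    (hB : ∀ i, ¬ A i → ℓ₂ (q i) = 0)
    (hv : ∀ y : Module.Dual ℂ (Fin 3 → ℂ), y v = 0 → ∃ a b : ℂ, y = a • ℓ₁ + b • ℓ₂)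
    (h3 : ℓ₃ v = 1) (y : Module.Dual ℂ (Fin 3 → ℂ)) :
    ∑ i : {i // A i}, y (q i) • p i = y v • ∑ i : {i // A i}, ℓ₃ (q i) • p i := by
  obtain ⟨a, b, hab⟩ := hv (y - y v • ℓ₃) (by simp [h3])
  have h2 : ∑ i : {i // A i}, ℓ₂ (q i) • p i = 0 := by
    have h0 := (h fun i => ℓ₂ (q i)).2 ⟨ℓ₂, fun _ => rfl⟩
    rw [← Fintype.sum_subtype_add_sum_subtype A] at h0
    have hB0 : ∑ i : {i // ¬ A i}, ℓ₂ (q i) • p i = 0 :=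
      Finset.sum_eq_zero fun i _ => by rw [hB i i.2, zero_smul]
    rwa [hB0, add_zero] at h0
  rw [← sub_eq_zero, Finset.smul_sum, ← Finset.sum_sub_distrib]
  have h4 : ∀ i : {i // A i}, y (q i) • p i - y v • ℓ₃ (q i) • p i = b • ℓ₂ (q i) • p i := by
    intro i
    have := LinearMap.congr_fun hab (q i)
    simp only [LinearMap.sub_apply, LinearMap.smul_apply, LinearMap.add_apply, hA i i.2,
      mul_zero, zero_add, smul_eq_mul] at this
    rw [smul_smul, ← sub_smul, this, mul_smul]
  rw [Finset.sum_congr rfl fun i _ => h4 i, ← Finset.smul_sum, h2, smul_zero]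

/-- Substituting for p₀ turns a relation of the enlarged family into a relation of p supported on A:
a form vanishing on the other q i and hence at v. Subtracting a multiple of ℓ₃ makes the value at -v
equal to the coefficient of p₀. -/
theorem IsGaleDual.split (h : IsGaleDual p q) {A : ι → Prop} [DecidablePred A]
    {ℓ₁ ℓ₂ ℓ₃ : Module.Dual ℂ (Fin 3 → ℂ)} {v : Fin 3 → ℂ} (hA : ∀ i, A i → ℓ₁ (q i) = 0)
    (hB : ∀ i, ¬ A i → ℓ₂ (q i) = 0)
    (hv : ∀ y : Module.Dual ℂ (Fin 3 → ℂ), y v = 0 → ∃ a b : ℂ, y = a • ℓ₁ + b • ℓ₂)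
    (h3 : ℓ₃ v = 1)
    (hvB : ∀ y : Module.Dual ℂ (Fin 3 → ℂ), (∀ i, ¬ A i → y (q i) = 0) → y v = 0)
    {p₀ : Fin (d + 1) → ℂ} (hp₀ : p₀ = ∑ i : {i // A i}, ℓ₃ (q i) • p i) :
    IsGaleDual (fun k : Option {i // A i} => k.elim p₀ fun i => p i)
      (fun k => k.elim (-v) fun i => q i) := by
  classical
  have hK := h.sum_plane hA hB hv h3
  rw [← hp₀] at hK
  intro c
  rw [Fintype.sum_option]
  simp only [Option.elim_none, Option.elim_some]
  constructor
  · intro hc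
    obtain ⟨y, hy⟩ := (h fun i => if hi : A i then c (some ⟨i, hi⟩) + c none * ℓ₃ (q i) else 0).1 (by
      rw [← Fintype.sum_subtype_add_sum_subtype A]
      have h1 : ∑ i : {i // ¬ A i},
          (if hi : A i then c (some ⟨i, hi⟩) + c none * ℓ₃ (q i) else 0) • p i = 0 :=
        Finset.sum_eq_zero fun i _ => by rw [dif_neg i.2, zero_smul]
      rw [h1, add_zero, ← hc, hp₀, Finset.smul_sum, ← Finset.sum_add_distrib]
      refine Finset.sum_congr rfl fun i _ => ?_
      rw [dif_pos i.2, add_smul, mul_smul]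
      exact add_comm _ _)
    have hyv : y v = 0 := hvB y fun i hi => by rw [← hy, dif_neg hi]
    refine ⟨y - c none • ℓ₃, fun k => ?_⟩
    rcases k with _ | i
    · simp [hyv, h3]
    · have := hy i
      rw [dif_pos i.2] at this
      simp only [Option.elim_some, LinearMap.sub_apply, LinearMap.smul_apply, smul_eq_mul, ← this]
      ring
  · rintro ⟨y, hy⟩
    have h1 := hy none
    have h2 : ∀ i, c (some i) = y (q i) := fun i => hy (some i)
    simp only [Option.elim_none, map_neg] at h1
    simp only [h2, hK, h1]
    module

/-- A vector common to the spans of both parts gives a relation of p, whose A-part is a multiple of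
p₀ by `IsGaleDual.sum_plane`. So the spans meet only in the line of p₀, and the two curves can be
glued there. -/
theorem IsGaleDual.onMinimalCurve_of_split (h : IsGaleDual p q) {A : ι → Prop} [DecidablePred A]
    {ℓ₁ ℓ₂ ℓ₃ : Module.Dual ℂ (Fin 3 → ℂ)} {v : Fin 3 → ℂ} (hA : ∀ i, A i → ℓ₁ (q i) = 0)
    (hB : ∀ i, ¬ A i → ℓ₂ (q i) = 0)
    (hv : ∀ y : Module.Dual ℂ (Fin 3 → ℂ), y v = 0 → ∃ a b : ℂ, y = a • ℓ₁ + b • ℓ₂)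
    (h3 : ℓ₃ v = 1) {p₀ : Fin (d + 1) → ℂ} (hp₀ : p₀ = ∑ i : {i // A i}, ℓ₃ (q i) • p i)
    (hne : p₀ ≠ 0)
    (hCA : OnMinimalCurve fun k : Option {i // A i} => k.elim p₀ fun i => p i)
    (hCB : OnMinimalCurve fun k : Option {i // ¬ A i} => k.elim (-p₀) fun i => p i) :
    OnMinimalCurve p := by
  classical
  have hK := h.sum_plane hA hB hv h3
  rw [← hp₀] at hK
  have hp₀B : -p₀ = ∑ i : {i // ¬ A i}, ℓ₃ (q i) • p i := by
    have h0 := (h fun i => ℓ₃ (q i)).2 ⟨ℓ₃, fun _ => rfl⟩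
    rw [← Fintype.sum_subtype_add_sum_subtype A, ← hp₀] at h0
    exact neg_eq_of_add_eq_zero_right h0
  obtain ⟨X, hX, hXs, hXc⟩ := hCA
  obtain ⟨Y, hY, hYs, hYc⟩ := hCB
  have hXs' : linSpan X = Submodule.span ℂ (Set.range fun i : {i // A i} => p i) := by
    rw [hXs]
    apply le_antisymm
    · rw [Submodule.span_le]
      rintro _ ⟨_ | i, rfl⟩
      · change p₀ ∈ _
        rw [hp₀]
        exact Submodule.sum_mem _ fun i _ =>
          Submodule.smul_mem _ _ (Submodule.subset_span ⟨i, rfl⟩)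
      · exact Submodule.subset_span ⟨i, rfl⟩
    · apply Submodule.span_mono
      rintro _ ⟨i, rfl⟩
      exact ⟨some i, rfl⟩
  have hYs' : linSpan Y = Submodule.span ℂ (Set.range fun i : {i // ¬ A i} => p i) := by
    rw [hYs]
    apply le_antisymm
    · rw [Submodule.span_le]
      rintro _ ⟨_ | i, rfl⟩
      · change -p₀ ∈ _
        rw [hp₀B]
        exact Submodule.sum_mem _ fun i _ =>
          Submodule.smul_mem _ _ (Submodule.subset_span ⟨i, rfl⟩)
      · exact Submodule.subset_span ⟨i, rfl⟩
    · apply Submodule.span_mono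
      rintro _ ⟨i, rfl⟩
      exact ⟨some i, rfl⟩
  have hall : ∀ i, p i ∈ cone (X ∪ Y) := by
    intro i
    rw [cone_union]
    by_cases hi : A i
    · exact Or.inl (hXc (some ⟨i, hi⟩))
    · exact Or.inr (hYc (some ⟨i, hi⟩))
  have hY0 : p₀ ∈ cone Y := by
    have := cone_smul_mem (hYc none) (-1)
    simpa using this
  refine ⟨X ∪ Y, hX.union' hY hne (hXc none) hY0 ?_, le_antisymm ?_ ?_, hall⟩
  · rintro u ⟨huX, huY⟩
    rw [SetLike.mem_coe, hXs', Submodule.mem_span_range_iff_exists_fun] at huX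
    rw [SetLike.mem_coe, hYs', Submodule.mem_span_range_iff_exists_fun] at huY
    obtain ⟨a, ha⟩ := huX
    obtain ⟨b, hb⟩ := huY
    obtain ⟨y, hy⟩ := (h fun i => if hi : A i then a ⟨i, hi⟩ else - b ⟨i, hi⟩).1 (by
      rw [← Fintype.sum_subtype_add_sum_subtype A]
      have h1 : ∑ i : {i // A i}, (if hi : A i then a ⟨i, hi⟩ else - b ⟨i, hi⟩) • p i = u := by
        rw [← ha]
        exact Finset.sum_congr rfl fun i _ => by rw [dif_pos i.2]
      have h2 : ∑ i : {i // ¬ A i}, (if hi : A i then a ⟨i, hi⟩ else - b ⟨i, hi⟩) • p i = -u := by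
        rw [← hb, ← Finset.sum_neg_distrib]
        exact Finset.sum_congr rfl fun i _ => by rw [dif_neg i.2, neg_smul]
      rw [h1, h2, add_neg_cancel])
    have h1 : u = y v • p₀ := by
      rw [← hK, ← ha]
      refine Finset.sum_congr rfl fun i _ => ?_
      rw [← hy, dif_pos i.2]
    rw [h1]
    exact Submodule.smul_mem _ _ (Submodule.mem_span_singleton_self _)
  · rw [linSpan_union, hXs', hYs', sup_le_iff]
    constructor <;>
    · apply Submodule.span_mono
      rintro _ ⟨i, rfl⟩
      exact ⟨i, rfl⟩
  · rw [Submodule.span_le, ← span_cone]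
    rintro _ ⟨i, rfl⟩
    exact Submodule.subset_span (hall i)

end Split

/-- The vectors a, b show that the planes are distinct and, with a generator v of their
intersection, form a basis; a form vanishing at v is determined by its values at a and b. -/
theorem exists_point_of_two_planes {ℓ₁ ℓ₂ : Module.Dual ℂ (Fin 3 → ℂ)} {a b : Fin 3 → ℂ}
    (ha1 : ℓ₁ a = 0) (ha2 : ℓ₂ a ≠ 0) (hb1 : ℓ₁ b ≠ 0) (hb2 : ℓ₂ b = 0) :
    ∃ (v : Fin 3 → ℂ) (ℓ₃ : Module.Dual ℂ (Fin 3 → ℂ)), ℓ₁ v = 0 ∧ ℓ₂ v = 0 ∧ ℓ₃ v = 1 ∧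
      ∀ y : Module.Dual ℂ (Fin 3 → ℂ), y v = 0 → ∃ r s : ℂ, y = r • ℓ₁ + s • ℓ₂ := by
  have hker : LinearMap.ker (ℓ₁.prod ℓ₂) ≠ ⊥ := LinearMap.ker_ne_bot_of_finrank_lt (by simp)
  obtain ⟨v, hv, hv0⟩ := (Submodule.ne_bot_iff _).1 hker
  replace hv : ℓ₁ v = 0 ∧ ℓ₂ v = 0 := Prod.mk_eq_zero.1 hv
  obtain ⟨ℓ₃, h3⟩ := Module.Projective.exists_dual_eq_one ℂ hv0
  refine ⟨v, ℓ₃, hv.1, hv.2, h3, fun y hy => ⟨y b / ℓ₁ b, y a / ℓ₂ a, ?_⟩⟩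
  have hbr : bracket v a b ≠ 0 := by
    rw [bracket_ne_zero_iff, Fintype.linearIndependent_iff]
    intro c hc
    rw [Fin.sum_univ_three] at hc
    simp only [Matrix.cons_val] at hc
    have e1 := congrArg ℓ₁ hc
    have e2 := congrArg ℓ₂ hc
    simp only [map_add, map_smul, hv, ha1, hb2, smul_eq_mul, mul_zero, zero_add, add_zero, map_zero,
      mul_eq_zero, hb1, ha2, or_false] at e1 e2
    rw [e1, e2, zero_smul, zero_smul, add_zero, add_zero] at hc
    have e0 := (smul_eq_zero.1 hc).resolve_right hv0
    intro i
    fin_cases i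
    · exact e0
    · exact e2
    · exact e1
  rw [← sub_eq_zero]
  apply dual_eq_zero_of_bracket_ne_zero hbr <;>
    simp [hv, hy, ha1, hb2, div_mul_cancel₀ _ hb1, div_mul_cancel₀ _ ha2]

theorem exists_injective_range_eq_ker {y : Module.Dual ℂ (Fin 3 → ℂ)} (hy : y ≠ 0) :
    ∃ f : (Fin 2 → ℂ) →ₗ[ℂ] (Fin 3 → ℂ), Function.Injective f ∧
      LinearMap.range f = LinearMap.ker y := by
  have h := Module.Dual.finrank_ker_add_one_of_ne_zero hy
  rw [Module.finrank_fin_fun] at h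
  let e : (Fin 2 → ℂ) ≃ₗ[ℂ] LinearMap.ker y :=
    LinearEquiv.ofFinrankEq _ _ (by rw [Module.finrank_fin_fun]; omega)
  refine ⟨(LinearMap.ker y).subtype ∘ₗ e.toLinearMap,
    (Submodule.injective_subtype _).comp e.injective, ?_⟩
  rw [LinearMap.range_comp, LinearEquiv.range, Submodule.map_top, Submodule.range_subtype]

/-! ### The inductive construction of the curve. -/

section Induction

variable {d : ℕ} {ι : Type} [Fintype ι] {p : ι → Fin (d + 1) → ℂ} {q : ι → Fin 3 → ℂ}

theorem IsGaleDual.exists_ne_of_dual_ne_zero (h : IsGaleDual p q) (hp : ∀ i, p i ≠ 0)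
    {y : Module.Dual ℂ (Fin 3 → ℂ)} {i : ι} (hi : y (q i) ≠ 0) : ∃ j, j ≠ i ∧ y (q j) ≠ 0 := by
  classical
  by_contra! hcon
  have h0 := (h fun j => y (q j)).2 ⟨y, fun _ => rfl⟩
  rw [Finset.sum_eq_single i (fun j _ hj => by rw [hcon j hj, zero_smul]) (by simp)] at h0
  exact (smul_ne_zero hi (hp i)) h0

theorem linearIndependent_pair_of_forall_ne {u v : Fin 3 → ℂ} (hv : v ≠ 0)
    (h : ∀ a : ℂ, u ≠ a • v) : LinearIndependent ℂ ![u, v] := by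
  rw [LinearIndependent.pair_iff]
  intro r s hrs
  have hr : r = 0 := by
    by_contra hr
    apply h (-s / r)
    rw [eq_comm, div_eq_inv_mul, mul_smul, inv_smul_eq_iff₀ hr, neg_smul, neg_eq_iff_add_eq_zero,
      add_comm]
    exact hrs
  rw [hr, zero_smul, zero_add] at hrs
  exact ⟨hr, (smul_eq_zero.1 hrs).resolve_right hv⟩

theorem IsGaleDual.onMinimalCurve_of_two_planes (h : IsGaleDual p q) (hp : ∀ i, p i ≠ 0)
    (hq : ∀ i, q i ≠ 0) (hpar : ∀ i j, i ≠ j → ∀ a : ℂ, q i ≠ a • q j)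
    {ℓ₁ ℓ₂ : Module.Dual ℂ (Fin 3 → ℂ)} (hℓ : ∀ i, ℓ₁ (q i) * ℓ₂ (q i) = 0)
    (h1 : ∃ i, ℓ₁ (q i) ≠ 0) (h2 : ∃ i, ℓ₂ (q i) ≠ 0)
    (IH : ∀ (κ : Type) [Fintype κ] [Nonempty κ], Fintype.card κ < Fintype.card ι →
      ∀ (p' : κ → Fin (d + 1) → ℂ) (q' : κ → Fin 3 → ℂ), IsGaleDual p' q' → (∀ i, p' i ≠ 0) →
      (∃ Q : QuadraticForm ℂ (Fin 3 → ℂ), Q ≠ 0 ∧ ∀ i, Q (q' i) = 0) → OnMinimalCurve p') :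
    OnMinimalCurve p := by
  classical
  obtain ⟨b, hb⟩ := h1
  obtain ⟨a, ha⟩ := h2
  -- No relation of nonzero vectors has exactly one nonzero coefficient, so each plane has at least
  -- two q i off the other plane. They span it, and in particular span v.
  obtain ⟨b', hbb, hb'⟩ := h.exists_ne_of_dual_ne_zero hp hb
  obtain ⟨a', haa, ha'⟩ := h.exists_ne_of_dual_ne_zero hp ha
  have hz1 : ∀ i, ℓ₂ (q i) ≠ 0 → ℓ₁ (q i) = 0 := fun i hi => (mul_eq_zero.1 (hℓ i)).resolve_right hi
  have hz2 : ∀ i, ℓ₁ (q i) ≠ 0 → ℓ₂ (q i) = 0 := fun i hi => (mul_eq_zero.1 (hℓ i)).resolve_left hi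
  obtain ⟨v, ℓ₃, hv1, hv2, hv3, hv⟩ := exists_point_of_two_planes (hz1 a ha) ha hb (hz2 b hb)
  have hℓ1 : ℓ₁ ≠ 0 := fun h0 => hb (by rw [h0]; rfl)
  have hℓ2 : ℓ₂ ≠ 0 := fun h0 => ha (by rw [h0]; rfl)
  have hvB : ∀ y : Module.Dual ℂ (Fin 3 → ℂ), (∀ i, ¬ ℓ₁ (q i) = 0 → y (q i) = 0) → y v = 0 := by
    intro y hy
    obtain ⟨r, s, hrs⟩ := exists_comb_of_bracket_eq_zero
      (linearIndependent_pair_of_forall_ne (hq b) (hpar b' b hbb))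
      (bracket_eq_zero_of_dual hℓ2 (hz2 b' hb') (hz2 b hb) hv2)
    rw [hrs, map_add, map_smul, map_smul, hy b' hb', hy b hb, smul_zero, smul_zero, add_zero]
  have hvA : ∀ y : Module.Dual ℂ (Fin 3 → ℂ), (∀ i, ℓ₁ (q i) = 0 → y (q i) = 0) → y v = 0 := by
    intro y hy
    obtain ⟨r, s, hrs⟩ := exists_comb_of_bracket_eq_zero
      (linearIndependent_pair_of_forall_ne (hq a) (hpar a' a haa))
      (bracket_eq_zero_of_dual hℓ1 (hz1 a' ha') (hz1 a ha) hv1)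
    rw [hrs, map_add, map_smul, map_smul, hy a' (hz1 a' ha'), hy a (hz1 a ha), smul_zero, smul_zero,
      add_zero]
  have hB : ∀ i, ¬ ℓ₁ (q i) = 0 → ℓ₂ (q i) = 0 := hz2
  obtain ⟨p₀, hp₀⟩ : ∃ p₀, p₀ = ∑ i : {i // ℓ₁ (q i) = 0}, ℓ₃ (q i) • p i := ⟨_, rfl⟩
  have hGA := h.split (A := fun i => ℓ₁ (q i) = 0) (fun _ hi => hi) hB hv hv3 hvB hp₀
  have hp₀B : -p₀ = ∑ i : {i // ¬ ℓ₁ (q i) = 0}, ℓ₃ (q i) • p i := by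
    have h0 := (h fun i => ℓ₃ (q i)).2 ⟨ℓ₃, fun _ => rfl⟩
    rw [← Fintype.sum_subtype_add_sum_subtype (fun i => ℓ₁ (q i) = 0), ← hp₀] at h0
    exact neg_eq_of_add_eq_zero_right h0
  have hGB := h.split (A := fun i => ¬ ℓ₁ (q i) = 0) (ℓ₁ := ℓ₂) (ℓ₂ := ℓ₁) hB
    (fun _ hi => not_not.1 hi) (fun y hy => by
      obtain ⟨r, s, hrs⟩ := hv y hy
      exact ⟨s, r, by rw [hrs, add_comm]⟩) hv3 (fun y hy => hvA y fun i hi => hy i (not_not.2 hi))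
    hp₀B
  -- If p₀ = 0, the relation 1 • p₀ = 0 is a form y with y (-v) = 1 that vanishes on the q i of A,
  -- which span v.
  have hne : p₀ ≠ 0 := by
    intro h0
    obtain ⟨y, hy⟩ := (hGA fun k => k.elim 1 fun _ => 0).1 (by simp [Fintype.sum_option, h0])
    have h4 : 1 = y (-v) := hy none
    rw [map_neg, hvA y fun i hi => (hy (some ⟨i, hi⟩)).symm, neg_zero] at h4
    exact one_ne_zero h4
  -- Both parts have at least two indices, so replacing one of them by a single new point gives a
  -- smaller family.
  have hcard := Fintype.card_subtype_compl (fun i => ℓ₁ (q i) = 0)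
  have hcA : 1 < Fintype.card {i // ℓ₁ (q i) = 0} :=
    Fintype.one_lt_card_iff.2 ⟨⟨a, hz1 a ha⟩, ⟨a', hz1 a' ha'⟩, fun h => haa (congrArg Subtype.val h).symm⟩
  have hcB : 1 < Fintype.card {i // ¬ ℓ₁ (q i) = 0} :=
    Fintype.one_lt_card_iff.2 ⟨⟨b, hb⟩, ⟨b', hb'⟩, fun h => hbb (congrArg Subtype.val h).symm⟩
  have hcle := Fintype.card_subtype_le (fun i => ℓ₁ (q i) = 0)
  refine h.onMinimalCurve_of_split (fun _ hi => hi) hB hv hv3 hp₀ hne ?_ ?_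
  -- The dual of each part, including v, lies in one plane; the double plane is its conic.
  · refine IH _ (by rw [Fintype.card_option]; omega) _ _ hGA ?_
      ⟨QuadraticMap.linMulLin ℓ₁ ℓ₁, linMulLin_ne_zero hℓ1 hℓ1, ?_⟩
    · rintro (_ | i)
      · exact hne
      · exact hp i
    · rintro (_ | i)
      · simp [hv1]
      · simp [i.2]
  · refine IH _ (by rw [Fintype.card_option]; omega) _ _ hGB ?_
      ⟨QuadraticMap.linMulLin ℓ₂ ℓ₂, linMulLin_ne_zero hℓ2 hℓ2, ?_⟩
    · rintro (_ | i)
      · exact neg_ne_zero.2 hne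
      · exact hp i
    · rintro (_ | i)
      · simp [hv2]
      · simp [hB i i.2]

/-- If q lies in a plane, or on a smooth conic, its parametrization by binary forms of degree 1 or 2
gives one rational normal curve. Otherwise the conic is a pair of planes that are both needed, and
the configuration splits. -/
theorem IsGaleDual.onMinimalCurve_of_pairwise [Nontrivial ι] (h : IsGaleDual p q)
    (hp : ∀ i, p i ≠ 0) (hpar : ∀ i j, i ≠ j → ∀ a : ℂ, q i ≠ a • q j)
    {Q : QuadraticForm ℂ (Fin 3 → ℂ)} (hQ : Q ≠ 0) (hQ0 : ∀ i, Q (q i) = 0)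
    (IH : ∀ (κ : Type) [Fintype κ] [Nonempty κ], Fintype.card κ < Fintype.card ι →
      ∀ (p' : κ → Fin (d + 1) → ℂ) (q' : κ → Fin 3 → ℂ), IsGaleDual p' q' → (∀ i, p' i ≠ 0) →
      (∃ Q : QuadraticForm ℂ (Fin 3 → ℂ), Q ≠ 0 ∧ ∀ i, Q (q' i) = 0) → OnMinimalCurve p') :
    OnMinimalCurve p := by
  have hq : ∀ i, q i ≠ 0 := by
    intro i hi
    obtain ⟨j, hj⟩ := exists_ne i
    exact hpar i j hj.symm 0 (by rw [hi, zero_smul])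
  have hplane : ∀ y : Module.Dual ℂ (Fin 3 → ℂ), y ≠ 0 → (∀ i, y (q i) = 0) →
      OnMinimalCurve p := by
    intro y hy hy0
    obtain ⟨f, hf, hfr⟩ := exists_injective_range_eq_ker hy
    refine h.onMinimalCurve_of_veroneseVector hp hq hpar one_ne_zero hf fun i => ?_
    have hi : q i ∈ LinearMap.range f := by
      rw [hfr]; exact hy0 i
    obtain ⟨w, hw⟩ := hi
    refine ⟨w 0, w 1, ?_⟩
    rw [← hw]
    congr 1
    ext k
    fin_cases k <;> simp [veroneseVector]
  rcases conic_cases hQ with ⟨ℓ₁, ℓ₂, h1, h2, hprod⟩ | ⟨f, hf, hfQ⟩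
  · by_cases e1 : ∀ i, ℓ₁ (q i) = 0
    · exact hplane ℓ₁ h1 e1
    by_cases e2 : ∀ i, ℓ₂ (q i) = 0
    · exact hplane ℓ₂ h2 e2
    push Not at e1 e2
    exact h.onMinimalCurve_of_two_planes hp hq hpar (fun i => by rw [← hprod, hQ0]) e1 e2 IH
  · exact h.onMinimalCurve_of_veroneseVector hp hq hpar two_ne_zero hf fun i => hfQ _ (hQ0 i)

end Induction

/-- Points whose Gale dual lies on a conic lie on a connected curve of minimal degree. -/
theorem onMinimalCurve_of_isGaleDual {d : ℕ} (n : ℕ) : ∀ (ι : Type) [Fintype ι] [Nonempty ι],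
    Fintype.card ι = n → ∀ (p : ι → Fin (d + 1) → ℂ) (q : ι → Fin 3 → ℂ), IsGaleDual p q →
    (∀ i, p i ≠ 0) → (∃ Q : QuadraticForm ℂ (Fin 3 → ℂ), Q ≠ 0 ∧ ∀ i, Q (q i) = 0) →
    OnMinimalCurve p := by
  induction n using Nat.strong_induction_on with
  | _ n IH =>
  intro ι _ _ hn p q h hp hQ
  classical
  rcases subsingleton_or_nontrivial ι with hs | hs
  · exact onMinimalCurve_of_subsingleton hp
  obtain ⟨Q, hQ, hQ0⟩ := hQ
  by_cases hpar : ∀ i j, i ≠ j → ∀ a : ℂ, q i ≠ a • q j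
  · refine h.onMinimalCurve_of_pairwise hp hpar hQ hQ0 ?_
    intro κ _ _ hκ
    exact IH _ (hn ▸ hκ) κ rfl
  push Not at hpar
  obtain ⟨i, j, hij, a, hq⟩ := hpar
  have hcard : ∀ k : ι, Fintype.card {l // l ≠ k} < n := by
    intro k
    rw [← hn]
    exact Fintype.card_subtype_lt (x := k) (by simp)
  have hnon : ∀ k : ι, Nonempty {l // l ≠ k} := fun k => by
    obtain ⟨l, hl⟩ := exists_ne k
    exact ⟨⟨l, hl⟩⟩
  -- In the first case p i and p j represent the same point and j is redundant; in the second a line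
  -- is split off.
  by_cases h0 : p j + a • p i = 0
  · obtain ⟨y, hy, hyk, hG⟩ := h.exists_drop hij.symm hq h0
    have := hnon j
    refine onMinimalCurve_of_drop hij h0 (IH _ (hcard j) _ rfl _ _ hG (fun k => hp k)
      ⟨QuadraticMap.linMulLin y y, linMulLin_ne_zero hy hy, fun k => ?_⟩)
    rw [QuadraticMap.linMulLin_apply, mul_self_eq_zero]
    split_ifs with hk
    · exact map_zero _
    · exact hyk k hk k.2
  · have := hnon i
    refine h.onMinimalCurve_of_merge hij.symm hq h0 (IH _ (hcard i) _ rfl _ _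
      (h.merge hij.symm hq) (fun k => ?_) ⟨Q, hQ, fun k => hQ0 k⟩)
    split_ifs with hk
    · rw [hk]; exact h0
    · rw [add_zero]; exact hp k

/-! ### Assembling the two equivalences. -/

section Main

variable {d : ℕ} {P : Fin (d + 4) → ProjSpace d}

theorem mem_of_rep_mem_cone {X : Set (ProjSpace d)} {p : ProjSpace d} (h : p.rep ∈ cone X) :
    p ∈ X := by
  obtain ⟨x, hx, hxp⟩ := exists_mem_of_mem_cone h p.rep_nonzero
  rw [← Projectivization.submodule_eq] at hxp
  exact Projectivization.submodule_injective hxp ▸ hx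

theorem exists_isGaleDual_rep (hP : ¬ OnHyperplane (Set.range P)) :
    ∃ q : Fin (d + 4) → Fin 3 → ℂ, IsGaleDual (fun k => (P k).rep) q ∧
      ∀ y : Module.Dual ℂ (Fin 3 → ℂ), (∀ i, y (q i) = 0) → y = 0 :=
  exists_isGaleDual _ (by
    rw [span_rep_eq_top hP, finrank_top, Module.finrank_fin_fun, Fintype.card_fin])

theorem PascalCondition.exists_isQuasiVeronese (h : PascalCondition P)
    (hP : ¬ OnHyperplane (Set.range P)) :
    ∃ C : Set (ProjSpace d), IsQuasiVeronese C ∧ ∀ k, P k ∈ C := by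
  obtain ⟨q, hq, -⟩ := exists_isGaleDual_rep hP
  obtain ⟨X, hX, hspan, hmem⟩ := onMinimalCurve_of_isGaleDual (d + 4) (Fin (d + 4))
    (Fintype.card_fin _) _ q hq (fun k => (P k).rep_nonzero) (h.exists_conic hq)
  rw [span_rep_eq_top hP] at hspan
  exact ⟨closure X, hX.isQuasiVeronese_closure hspan,
    fun k => subset_closure (mem_of_rep_mem_cone (hmem k))⟩

theorem IsRationalNormalCurve.pascalCondition {C : Set (ProjSpace d)}
    (hC : IsRationalNormalCurve C) (hP : ∀ k, P k ∈ C) : PascalCondition P := by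
  obtain ⟨g, hg⟩ := hC
  have hC' : C = normalCurve g.toLinearMap := hg
  have hX := (isMinimalCurve_normalCurve (g := g.toLinearMap) g.injective).isQuasiVeronese_closure
    (by rw [linSpan_normalCurve g.injective, LinearEquiv.range])
  exact pascalCondition_of_isQuasiVeronese hX fun k => subset_closure (hC' ▸ hP k)

theorem GeneralLinearPosition.not_onHyperplane (h : GeneralLinearPosition P) :
    ¬ OnHyperplane (Set.range P) := by
  obtain ⟨S, -, hS⟩ := Finset.exists_subset_card_eq (s := (Finset.univ : Finset (Fin (d + 4))))
    (n := d + 1) (by simp)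
  rintro ⟨φ, hφ, h0⟩
  exact h S hS ⟨φ, hφ, fun p hp => h0 p (Set.image_subset_range _ _ hp)⟩

/-- A form vanishing at three of the q k is a relation among the remaining d + 1 points, which are
independent. -/
theorem GeneralLinearPosition.bracket_ne_zero (h : GeneralLinearPosition P)
    {q : Fin (d + 4) → Fin 3 → ℂ} (hq : IsGaleDual (fun k => (P k).rep) q)
    (hq0 : ∀ y : Module.Dual ℂ (Fin 3 → ℂ), (∀ i, y (q i) = 0) → y = 0) {a b c : Fin (d + 4)}
    (hab : a ≠ b) (hac : a ≠ c) (hbc : b ≠ c) : bracket (q a) (q b) (q c) ≠ 0 := by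
  intro hbr
  obtain ⟨y, hy, hya, hyb, hyc⟩ := exists_dual_of_bracket_eq_zero hbr
  apply hy
  apply hq0
  set S : Finset (Fin (d + 4)) := {a, b, c}ᶜ with hS
  have hcard : S.card = d + 1 := by
    rw [hS, Finset.card_compl, Finset.card_eq_three.2 ⟨a, b, c, hab, hac, hbc, rfl⟩,
      Fintype.card_fin]
    omega
  have hspan := not_onHyperplane_iff.1 (h S hcard)
  rw [linSpan_eq_span_rep, Set.image_image, Set.image_eq_range] at hspan
  have hli := linearIndependent_of_top_le_span_of_card_eq_finrank hspan.ge (by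
    simp [hcard])
  have hli' : LinearIndepOn ℂ (fun k => (P k).rep) (S : Set (Fin (d + 4))) := hli
  rw [linearIndepOn_finset_iff] at hli'
  have hzero : ∀ k, k ∉ S → y (q k) = 0 := by
    intro k hk
    simp only [hS, Finset.mem_compl, not_not, Finset.mem_insert, Finset.mem_singleton] at hk
    rcases hk with rfl | rfl | rfl
    · exact hya
    · exact hyb
    · exact hyc
  have hsum := (hq fun k => y (q k)).2 ⟨y, fun _ => rfl⟩
  rw [← Finset.sum_subset (Finset.subset_univ S) fun k _ hk => by rw [hzero k hk, zero_smul]] at hsum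
  intro k
  by_cases hk : k ∈ S
  · exact hli' _ hsum k hk
  · exact hzero k hk

theorem exists_ne_ne (a b : Fin (d + 4)) : ∃ c, a ≠ c ∧ b ≠ c := by
  obtain ⟨c, -, hc⟩ := Finset.exists_mem_notMem_of_card_lt_card (s := {a, b})
    (t := (Finset.univ : Finset (Fin (d + 4)))) (by
      refine Finset.card_le_two.trans_lt ?_
      rw [Finset.card_univ, Fintype.card_fin]
      omega)
  rw [Finset.mem_insert, Finset.mem_singleton, not_or] at hc
  exact ⟨c, Ne.symm hc.1, Ne.symm hc.2⟩

theorem linearIndependent_pair_of_bracket_ne_zero {u v w : Fin 3 → ℂ} (h : bracket u v w ≠ 0) :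
    LinearIndependent ℂ ![u, v] := by
  rw [bracket_ne_zero_iff, Fintype.linearIndependent_iff] at h
  rw [LinearIndependent.pair_iff]
  intro r s hrs
  have h1 := h ![r, s, 0] (by rw [Fin.sum_univ_three]; simpa using hrs)
  exact ⟨h1 0, h1 1⟩

theorem GeneralLinearPosition.exists_isPascalTriple (h : GeneralLinearPosition P)
    (i : Fin 6 ↪o Fin (d + 4)) : ∃ x y z : ProjSpace d, IsPascalTriple P i x y z := by
  obtain ⟨q, hq, hq0⟩ := exists_isGaleDual_rep h.not_onHyperplane
  have hne : ∀ a b c : Fin 6, a ≠ b → a ≠ c → b ≠ c →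
      bracket (q (i a)) (q (i b)) (q (i c)) ≠ 0 := fun a b c hab hac hbc =>
    h.bracket_ne_zero hq hq0 (i.injective.ne hab) (i.injective.ne hac) (i.injective.ne hbc)
  have hcop : ∀ (a b : Fin 6) (y : Module.Dual ℂ (Fin 3 → ℂ)),
      (∀ k, k ≠ a → k ≠ b → y (q (i k)) = 0) → y = 0 := by
    intro a b y hy
    have h3 : 2 < ({a, b}ᶜ : Finset (Fin 6)).card := by
      have := Finset.card_le_two (a := a) (b := b)
      rw [Finset.card_compl, Fintype.card_fin]
      omega
    obtain ⟨u, hu, v, hv, w, hw, huv, huw, hvw⟩ := Finset.two_lt_card.1 h3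
    simp only [Finset.mem_compl, Finset.mem_insert, Finset.mem_singleton, not_or] at hu hv hw
    exact dual_eq_zero_of_bracket_ne_zero (hne u v w huv huw hvw) (hy u hu.1 hu.2) (hy v hv.1 hv.2)
      (hy w hw.1 hw.2)
  have hJ := finrank_linSpan_complementPoints hq i fun y hy => hcop 0 0 y fun k _ _ => hy k
  obtain ⟨π, hker, -⟩ := exists_projection hJ
  obtain ⟨x, y, z, hxyz, -⟩ := _root_.exists_isPascalTriple hker hJ (hq.projection i hker) hcop
    (fun a b hab => by
      obtain ⟨c, hc, hc'⟩ := exists_ne_ne (d := 2) a b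
      exact linearIndependent_pair_of_bracket_ne_zero (hne a b c hab hc hc'))
  exact ⟨x, y, z, hxyz⟩

theorem GeneralLinearPosition.exists_isRationalNormalCurve (hd : 2 ≤ d)
    (h : GeneralLinearPosition P) (hP : PascalCondition P) :
    ∃ C : Set (ProjSpace d), IsRationalNormalCurve C ∧ ∀ k, P k ∈ C := by
  classical
  obtain ⟨q, hq, hq0⟩ := exists_isGaleDual_rep h.not_onHyperplane
  obtain ⟨Q, hQ, hQ0⟩ := hP.exists_conic hq
  have hne : ∀ {a b c}, a ≠ b → a ≠ c → b ≠ c → bracket (q a) (q b) (q c) ≠ 0 :=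
    fun hab hac hbc => h.bracket_ne_zero hq hq0 hab hac hbc
  have hfew : ∀ y : Module.Dual ℂ (Fin 3 → ℂ), y ≠ 0 →
      (Finset.univ.filter fun k => y (q k) = 0).card ≤ 2 := by
    intro y hy
    by_contra! hlt
    obtain ⟨a, ha, b, hb, c, hc, hab, hac, hbc⟩ := Finset.two_lt_card.1 hlt
    exact hy (dual_eq_zero_of_bracket_ne_zero (hne hab hac hbc) (Finset.mem_filter.1 ha).2
      (Finset.mem_filter.1 hb).2 (Finset.mem_filter.1 hc).2)
  rcases conic_cases hQ with ⟨ℓ₁, ℓ₂, h1, h2, hprod⟩ | ⟨f, hf, hfQ⟩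
  -- Each of the two planes contains at most two of the d + 4 vectors.
  · exfalso
    have hcover : (Finset.univ.filter fun k => ℓ₁ (q k) = 0) ∪
        (Finset.univ.filter fun k => ℓ₂ (q k) = 0) = Finset.univ := by
      ext k
      have hk := hQ0 k
      rw [hprod, mul_eq_zero] at hk
      simpa using hk
    have hle := Finset.card_union_le (Finset.univ.filter fun k => ℓ₁ (q k) = 0)
      (Finset.univ.filter fun k => ℓ₂ (q k) = 0)
    rw [hcover, Finset.card_univ, Fintype.card_fin] at hle
    have := hfew ℓ₁ h1
    have := hfew ℓ₂ h2
    omega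
  · have hqst := fun k => hfQ (q k) (hQ0 k)
    choose s t hst using hqst
    have hli : ∀ a b, a ≠ b → LinearIndependent ℂ ![q a, q b] := fun a b hab => by
      obtain ⟨c, hc, hc'⟩ := exists_ne_ne a b
      exact linearIndependent_pair_of_bracket_ne_zero (hne hab hc hc')
    obtain ⟨hpw, hst0⟩ := pairwise_of_veroneseVector two_ne_zero hst
      (fun a => by
        obtain ⟨b, hb, -⟩ := exists_ne_ne a a
        exact (hli a b hb).ne_zero 0)
      (fun a b hab r hr => by
        have := (LinearIndependent.pair_iff.1 (hli a b hab)) 1 (-r) (by rw [hr]; module)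
        exact one_ne_zero this.1)
    -- For e = 2 the count d + 4 = n + e + 2 gives n = d, so g is an injective endomorphism and
    -- hence an automorphism.
    obtain ⟨g, b, hg, hb, hpg, -⟩ := (hq.of_injective hf hst).exists_normalCurve hpw hst0 (n := d)
      (by rw [Fintype.card_fin])
    refine ⟨normalCurve g, ⟨LinearEquiv.ofInjectiveEndo g hg, rfl⟩, fun k => ⟨s k, t k, hst0 k, ?_⟩⟩
    rw [Projectivization.submodule_eq, hpg, Submodule.span_singleton_smul_eq (hb k).isUnit]

end Main

theorem corollary5p2 (d : ℕ) (hd : 2 ≤ d) (P : Fin (d + 4) → ProjSpace d) :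
    (¬ OnHyperplane (Set.range P) →
      ((∃ C : Set (ProjSpace d), IsQuasiVeronese C ∧ ∀ k, P k ∈ C) ↔ PascalCondition P)) ∧
    (GeneralLinearPosition P →
      (∀ i : Fin 6 ↪o Fin (d + 4), ∃ x y z : ProjSpace d, IsPascalTriple P i x y z) ∧
      ((∃ C : Set (ProjSpace d), IsRationalNormalCurve C ∧ ∀ k, P k ∈ C) ↔
        PascalCondition P)) := by
  refine ⟨fun hP => ⟨?_, fun h => h.exists_isQuasiVeronese hP⟩, fun hP =>
    ⟨hP.exists_isPascalTriple, ?_, hP.exists_isRationalNormalCurve hd⟩⟩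
  · rintro ⟨C, hC, h⟩
    exact pascalCondition_of_isQuasiVeronese hC h
  · rintro ⟨C, hC, h⟩
    exact hC.pascalCondition h
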